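/- Let $k\ge 2$. For $x\in[q]^n$, a $k$-collision is a set of $k$ positions of $x$ carrying equal values; the $k$-distinctness problem is to decide whether $x$ contains a $k$-collision. For $S\subseteq[n]$ and $1\le i\le k$, let $S_i$ be the set of $j\in S$ such that exactly $i$ elements $j'\in S$ satisfy $x_{j'}=x_j$; the type of $S$ is $(|S_1|/1,\dots,|S_k|/k)$. For positive integers $r_1,\dots,r_{k-1}$ let $V_0$ be the set of all $S\subseteq[n]$ of type $(r_1,\dots,r_{k-1},0)$. Given one copy of the uniform superposition $\frac1{\sqrt{|V_0|}}\sum_{S\in V_0}|S\rangle$ over $V_0$, the $k$-distinctness problem can be solved in quantum time $\tilde O\bigl(n/\sqrt{\min\{r_1,\dots,r_{k-1}\}}\bigr)$. Precisely: for every $k\ge2$ there are a single program of a quantum random access machine with coherently addressable quantum memory and integers $c\ge1$, $C,d\ge0$, all depending only on $k$, such that the following holds for all $n,q$, all positive integers $r_1,\dots,r_{k-1}$ (in particular when $r_i=o(n)$) and all $x\in[q]^n$ with $V_0\ne\emptyset$. The machine has words of $c\lceil\log_2(n+q+1)\rceil$ bits; its unit-cost steps are word operations on classical registers, with classical control of branching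 and loops, reversible word operations on quantum registers, Hadamard and Pauli $Z$ gates on single bits, exchange of a quantum register with the memory cell it addresses in superposition, and oracle queries to $x$. It is started with $n,q,r_1,\dots,r_{k-1}$ in its classical registers, its quantum registers zero, and the above superposition in its memory. Here $|S\rangle$ is a data structure determined by $k$, $S$ and $(x_j)_{j\in S}$: tables giving, for each $a\in[q]$, the number of $j\in S$ with $x_j=a$, and, for each $j\in[n]$, whether $j\in S$ and if so $x_j$, together with $|S|$ and the type of $S$. Then the program halts after at most $$C\,\frac{n}{\sqrt{\min\{r_1,\dots,r_{k-1}\}}}\,\bigl(\ln(n+2)\bigr)^d$$ steps, and a final measurement accepts with probability at least $2/3$ if $x$ contains a $k$-collision, and with probability at most $1/3$ otherwise. -/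

import Mathlib

namespace QRam

/-! ### A quantum random access machine with quantum memory (QRAQM)

The machine has words of `w` bits.  It consists of
* classical registers, indexed by `ℕ`, which alone govern the flow of control;
* `m + 1` quantum registers, each holding a word;
* a quantum memory of `2 ^ w` words, which can be addressed in superposition;
* coherent access to an input oracle `O`.
Every instruction and every test of a loop or branching has cost one. -/

/-- The arithmetical and logical operations on words (modulo `2 ^ w`). -/
inductive BinOp where
  | and | or | xor | add | sub | mul | shiftLeft | shiftRight | lt | eq

/-- The value of a word operation; comparisons return the word `1` (true) or `0` (false). -/
def BinOp.eval {w : ℕ} : BinOp → BitVec w → BitVec w → BitVec w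
  | .and, a, b => a &&& b
  | .or, a, b => a ||| b
  | .xor, a, b => a ^^^ b
  | .add, a, b => a + b
  | .sub, a, b => a - b
  | .mul, a, b => a * b
  | .shiftLeft, a, b => a <<< b.toNat
  | .shiftRight, a, b => a >>> b.toNat
  | .lt, a, b => if a.toNat < b.toNat then 1 else 0
  | .eq, a, b => if a = b then 1 else 0

/-- Elementary quantum instructions.  Arguments of type `Fin (m + 1)` are quantum registers,
arguments of type `ℕ` are classical registers. -/
inductive Gate (m : ℕ) where
  /-- xor the content of the classical register `c` into the quantum register `i` -/
  | load (i : Fin (m + 1)) (c : ℕ)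
  /-- xor the value of `o` at the quantum registers `j`, `l` into the quantum register `i`
  (no effect if `i` is one of `j`, `l`) -/
  | op (o : BinOp) (i j l : Fin (m + 1))
  /-- exchange the quantum register `i` with the memory cell addressed by the quantum
  register `j` (no effect if `i = j`) -/
  | swap (i j : Fin (m + 1))
  /-- xor the answer of the oracle to the content of the quantum register `j` into the quantum
  register `i` (no effect if `i = j`) -/
  | query (i j : Fin (m + 1))
  /-- the Hadamard gate on that bit of the quantum register `i` whose position is stored in the
  classical register `c` (no effect if there is no such bit) -/
  | had (i : Fin (m + 1)) (c : ℕ)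
  /-- the Pauli Z gate on the lowest bit of the quantum register `i` -/
  | phase (i : Fin (m + 1))

/-- A computational basis state: the contents of the quantum registers and of the memory. -/
abbrev Basis (w m : ℕ) : Type := (Fin (m + 1) → BitVec w) × (BitVec w → BitVec w)

/-- Replace the quantum register `i` of a basis state by its xor with `v`. -/
def xorReg {w m : ℕ} (i : Fin (m + 1)) (v : BitVec w) (s : Basis w m) : Basis w m :=
  (Function.update s.1 i (s.1 i ^^^ v), s.2)

/-- Exchange the quantum register `i` with the memory cell with address `a`. -/
def swapMem {w m : ℕ} (i : Fin (m + 1)) (a : BitVec w) (s : Basis w m) : Basis w m :=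
  (Function.update s.1 i (s.2 a), Function.update s.2 a (s.1 i))

/-- The unitary operation performed by an instruction, given the oracle `O` and the contents `cl`
of the classical registers.  The instructions that permute the basis states act by involutions,
so that the new amplitude of `s` is the old amplitude of the image of `s`. -/
noncomputable def Gate.apply {w m : ℕ} (O : BitVec w → BitVec w) (cl : ℕ → BitVec w) :
    Gate m → (Basis w m → ℂ) → (Basis w m → ℂ)
  | .load i c, ψ => fun s => ψ (xorReg i (cl c) s)
  | .op o i j l, ψ => fun s =>
      if i = j ∨ i = l then ψ s else ψ (xorReg i (o.eval (s.1 j) (s.1 l)) s)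
  | .swap i j, ψ => fun s => if i = j then ψ s else ψ (swapMem i (s.1 j) s)
  | .query i j, ψ => fun s => if i = j then ψ s else ψ (xorReg i (O (s.1 j)) s)
  | .had i c, ψ => fun s =>
      let b := (cl c).toNat
      let flipped := xorReg i (BitVec.twoPow w b) s
      if b < w then
        (if (s.1 i).getLsbD b then ψ flipped - ψ s else ψ s + ψ flipped) / (Real.sqrt 2 : ℂ)
      else ψ s
  | .phase i, ψ => fun s => if (s.1 i).getLsbD 0 then -ψ s else ψ s

/-- Programs.  A program is a finite text that depends neither on the word length nor on the
input. -/
inductive Prog (m : ℕ) where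
  /-- do nothing -/
  | skip
  /-- store the constant `v` in the classical register `c` -/
  | const (c v : ℕ)
  /-- store the value of `o` at the classical registers `a`, `b` in the classical register `c` -/
  | arith (o : BinOp) (c a b : ℕ)
  /-- perform a quantum instruction -/
  | gate (g : Gate m)
  /-- sequential composition -/
  | seq (p p₂ : Prog m)
  /-- if the classical register `c` is nonzero then `p` else `p₂` -/
  | ite (c : ℕ) (p p₂ : Prog m)
  /-- while the classical register `c` is nonzero do `p` -/
  | loop (c : ℕ) (p : Prog m)

/-- A state of the machine: the classical registers, and the amplitudes of the basis states. -/
abbrev State (w m : ℕ) : Type := (ℕ → BitVec w) × (Basis w m → ℂ)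

/-- `Runs O p s t s₂`: with oracle `O`, the program `p` started in the state `s` halts in the
state `s₂`, after exactly `t` steps. -/
inductive Runs {w m : ℕ} (O : BitVec w → BitVec w) :
    Prog m → State w m → ℕ → State w m → Prop
  | skip (s : State w m) : Runs O .skip s 1 s
  | const (c v : ℕ) (s : State w m) :
      Runs O (.const c v) s 1 (Function.update s.1 c (BitVec.ofNat w v), s.2)
  | arith (o : BinOp) (c a b : ℕ) (s : State w m) :
      Runs O (.arith o c a b) s 1 (Function.update s.1 c (o.eval (s.1 a) (s.1 b)), s.2)
  | gate (g : Gate m) (s : State w m) : Runs O (.gate g) s 1 (s.1, g.apply O s.1 s.2)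
  | seq {p p₂ : Prog m} {s s₁ s₂ : State w m} {t t₂ : ℕ} :
      Runs O p s t s₁ → Runs O p₂ s₁ t₂ s₂ → Runs O (.seq p p₂) s (t + t₂) s₂
  | iteTrue {c : ℕ} {p p₂ : Prog m} {s s₁ : State w m} {t : ℕ} :
      s.1 c ≠ 0 → Runs O p s t s₁ → Runs O (.ite c p p₂) s (1 + t) s₁
  | iteFalse {c : ℕ} {p p₂ : Prog m} {s s₁ : State w m} {t : ℕ} :
      s.1 c = 0 → Runs O p₂ s t s₁ → Runs O (.ite c p p₂) s (1 + t) s₁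
  | loopTrue {c : ℕ} {p : Prog m} {s s₁ s₂ : State w m} {t t₂ : ℕ} :
      s.1 c ≠ 0 → Runs O p s t s₁ → Runs O (.loop c p) s₁ t₂ s₂ →
      Runs O (.loop c p) s (1 + t + t₂) s₂
  | loopFalse {c : ℕ} {p : Prog m} {s : State w m} :
      s.1 c = 0 → Runs O (.loop c p) s 1 s

/-- The probability that a measurement of the quantum register `0` gives `1`. -/
noncomputable def acceptProb {w m : ℕ} (s : State w m) : ℝ :=
  ∑ b : Basis w m, if b.1 0 = 1 then ‖s.2 b‖ ^ 2 else 0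

end QRam

namespace KDistinctness

variable {n q : ℕ}

/-- The input `x` contains a `k`-collision: `k` positions that carry equal values. -/
def HasCollision (k : ℕ) (x : Fin n → Fin q) : Prop :=
  ∃ J : Finset (Fin n), J.card = k ∧ ∀ i ∈ J, ∀ j ∈ J, x i = x j

/-- `S_i`: the elements of `S` whose value occurs exactly `i` times in `S`. -/
def part (x : Fin n → Fin q) (S : Finset (Fin n)) (i : ℕ) : Finset (Fin n) :=
  S.filter fun j => (S.filter fun l => x l = x j).card = i

/-- The type `(r_1, …, r_k)` of `S`, where `r_i = |S_i| / i`; the entry at `i : Fin k` is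
`r_{i+1}`. -/
def setType (k : ℕ) (x : Fin n → Fin q) (S : Finset (Fin n)) : Fin k → ℕ :=
  fun i => (part x S (i + 1)).card / (i + 1)

/-- The tuple `(r_1, …, r_{k-1}, 0)`. -/
def startType (k : ℕ) (r : Fin (k - 1) → ℕ) : Fin k → ℕ :=
  fun i => if h : (i : ℕ) < k - 1 then r ⟨i, h⟩ else 0

/-- The collection `V_0` of all subsets of type `(r_1, …, r_{k-1}, 0)`. -/
def startSets (k : ℕ) (r : Fin (k - 1) → ℕ) (x : Fin n → Fin q) : Finset (Finset (Fin n)) :=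
  Finset.univ.filter fun S => setType k x S = startType k r

/-- The oracle for the input `x`: the address `j < n` is answered by the value `x_j`. -/
def oracle (w : ℕ) (x : Fin n → Fin q) : BitVec w → BitVec w :=
  fun a => if h : a.toNat < n then BitVec.ofNat w (x ⟨a.toNat, h⟩) else 0

/-- The memory contents representing the data structure for `S`; it depends only on `S` and on
the values `x_j`, `j ∈ S`.
* The cell `a < q` holds the number of `j ∈ S` such that `x_j = a`.
* The cell `q + j` with `j < n` holds `x_j + 1` if `j ∈ S`, and `0` otherwise.
* The cell `q + n` holds the size of `S`.
* The cells `q + n + 1, …, q + n + k` hold the type of `S`.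
All other cells hold `0`. -/
def dataStructure (w k : ℕ) (x : Fin n → Fin q) (S : Finset (Fin n)) : BitVec w → BitVec w :=
  fun a =>
    if a.toNat < q then BitVec.ofNat w (S.filter fun j => (x j : ℕ) = a.toNat).card
    else if h : a.toNat - q < n then
      if (⟨a.toNat - q, h⟩ : Fin n) ∈ S then BitVec.ofNat w ((x ⟨a.toNat - q, h⟩ : ℕ) + 1) else 0
    else if a.toNat = q + n then BitVec.ofNat w S.card
    else if h : a.toNat - (q + n + 1) < k then
      BitVec.ofNat w (setType k x S ⟨a.toNat - (q + n + 1), h⟩)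
    else 0

/-- The parameters `n, q, r_1, …, r_{k-1}` in the classical registers `0, 1, 2, …, k`. -/
def parameters (w k n q : ℕ) (r : Fin (k - 1) → ℕ) : ℕ → BitVec w
  | 0 => BitVec.ofNat w n
  | 1 => BitVec.ofNat w q
  | i + 2 => if h : i < k - 1 then BitVec.ofNat w (r ⟨i, h⟩) else 0

/-- The initial state of the machine: the parameters are in the classical registers, the quantum
registers are zero, and the memory is in the uniform superposition, over all `S` in `V_0`, of the
data structures for `S`. -/
noncomputable def initialState (w m k : ℕ) (r : Fin (k - 1) → ℕ) (x : Fin n → Fin q) :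
    QRam.State w m :=
  (parameters w k n q r,
    fun b => ((Real.sqrt (startSets k r x).card : ℝ) : ℂ)⁻¹ *
      ∑ S ∈ startSets k r x, if b = (0, dataStructure w k x S) then 1 else 0)

end KDistinctness

/-!
The algorithm is a quantum walk that looks for an invariant vector by averaging over time.

*The walk.*  A vertex is a set `S` that arises from a starting set (a member of `V_0`) by adding `d`
elements of a single value, together with `d` and the multiplicity `c` of this value (`Vertex`).
Vertices with `c = k` exhibit a collision and are marked.  Each vertex has `2 ^ L` directions, with
`2 ^ s` of them for each position of the input; the direction of a position adds it to `S` or removes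
it (`move`).  One step of the walk (`walk`) is a coin, which reflects about the uniform superposition
of the directions at unmarked vertices and is `-1` at marked ones, followed by the move and by a sign
`-1` for the loop `0` at the starting vertices and at the marked ones.  The walk starts in
`ψ = startVector`, the uniform superposition of the starting vertices with the direction `0`, and one
looks at the average of its orbit over `T` steps.

*With a collision*, send a flow from each starting set to a marked vertex by adding, one after the
other, the elements of a fixed collision.  The vector `φ` consisting of `ψ` and this flow is
invariant under the walk (`walk_flowVector`), `⟨φ, ψ⟩ = 1`, and `‖φ‖² ≤ 3 / 2`, because the flow is
spread over `2 ^ s` parallel edges and at most `2 ^ k` paths share an edge.  Hence the average of the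
orbit of `ψ` has squared norm at least `2 / 3` (`le_dot_average_of_hasCollision`).

*Without collisions*, no marked vertex is ever reached.  The uniform vector `η` on the reached
vertices changes under a step only at the loops `0` of the starting vertices, so that `ψ = η - U η`
when scaled suitably; the sum over the orbit telescopes, and its average has squared norm at most
`4 ‖η‖² / T²`.  A double counting (`card_layer_mul_le`) shows that the number of reached vertices is
`O(n / min r_i)` times the number of starting sets.  Thus `T = O(n / √(min r_i))` steps make the
average small (`dot_average_le_of_not_hasCollision`).

*The machine.*  A register in the uniform superposition of the times `t < T = 2 ^ a` controls for how
many steps the walk runs; after the inverse Hadamard transform the probability that this register is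
zero is the squared norm of the average (`runs_quantumProg`).  States of the machine are described
as superpositions `embed enc φ` of basis states `enc x` with amplitudes `φ x`; lists of reversible
instructions act on `enc`, phases and Hadamard gates act on `φ`.  A step costs `O(L)` for the Hadamard
transforms of the direction and `O(1)` for the move, since the data structure supports the lookups in
constant time.  The constants, `L` and `T` are computed from the parameters by a classical prelude
(`runs_classicalProg`).
-/


namespace QRam

variable {w m : ℕ}

/-! ### Lists of quantum instructions, and superpositions of encoded states -/

theorem Runs.cast {O : BitVec w → BitVec w} {p : Prog m} {s s' : State w m} {t t' : ℕ}
    (h : Runs O p s t s') (e : t = t') : Runs O p s t' s' := e ▸ h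

/-- The program that performs a list of quantum instructions. -/
def Prog.ofGates : List (Gate m) → Prog m
  | [] => .skip
  | g :: l => .seq (.gate g) (ofGates l)

/-- The joint effect of a list of quantum instructions on the amplitudes. -/
noncomputable def applyGates (O : BitVec w → BitVec w) (cl : ℕ → BitVec w) :
    List (Gate m) → (Basis w m → ℂ) → (Basis w m → ℂ)
  | [], ψ => ψ
  | g :: l, ψ => applyGates O cl l (g.apply O cl ψ)

theorem applyGates_append (O : BitVec w → BitVec w) (cl : ℕ → BitVec w) (l l' : List (Gate m))
    (ψ : Basis w m → ℂ) :
    applyGates O cl (l ++ l') ψ = applyGates O cl l' (applyGates O cl l ψ) := by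
  induction l generalizing ψ with
  | nil => rfl
  | cons g l ih => exact ih _

theorem runs_ofGates (O : BitVec w → BitVec w) (l : List (Gate m)) (s : State w m) :
    Runs O (Prog.ofGates l) s (l.length + 1) (s.1, applyGates O s.1 l s.2) := by
  induction l generalizing s with
  | nil => exact Runs.skip s
  | cons g l ih =>
    have h := Runs.seq (Runs.gate (O := O) g s) (ih (s.1, g.apply O s.1 s.2))
    rw [List.length_cons]
    rwa [add_comm 1] at h

/-- The map of basis states that an instruction other than `had` and `phase` performs. -/
def Gate.act (O : BitVec w → BitVec w) (cl : ℕ → BitVec w) : Gate m → Basis w m → Basis w m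
  | .load i c => fun s => xorReg i (cl c) s
  | .op o i j l => fun s => if i = j ∨ i = l then s else xorReg i (o.eval (s.1 j) (s.1 l)) s
  | .swap i j => fun s => if i = j then s else swapMem i (s.1 j) s
  | .query i j => fun s => if i = j then s else xorReg i (O (s.1 j)) s
  | .had _ _ => id
  | .phase _ => id

/-- The instruction permutes the basis states. -/
def Gate.IsPerm : Gate m → Prop
  | .had _ _ => False
  | .phase _ => False
  | _ => True

theorem xorReg_xorReg (i : Fin (m + 1)) (u v : BitVec w) (s : Basis w m) :
    xorReg i u (xorReg i v s) = xorReg i (u ^^^ v) s := by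
  simp [xorReg, BitVec.xor_assoc, BitVec.xor_comm v u]

theorem xorReg_zero (i : Fin (m + 1)) (s : Basis w m) : xorReg i 0 s = s := by
  simp [xorReg]

theorem xorReg_self (i : Fin (m + 1)) (v : BitVec w) (s : Basis w m) :
    xorReg i v (xorReg i v s) = s := by
  rw [xorReg_xorReg, BitVec.xor_self]; exact xorReg_zero i s

theorem xorReg_fst_of_ne {i j : Fin (m + 1)} (h : j ≠ i) (v : BitVec w) (s : Basis w m) :
    (xorReg i v s).1 j = s.1 j := by
  simp [xorReg, h]

theorem Gate.act_involutive (O : BitVec w → BitVec w) (cl : ℕ → BitVec w) (g : Gate m) :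
    Function.Involutive (g.act O cl) := by
  intro s
  cases g with
  | load i c => exact xorReg_self _ _ _
  | op o i j l =>
    by_cases h : i = j ∨ i = l
    · simp [Gate.act, h]
    · have h' := not_or.1 h
      simp only [Gate.act, if_neg h]
      rw [xorReg_fst_of_ne (Ne.symm h'.1), xorReg_fst_of_ne (Ne.symm h'.2), xorReg_self]
  | swap i j =>
    by_cases h : i = j
    · simp [Gate.act, h]
    · simp only [Gate.act, if_neg h]
      have : j ≠ i := Ne.symm h
      simp [swapMem, this]
  | query i j =>
    by_cases h : i = j
    · simp [Gate.act, h]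
    · simp only [Gate.act, if_neg h]
      rw [xorReg_fst_of_ne (Ne.symm h), xorReg_self]
  | had i c => rfl
  | phase i => rfl

theorem Gate.apply_of_isPerm (O : BitVec w → BitVec w) (cl : ℕ → BitVec w) {g : Gate m}
    (hg : g.IsPerm) (ψ : Basis w m → ℂ) : g.apply O cl ψ = ψ ∘ g.act O cl := by
  funext s
  cases g with
  | load i c => rfl
  | op o i j l => simp only [Gate.apply, Gate.act, Function.comp]; split_ifs <;> rfl
  | swap i j => simp only [Gate.apply, Gate.act, Function.comp]; split_ifs <;> rfl
  | query i j => simp only [Gate.apply, Gate.act, Function.comp]; split_ifs <;> rfl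
  | had i c => exact hg.elim
  | phase i => exact hg.elim

/-- The vector in which the basis state `enc x` has amplitude `φ x`, and every basis state not of
this form has amplitude zero. -/
noncomputable def embed {X : Type*} (enc : X → Basis w m) (φ : X → ℝ) : Basis w m → ℂ :=
  Function.extend enc (fun x => (φ x : ℂ)) 0

variable {X : Type*}

theorem embed_apply {enc : X → Basis w m} (h : Function.Injective enc) (φ : X → ℝ) (x : X) :
    embed enc φ (enc x) = φ x := h.extend_apply _ _ _

theorem embed_of_notMem {enc : X → Basis w m} (φ : X → ℝ) {b : Basis w m}
    (h : ¬ ∃ x, enc x = b) : embed enc φ b = 0 := Function.extend_apply' _ _ _ h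

/-- The amplitudes move along with the basis states: the machine composes the amplitudes with `f`,
and this replaces the encoding `enc` by `f ∘ enc`. -/
theorem embed_comp_involutive (enc : X → Basis w m) (φ : X → ℝ) {f : Basis w m → Basis w m}
    (hf : Function.Involutive f) : embed enc φ ∘ f = embed (f ∘ enc) φ := by
  funext b
  have : ∀ x, (enc x = f b) = ((f ∘ enc) x = b) := fun x => by
    rw [Function.comp]
    exact propext ⟨fun h => by rw [h, hf b], fun h => by rw [← h, hf]⟩
  -- the function `Function.extend` depends on `b` only through the predicate `enc x = b`
  have key : ∀ p p' : X → Prop, p = p' →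
      (@dite ℂ (∃ a, p a) (Classical.propDecidable _) (fun h => (φ (Classical.choose h) : ℂ))
        fun _ => 0) =
      (@dite ℂ (∃ a, p' a) (Classical.propDecidable _) (fun h => (φ (Classical.choose h) : ℂ))
        fun _ => 0) := by
    rintro p _ rfl; rfl
  exact key _ _ (funext this)

/-- Re-indexing along a permutation of the index set. -/
theorem embed_comp_involutive_index (enc : X → Basis w m) (φ : X → ℝ) {f : X → X}
    (henc : Function.Injective enc) (hf : Function.Involutive f) :
    embed (enc ∘ f) φ = embed enc (φ ∘ f) := by
  funext b
  by_cases h : ∃ x, enc x = b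
  · obtain ⟨x, rfl⟩ := h
    rw [embed_apply henc, ← hf x]
    have := embed_apply (henc.comp hf.injective) φ (f x)
    simpa [hf x] using this
  · rw [embed_of_notMem _ h, embed_of_notMem]
    rintro ⟨x, hx⟩
    exact h ⟨f x, hx⟩

/-- Enlarging the index set. -/
theorem embed_comp_injective {Y : Type*} (enc : X → Basis w m) {ι : Y → X} (φ : Y → ℝ)
    (henc : Function.Injective enc) (hι : Function.Injective ι) :
    embed (enc ∘ ι) φ = embed enc (Function.extend ι φ 0) := by
  funext b
  by_cases h : ∃ x, enc x = b
  · obtain ⟨x, rfl⟩ := h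
    rw [embed_apply henc]
    by_cases h' : ∃ y, ι y = x
    · obtain ⟨y, rfl⟩ := h'
      rw [hι.extend_apply]
      exact embed_apply (henc.comp hι) φ y
    · rw [Function.extend_apply' _ _ _ h', embed_of_notMem]
      · simp
      · rintro ⟨y, hy⟩
        exact h' ⟨y, henc hy⟩
  · rw [embed_of_notMem _ h, embed_of_notMem]
    rintro ⟨x, hx⟩
    exact h ⟨ι x, hx⟩

/-- The joint effect of instructions that permute the basis states. -/
def actGates (O : BitVec w → BitVec w) (cl : ℕ → BitVec w) (l : List (Gate m))
    (b : Basis w m) : Basis w m := l.foldl (fun b g => g.act O cl b) b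

theorem actGates_append (O : BitVec w → BitVec w) (cl : ℕ → BitVec w) (l l' : List (Gate m))
    (b : Basis w m) : actGates O cl (l ++ l') b = actGates O cl l' (actGates O cl l b) := by
  simp [actGates]

theorem actGates_cons (O : BitVec w → BitVec w) (cl : ℕ → BitVec w) (g : Gate m)
    (l : List (Gate m)) (b : Basis w m) :
    actGates O cl (g :: l) b = actGates O cl l (g.act O cl b) := rfl

theorem applyGates_embed (O : BitVec w → BitVec w) (cl : ℕ → BitVec w) (l : List (Gate m))
    (hl : ∀ g ∈ l, g.IsPerm) (enc : X → Basis w m) (φ : X → ℝ) :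
    applyGates O cl l (embed enc φ) = embed (actGates O cl l ∘ enc) φ := by
  induction l generalizing enc with
  | nil => rfl
  | cons g l ih =>
    simp only [List.forall_mem_cons] at hl
    rw [applyGates, Gate.apply_of_isPerm O cl hl.1,
      embed_comp_involutive _ _ (g.act_involutive O cl), ih hl.2]
    rfl

theorem apply_phase_embed (O : BitVec w → BitVec w) (cl : ℕ → BitVec w) (i : Fin (m + 1))
    (enc : X → Basis w m) (henc : Function.Injective enc) (φ : X → ℝ) :
    (Gate.phase i).apply O cl (embed enc φ) =
      embed enc fun x => (if ((enc x).1 i).getLsbD 0 then -1 else 1) * φ x := by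
  funext b
  by_cases h : ∃ x, enc x = b
  · obtain ⟨x, rfl⟩ := h
    rw [embed_apply henc]
    simp only [Gate.apply, embed_apply henc]
    split_ifs <;> simp
  · simp only [Gate.apply, embed_of_notMem _ h]
    simp

/-! ### Hadamard transforms of a register -/

/-- The Hadamard gate on the bit `b` of a word, as an operation on amplitudes. -/
noncomputable def hd (b : ℕ) (f : BitVec w → ℝ) : BitVec w → ℝ := fun g =>
  (if g.getLsbD b then f (g ^^^ BitVec.twoPow w b) - f g
    else f g + f (g ^^^ BitVec.twoPow w b)) / Real.sqrt 2

/-- The Hadamard gates on the bits `b < L`, starting with bit `0`. -/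
noncomputable def hdAsc : ℕ → (BitVec w → ℝ) → (BitVec w → ℝ)
  | 0, f => f
  | L + 1, f => hd L (hdAsc L f)

/-- The Hadamard gates on the bits `b < L`, ending with bit `0`. -/
noncomputable def hdDesc : ℕ → (BitVec w → ℝ) → (BitVec w → ℝ)
  | 0, f => f
  | L + 1, f => hdDesc L (hd L f)

theorem getLsbD_xor_twoPow_self {b : ℕ} (hb : b < w) (g : BitVec w) :
    (g ^^^ BitVec.twoPow w b).getLsbD b = !g.getLsbD b := by
  simp [hb]

theorem xor_twoPow_xor_twoPow (b : ℕ) (g : BitVec w) :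
    g ^^^ BitVec.twoPow w b ^^^ BitVec.twoPow w b = g := by
  rw [BitVec.xor_assoc, BitVec.xor_self, BitVec.xor_zero]

theorem hd_hd {b : ℕ} (hb : b < w) (f : BitVec w → ℝ) : hd b (hd b f) = f := by
  funext g
  have h2 : Real.sqrt 2 * Real.sqrt 2 = 2 := Real.mul_self_sqrt (by norm_num)
  have h0 : Real.sqrt 2 ≠ 0 := by positivity
  simp only [hd, getLsbD_xor_twoPow_self hb, xor_twoPow_xor_twoPow]
  by_cases h : g.getLsbD b
  · simp only [h, Bool.not_true, Bool.false_eq_true, if_false, if_true]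
    field_simp
    rw [pow_two, h2]; ring
  · simp only [h, Bool.not_false, Bool.false_eq_true, if_false, if_true]
    field_simp
    rw [pow_two, h2]; ring

theorem hdAsc_hdDesc {L : ℕ} (hL : L ≤ w) (f : BitVec w → ℝ) : hdAsc L (hdDesc L f) = f := by
  induction L generalizing f with
  | zero => rfl
  | succ L ih => rw [hdDesc, hdAsc, ih (by omega), hd_hd (by omega)]

theorem hd_add (b : ℕ) (f g : BitVec w → ℝ) : hd b (f + g) = hd b f + hd b g := by
  funext x
  simp only [hd, Pi.add_apply]
  split_ifs <;> ring

theorem hd_smul (b : ℕ) (c : ℝ) (f : BitVec w → ℝ) : hd b (c • f) = c • hd b f := by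
  funext x
  simp only [hd, Pi.smul_apply, smul_eq_mul]
  split_ifs <;> ring

theorem hdAsc_add (L : ℕ) (f g : BitVec w → ℝ) : hdAsc L (f + g) = hdAsc L f + hdAsc L g := by
  induction L with
  | zero => rfl
  | succ L ih => rw [hdAsc, ih, hd_add]; rfl

theorem hdAsc_smul (L : ℕ) (c : ℝ) (f : BitVec w → ℝ) : hdAsc L (c • f) = c • hdAsc L f := by
  induction L with
  | zero => rfl
  | succ L ih => rw [hdAsc, ih, hd_smul]; rfl

theorem toNat_xor_twoPow_of_lt {b : ℕ} (hb : b < w) {g : BitVec w} (hg : g.toNat < 2 ^ b) :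
    (g ^^^ BitVec.twoPow w b).toNat = g.toNat + 2 ^ b := by
  have h : (BitVec.twoPow w b).toNat = 2 ^ b := by
    rw [BitVec.toNat_twoPow, Nat.mod_eq_of_lt (Nat.pow_lt_pow_right (by norm_num) hb)]
  rw [BitVec.toNat_xor, h]
  apply Nat.eq_of_testBit_eq
  intro i
  rw [Nat.testBit_xor, Nat.testBit_two_pow, add_comm]
  rcases lt_trichotomy i b with hi | rfl | hi
  · rw [Nat.testBit_two_pow_add_gt hi]; simp [hi.ne']
  · rw [Nat.testBit_two_pow_add_eq]; simp [Nat.testBit_lt_two_pow hg]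
  · have h1 : g.toNat < 2 ^ i := lt_trans hg (Nat.pow_lt_pow_right (by norm_num) hi)
    have h2 : 2 ^ b + g.toNat < 2 ^ i := by
      calc 2 ^ b + g.toNat < 2 ^ b + 2 ^ b := by omega
        _ = 2 ^ (b + 1) := by ring
        _ ≤ 2 ^ i := Nat.pow_le_pow_right (by norm_num) hi
    rw [Nat.testBit_lt_two_pow h1, Nat.testBit_lt_two_pow h2]; simp [hi.ne]

theorem getLsbD_of_toNat_lt {b : ℕ} {g : BitVec w} (hg : g.toNat < 2 ^ b) :
    g.getLsbD b = false := by
  rw [← BitVec.testBit_toNat]; exact Nat.testBit_lt_two_pow hg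

theorem toNat_xor_twoPow_lt_iff {b : ℕ} (hb : b < w) (g : BitVec w) :
    (g ^^^ BitVec.twoPow w b).toNat < 2 ^ b ↔ 2 ^ b ≤ g.toNat ∧ g.toNat < 2 ^ (b + 1) := by
  constructor
  · intro h
    have h3 := toNat_xor_twoPow_of_lt hb h
    rw [xor_twoPow_xor_twoPow] at h3
    rw [pow_succ]
    omega
  · rintro ⟨h1, h2⟩
    -- `g` has the bit `b` and no higher bit, so flipping this bit gives a word below `2 ^ b`
    have h5 : g.toNat.testBit b = true := by
      rw [Nat.testBit_eq_decide_div_mod_eq, Nat.div_eq_of_lt_le (k := 1) (by omega) (by omega)]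
      simp
    refine Nat.lt_pow_two_of_testBit _ fun i hi => ?_
    rw [BitVec.testBit_toNat, BitVec.getLsbD_xor, BitVec.getLsbD_twoPow, ← BitVec.testBit_toNat]
    rcases eq_or_lt_of_le hi with rfl | hi
    · simp [h5, hb]
    · rw [Nat.testBit_lt_two_pow (lt_of_lt_of_le h2 (Nat.pow_le_pow_right (by norm_num) hi))]
      simp [hi.ne]

/-- At the zero word, the transform is the normalized sum of all amplitudes. -/
theorem hdDesc_zero {L : ℕ} (hL : L ≤ w) (f : BitVec w → ℝ) :
    hdDesc L f 0 = (∑ g : BitVec w, if g.toNat < 2 ^ L then f g else 0) / Real.sqrt (2 ^ L) := by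
  induction L generalizing f with
  | zero =>
    simp only [hdDesc, pow_zero, Nat.lt_one_iff, Real.sqrt_one, div_one]
    have : ∀ g : BitVec w, (g.toNat = 0) ↔ g = 0 := fun g =>
      ⟨fun h => BitVec.eq_of_toNat_eq (by simpa using h), fun h => by simp [h]⟩
    simp [this]
  | succ L ih =>
    have hLw : L < w := by omega
    rw [hdDesc, ih (by omega), pow_succ (2 : ℝ), Real.sqrt_mul (by positivity)]
    rw [div_eq_div_iff (by positivity) (by positivity), mul_comm (Real.sqrt (2 ^ L)), ← mul_assoc]
    congr 1
    have key : ∀ g : BitVec w, (if g.toNat < 2 ^ L then hd L f g else 0) * Real.sqrt 2 =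
        (if g.toNat < 2 ^ L then f g else 0) +
        (if g.toNat < 2 ^ L then f (g ^^^ BitVec.twoPow w L) else 0) := by
      intro g
      split_ifs with h
      · simp only [hd, getLsbD_of_toNat_lt h]
        simp
      · simp
    rw [Finset.sum_mul, Finset.sum_congr rfl fun g _ => key g, Finset.sum_add_distrib]
    have e : Function.Involutive (fun g : BitVec w => g ^^^ BitVec.twoPow w L) :=
      xor_twoPow_xor_twoPow L
    rw [← Equiv.sum_comp e.toPerm (fun g => if g.toNat < 2 ^ L then
      f (g ^^^ BitVec.twoPow w L) else 0), ← Finset.sum_add_distrib]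
    refine Finset.sum_congr rfl fun g _ => ?_
    simp only [Function.Involutive.coe_toPerm, xor_twoPow_xor_twoPow,
      toNat_xor_twoPow_lt_iff hLw, pow_succ]
    by_cases h1 : g.toNat < 2 ^ L
    · rw [if_pos h1, if_neg (by omega), if_pos (by omega), add_zero]
    · rw [if_neg h1, zero_add]
      refine if_congr ?_ rfl rfl
      omega

/-- The transform of the zero word is uniform. -/
theorem hdAsc_single {L : ℕ} (hL : L ≤ w) :
    hdAsc L (Pi.single (0 : BitVec w) (1 : ℝ)) =
      fun g => if g.toNat < 2 ^ L then 1 / Real.sqrt (2 ^ L) else 0 := by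
  induction L with
  | zero =>
    funext g
    simp only [hdAsc, pow_zero, Nat.lt_one_iff, Real.sqrt_one, div_one, Pi.single_apply]
    have : (g.toNat = 0) ↔ g = 0 :=
      ⟨fun h => BitVec.eq_of_toNat_eq (by simpa using h), fun h => by simp [h]⟩
    simp [this]
  | succ L ih =>
    have hLw : L < w := by omega
    rw [hdAsc, ih (by omega)]
    funext g
    rw [pow_succ (2 : ℝ), Real.sqrt_mul (by positivity), ← div_div]
    simp only [hd, toNat_xor_twoPow_lt_iff hLw]
    by_cases h : g.toNat < 2 ^ L
    · have h' : g.toNat < 2 ^ (L + 1) := by rw [pow_succ]; omega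
      simp only [getLsbD_of_toNat_lt h, h, h', not_le.2 h]
      simp
    · by_cases h' : g.toNat < 2 ^ (L + 1)
      · have hb : g.getLsbD L = true := by
          rw [← BitVec.testBit_toNat, Nat.testBit_eq_decide_div_mod_eq,
            Nat.div_eq_of_lt_le (k := 1) (by omega) (by omega)]
          simp
        simp [hb, h, h', not_lt.1 h]
      · simp [h, h']

/-! ### The Hadamard gates of the machine -/

/-- The Hadamard gate commutes with an encoding in which the transformed register is one
coordinate `coord` of the index set. -/
theorem apply_had_embed (O : BitVec w → BitVec w) (cl : ℕ → BitVec w) (i : Fin (m + 1)) (c : ℕ)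
    (hc : (cl c).toNat < w) {enc : X → Basis w m} (henc : Function.Injective enc)
    (put : BitVec w → X → X) (coord : X → BitVec w)
    (hcoord : ∀ x, (enc x).1 i = coord x)
    (hput : ∀ v x, enc (put (coord x ^^^ v) x) = xorReg i v (enc x))
    (φ : X → ℝ) :
    (Gate.had i c).apply O cl (embed enc φ) =
      embed enc fun x =>
        (if (coord x).getLsbD (cl c).toNat then
          φ (put (coord x ^^^ BitVec.twoPow w (cl c).toNat) x) - φ x
        else φ x + φ (put (coord x ^^^ BitVec.twoPow w (cl c).toNat) x)) / Real.sqrt 2 := by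
  funext b
  by_cases h : ∃ x, enc x = b
  · obtain ⟨x, rfl⟩ := h
    rw [embed_apply henc]
    simp only [Gate.apply, if_pos hc, hcoord, ← hput, embed_apply henc]
    split_ifs <;> push_cast <;> ring
  · have h' : ¬ ∃ x, enc x = xorReg i (BitVec.twoPow w (cl c).toNat) b := by
      rintro ⟨x, hx⟩
      exact h ⟨put (coord x ^^^ BitVec.twoPow w (cl c).toNat) x, by rw [hput, hx, xorReg_self]⟩
    simp [Gate.apply, embed_of_notMem _ h, embed_of_notMem _ h']

end QRam

namespace QRam

variable {w : ℕ}

/-! ### Expressions and reversible assignments -/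

/-- The first register of the stack that serves to evaluate expressions. -/
abbrev stackBase : ℕ := 32

/-- The quantum register with number `i < 64`. -/
abbrev rg (i : ℕ) : Fin (63 + 1) := Fin.ofNat 64 i

/-- Basis states with the registers indexed by `ℕ`; only those below `64` exist. -/
abbrev RegMem (w : ℕ) : Type := (ℕ → BitVec w) × (BitVec w → BitVec w)

/-- The basis state of the machine; the registers from `64` on are dropped. -/
def RegMem.toBasis (s : RegMem w) : Basis w 63 := (fun i => s.1 i, s.2)

theorem rg_val {i : ℕ} (hi : i < 64) : ((rg i : Fin (63 + 1)) : ℕ) = i := Nat.mod_eq_of_lt hi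

theorem rg_ne {i j : ℕ} (hi : i < 64) (hj : j < 64) (h : i ≠ j) : rg i ≠ rg j := by
  intro e
  have := congrArg Fin.val e
  rw [rg_val hi, rg_val hj] at this
  exact h this

theorem toBasis_fst (s : RegMem w) {i : ℕ} (hi : i < 64) : s.toBasis.1 (rg i) = s.1 i := by
  simp only [RegMem.toBasis]
  rw [rg_val hi]

theorem update_toBasis (ρ : ℕ → BitVec w) {i : ℕ} (hi : i < 64) (v : BitVec w) :
    Function.update (fun j : Fin (63 + 1) => ρ j) (rg i) v =
      fun j : Fin (63 + 1) => Function.update ρ i v j := by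
  funext j
  by_cases h : j = rg i
  · subst h
    rw [Function.update_self, rg_val hi, Function.update_self]
  · rw [Function.update_of_ne h, Function.update_of_ne]
    rintro rfl
    apply h
    apply Fin.ext
    rw [rg_val hi]

theorem xorReg_toBasis (s : RegMem w) {i : ℕ} (hi : i < 64) (v : BitVec w) :
    xorReg (rg i) v s.toBasis = RegMem.toBasis (Function.update s.1 i (s.1 i ^^^ v), s.2) := by
  rw [xorReg, toBasis_fst s hi]
  simp only [RegMem.toBasis]
  rw [update_toBasis _ hi]

/-- Word expressions over the quantum registers. -/
inductive Expr where
  | reg (i : ℕ)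
  | bin (o : BinOp) (a b : Expr)

namespace Expr

/-- The value of an expression when the registers have the contents `ρ`. -/
def eval (ρ : ℕ → BitVec w) : Expr → BitVec w
  | reg i => ρ i
  | bin o a b => o.eval (a.eval ρ) (b.eval ρ)

/-- The number of registers above its target that the evaluation of an expression needs. -/
def height : Expr → ℕ
  | reg _ => 0
  | bin _ a b => max a.height b.height + 2

/-- All registers of the expression satisfy `p`. -/
def all (p : ℕ → Bool) : Expr → Bool
  | reg i => p i
  | bin _ a b => a.all p && b.all p

theorem eval_congr {p : ℕ → Bool} {ρ ρ' : ℕ → BitVec w} {e : Expr} (he : e.all p = true)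
    (h : ∀ i, p i = true → ρ i = ρ' i) : e.eval ρ = e.eval ρ' := by
  induction e with
  | reg i => exact h i he
  | bin o a b iha ihb =>
    simp only [all, Bool.and_eq_true] at he
    rw [eval, eval, iha he.1, ihb he.2]

/-- Instructions that xor the value of an expression into the register `d`, given that all
registers above `d` are zero; these are restored to zero by undoing the evaluation of the
subexpressions. -/
def code : Expr → ℕ → List (Gate 63)
  | reg i, d => [.op .and (rg d) (rg i) (rg i)]
  | bin o a b, d => a.code (d + 1) ++ (b.code (d + 2) ++ (.op o (rg d) (rg (d + 1)) (rg (d + 2)) ::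
      (b.code (d + 2) ++ a.code (d + 1))))

theorem isPerm_of_mem_code {e : Expr} {d : ℕ} {g : Gate 63} (hg : g ∈ e.code d) : g.IsPerm := by
  induction e generalizing d with
  | reg i =>
    simp only [code, List.mem_singleton] at hg
    subst hg; trivial
  | bin o a b iha ihb =>
    simp only [code, List.mem_append, List.mem_cons] at hg
    rcases hg with h | h | rfl | h | h
    · exact iha h
    · exact ihb h
    · trivial
    · exact ihb h
    · exact iha h

theorem actGates_code (O : BitVec w → BitVec w) (cl : ℕ → BitVec w) (e : Expr) (d : ℕ)
    (s : RegMem w) (he : e.all (fun i => decide (i < stackBase)) = true) (hd : stackBase ≤ d)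
    (hh : d + e.height < 64) (hs : ∀ j, d < j → s.1 j = 0) :
    actGates O cl (e.code d) s.toBasis =
      RegMem.toBasis (Function.update s.1 d (s.1 d ^^^ e.eval s.1), s.2) := by
  induction e generalizing d s with
  | reg i =>
    simp only [all, decide_eq_true_eq] at he
    simp only [stackBase] at he hd
    have hne : rg d ≠ rg i := rg_ne (by omega) (by omega) (by omega)
    simp only [code, actGates, List.foldl, Gate.act, hne, or_self, if_false]
    rw [toBasis_fst s (by omega), xorReg_toBasis s (by omega)]
    simp [BinOp.eval, eval]
  | bin o a b iha ihb =>
    simp only [all, Bool.and_eq_true] at he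
    simp only [height] at hh
    obtain ⟨ρ, M⟩ := s
    simp only at hs
    have ev : ∀ (e : Expr), e.all (fun i => decide (i < stackBase)) = true →
        ∀ (ρ : ℕ → BitVec w) j v, stackBase ≤ j → e.eval (Function.update ρ j v) = e.eval ρ := by
      intro e he ρ j v hj
      refine eval_congr he fun i hi => ?_
      simp only [decide_eq_true_eq] at hi
      exact Function.update_of_ne (by omega) _ _
    have h1 : stackBase ≤ d + 1 := by omega
    have h2 : stackBase ≤ d + 2 := by omega
    rw [code, actGates_append, iha (d + 1) (ρ, M) he.1 h1 (by omega)
      (fun j hj => hs j (by omega)), actGates_append]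
    simp only
    rw [ihb (d + 2) _ he.2 h2 (by omega) (fun j hj => by
      simp only; rw [Function.update_of_ne (by omega)]; exact hs j (by omega)), actGates_cons]
    simp only
    have hne1 : rg d ≠ rg (d + 1) := rg_ne (by omega) (by omega) (by omega)
    have hne2 : rg d ≠ rg (d + 2) := rg_ne (by omega) (by omega) (by omega)
    simp only [Gate.act, hne1, hne2, or_self, if_false]
    rw [toBasis_fst _ (by omega), toBasis_fst _ (by omega), xorReg_toBasis _ (by omega),
      actGates_append]
    simp only [ev b he.2 _ _ _ h1]
    rw [ihb (d + 2) _ he.2 h2 (by omega) (fun j hj => by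
      simp only
      rw [Function.update_of_ne (by omega), Function.update_of_ne (by omega),
        Function.update_of_ne (by omega)]; exact hs j (by omega))]
    simp only
    rw [iha (d + 1) _ he.1 h1 (by omega) (fun j hj => by
      simp only
      by_cases hj2 : j = d + 2
      · subst hj2
        simp only [Function.update_self]
        rw [Function.update_of_ne (by omega), Function.update_self,
          ev b he.2 _ _ _ hd, ev b he.2 _ _ _ h2, ev b he.2 _ _ _ h1]
        simp [hs]
      · rw [Function.update_of_ne (by omega), Function.update_of_ne (by omega),
          Function.update_of_ne (by omega), Function.update_of_ne (by omega)]; exact hs j (by omega))]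
    simp only [ev b he.2 _ _ _ hd, ev a he.1 _ _ _ hd, ev b he.2 _ _ _ h1, ev b he.2 _ _ _ h2,
      ev a he.1 _ _ _ h1, ev a he.1 _ _ _ h2]
    congr 2
    funext j
    have z1 : ρ (d + 1) = 0 := hs _ (by omega)
    have z2 : ρ (d + 2) = 0 := hs _ (by omega)
    have e1 : d + 1 ≠ d := by omega
    have e2 : d + 2 ≠ d := by omega
    have e3 : d + 1 ≠ d + 2 := by omega
    by_cases hj1 : j = d + 1
    · subst hj1; simp [z1]
    · by_cases hj2 : j = d + 2
      · subst hj2; simp [z2]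
      · by_cases hj0 : j = d
        · subst hj0
          simp [z1, z2, eval]
        · simp [hj0, hj1, hj2]

end Expr

/-- Reversible instructions on the registers and the memory. -/
inductive Instr where
  /-- xor the value of the expression `e` into the register `i` -/
  | xor (i : ℕ) (e : Expr)
  /-- xor the answer of the oracle to the register `j` into the register `i` -/
  | query (i j : ℕ)
  /-- exchange the register `i` with the memory cell addressed by the register `j` -/
  | swap (i j : ℕ)
  /-- xor the classical register `c` into the register `i` -/
  | load (i c : ℕ)

namespace Instr

/-- The machine instructions for a reversible instruction.  An expression is evaluated on the
stack, copied by a conjunction of the result with itself, and erased by evaluating it again. -/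
def gates : Instr → List (Gate 63)
  | xor i e => e.code stackBase ++
      (.op .and (rg i) (rg stackBase) (rg stackBase) :: e.code stackBase)
  | query i j => [.query (rg i) (rg j)]
  | swap i j => [.swap (rg i) (rg j)]
  | load i c => [.load (rg i) c]

/-- The instruction does not touch the stack, and its target is not among its arguments. -/
def ok : Instr → Bool
  | xor i e => decide (i < stackBase) && (e.all (fun j => decide (j < stackBase) && decide (j ≠ i))
      && decide (e.height < 32))
  | query i j => decide (i < stackBase) && decide (j < stackBase) && decide (i ≠ j)
  | swap i j => decide (i < stackBase) && decide (j < stackBase) && decide (i ≠ j)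
  | load i _ => decide (i < stackBase)

/-- The effect of an instruction. -/
def run (O : BitVec w → BitVec w) (cl : ℕ → BitVec w) : Instr → RegMem w → RegMem w
  | xor i e, s => (Function.update s.1 i (s.1 i ^^^ e.eval s.1), s.2)
  | query i j, s => (Function.update s.1 i (s.1 i ^^^ O (s.1 j)), s.2)
  | swap i j, s => (Function.update s.1 i (s.2 (s.1 j)), Function.update s.2 (s.1 j) (s.1 i))
  | load i c, s => (Function.update s.1 i (s.1 i ^^^ cl c), s.2)

theorem run_run (O : BitVec w → BitVec w) (cl : ℕ → BitVec w) {I : Instr} (h : I.ok = true)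
    (s : RegMem w) : I.run O cl (I.run O cl s) = s := by
  obtain ⟨ρ, M⟩ := s
  cases I with
  | xor i e =>
    simp only [ok, Bool.and_eq_true, decide_eq_true_eq] at h
    have : e.eval (Function.update ρ i (ρ i ^^^ e.eval ρ)) = e.eval ρ := by
      refine Expr.eval_congr h.2.1 fun j hj => ?_
      simp only [Bool.and_eq_true, decide_eq_true_eq] at hj
      exact Function.update_of_ne hj.2 _ _
    simp [run, this]
  | query i j =>
    simp only [ok, Bool.and_eq_true, decide_eq_true_eq] at h
    have : j ≠ i := Ne.symm h.2
    simp [run, this]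
  | swap i j =>
    simp only [ok, Bool.and_eq_true, decide_eq_true_eq] at h
    have : j ≠ i := Ne.symm h.2
    simp [run, this]
  | load i c => simp [run]

/-- The stack is empty. -/
def Clean (s : RegMem w) : Prop := ∀ j, stackBase ≤ j → s.1 j = 0

theorem Clean.run {O : BitVec w → BitVec w} {cl : ℕ → BitVec w} {I : Instr} (h : I.ok = true)
    {s : RegMem w} (hs : Clean s) : Clean (I.run O cl s) := by
  intro j hj
  have := hs j hj
  cases I with
  | xor i e =>
    simp only [ok, Bool.and_eq_true, decide_eq_true_eq] at h
    have : j ≠ i := by omega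
    simp [Instr.run, *]
  | query i l =>
    simp only [ok, Bool.and_eq_true, decide_eq_true_eq] at h
    have : j ≠ i := by omega
    simp [Instr.run, *]
  | swap i l =>
    simp only [ok, Bool.and_eq_true, decide_eq_true_eq] at h
    have : j ≠ i := by omega
    simp [Instr.run, *]
  | load i c =>
    simp only [ok, decide_eq_true_eq] at h
    have : j ≠ i := by omega
    simp [Instr.run, *]

theorem isPerm_of_mem_gates {I : Instr} {g : Gate 63} (hg : g ∈ I.gates) : g.IsPerm := by
  cases I with
  | xor i e =>
    simp only [gates, List.mem_append, List.mem_cons] at hg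
    rcases hg with h | rfl | h
    · exact Expr.isPerm_of_mem_code h
    · trivial
    · exact Expr.isPerm_of_mem_code h
  | query i j => simp only [gates, List.mem_singleton] at hg; subst hg; trivial
  | swap i j => simp only [gates, List.mem_singleton] at hg; subst hg; trivial
  | load i j => simp only [gates, List.mem_singleton] at hg; subst hg; trivial

theorem actGates_gates (O : BitVec w → BitVec w) (cl : ℕ → BitVec w) {I : Instr}
    (h : I.ok = true) {s : RegMem w} (hs : Clean s) :
    actGates O cl I.gates s.toBasis = (I.run O cl s).toBasis := by
  cases I with
  | xor i e =>
    simp only [ok, Bool.and_eq_true, decide_eq_true_eq] at h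
    obtain ⟨hi, he, hh⟩ := h
    have he' : e.all (fun j => decide (j < stackBase)) = true := by
      clear hh
      induction e with
      | reg i => simp only [Expr.all, Bool.and_eq_true] at he ⊢; exact he.1
      | bin o a b iha ihb =>
        simp only [Expr.all, Bool.and_eq_true] at he ⊢; exact ⟨iha he.1, ihb he.2⟩
    obtain ⟨ρ, M⟩ := s
    have hs' : ∀ j, stackBase ≤ j → ρ j = 0 := hs
    simp only [stackBase] at *
    rw [gates, actGates_append, Expr.actGates_code O cl e 32 _ he' le_rfl (by omega)
      (fun j hj => hs j (le_of_lt hj)), actGates_cons]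
    have hne : rg i ≠ rg 32 := rg_ne (by omega) (by omega) (by omega)
    simp only [Gate.act, hne, or_self, if_false]
    rw [toBasis_fst _ (i := 32) (by omega), xorReg_toBasis _ (by omega), Expr.actGates_code O cl e 32 _ he'
      le_rfl (by omega) (fun j hj => by
        simp only
        rw [Function.update_of_ne (by omega), Function.update_of_ne (by omega)]
        exact hs' j (by omega))]
    congr 2
    have ev : ∀ v v', e.eval (Function.update (Function.update ρ 32 v) i v') = e.eval ρ := by
      intro v v'
      refine Expr.eval_congr he fun j hj => ?_
      simp only [Bool.and_eq_true, decide_eq_true_eq] at hj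
      rw [Function.update_of_ne hj.2, Function.update_of_ne (by omega)]
    have h0 := hs' 32 le_rfl
    have hi' : i ≠ 32 := by omega
    have hi'' : 32 ≠ i := by omega
    funext j
    simp only [BinOp.eval, BitVec.and_self, Function.update_self, ev, h0]
    by_cases hj : j = 32
    · subst hj
      simp [hi'', h0]
    · by_cases hji : j = i
      · subst hji; simp [hi']
      · simp [hj, hji]
  | query i j =>
    simp only [ok, Bool.and_eq_true, decide_eq_true_eq, stackBase] at h
    have hne : rg i ≠ rg j := rg_ne (by omega) (by omega) (by omega)
    simp only [gates, actGates, List.foldl, Gate.act, hne, if_false]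
    rw [toBasis_fst _ (by omega), xorReg_toBasis _ (by omega)]
    rfl
  | swap i j =>
    simp only [ok, Bool.and_eq_true, decide_eq_true_eq, stackBase] at h
    have hne : rg i ≠ rg j := rg_ne (by omega) (by omega) (by omega)
    simp only [gates, actGates, List.foldl, Gate.act, hne, if_false]
    rw [toBasis_fst _ (by omega), swapMem, toBasis_fst _ (by omega)]
    simp only [RegMem.toBasis]
    rw [update_toBasis _ (by omega)]
    rfl
  | load i c =>
    simp only [ok, decide_eq_true_eq, stackBase] at h
    simp only [gates, actGates, List.foldl, Gate.act]
    rw [xorReg_toBasis _ (by omega)]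
    rfl

/-- Run a list of instructions. -/
def runs (O : BitVec w → BitVec w) (cl : ℕ → BitVec w) (l : List Instr) (s : RegMem w) :
    RegMem w := l.foldl (fun s I => I.run O cl s) s

theorem runs_append (O : BitVec w → BitVec w) (cl : ℕ → BitVec w) (l l' : List Instr)
    (s : RegMem w) : runs O cl (l ++ l') s = runs O cl l' (runs O cl l s) := by
  simp [runs]

theorem runs_reverse (O : BitVec w → BitVec w) (cl : ℕ → BitVec w) {l : List Instr}
    (hl : l.all ok = true) (s : RegMem w) : runs O cl l.reverse (runs O cl l s) = s := by
  induction l generalizing s with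
  | nil => rfl
  | cons I l ih =>
    simp only [List.all_cons, Bool.and_eq_true] at hl
    rw [List.reverse_cons, runs_append]
    show runs O cl [I] (runs O cl l.reverse (runs O cl l (I.run O cl s))) = s
    rw [ih hl.2]
    exact run_run O cl hl.1 s

theorem Clean.runs {O : BitVec w → BitVec w} {cl : ℕ → BitVec w} {l : List Instr}
    (hl : l.all ok = true) {s : RegMem w} (hs : Clean s) : Clean (Instr.runs O cl l s) := by
  induction l generalizing s with
  | nil => exact hs
  | cons I l ih =>
    simp only [List.all_cons, Bool.and_eq_true] at hl
    exact ih hl.2 (Clean.run hl.1 hs)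

theorem actGates_flatMap (O : BitVec w → BitVec w) (cl : ℕ → BitVec w) {l : List Instr}
    (hl : l.all ok = true) {s : RegMem w} (hs : Clean s) :
    actGates O cl (l.flatMap gates) s.toBasis = (runs O cl l s).toBasis := by
  induction l generalizing s with
  | nil => rfl
  | cons I l ih =>
    simp only [List.all_cons, Bool.and_eq_true] at hl
    rw [List.flatMap_cons, actGates_append, actGates_gates O cl hl.1 hs, ih hl.2 (Clean.run hl.1 hs)]
    rfl

/-- A list of instructions carries a superposition of basis states along. -/
theorem applyGates_flatMap {X : Type*} (O : BitVec w → BitVec w) (cl : ℕ → BitVec w)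
    {l : List Instr} (hl : l.all ok = true) (enc : X → RegMem w) (henc : ∀ x, Clean (enc x))
    (φ : X → ℝ) :
    applyGates O cl (l.flatMap gates) (embed (fun x => (enc x).toBasis) φ) =
      embed (fun x => (runs O cl l (enc x)).toBasis) φ := by
  rw [applyGates_embed]
  · congr 1
    funext x
    exact actGates_flatMap O cl hl (henc x)
  · intro g hg
    obtain ⟨I, _, hI⟩ := List.mem_flatMap.1 hg
    exact isPerm_of_mem_gates hI

end Instr

end QRam

/-! ### Detection of an invariant vector by averaging -/

namespace PhaseDetection

variable {Ω : Type*} [Fintype Ω]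

theorem dot_iterate {U : (Ω → ℝ) → (Ω → ℝ)} (hU : ∀ u v, U u ⬝ᵥ U v = u ⬝ᵥ v) (t : ℕ)
    (u v : Ω → ℝ) : U^[t] u ⬝ᵥ U^[t] v = u ⬝ᵥ v := by
  induction t with
  | zero => rfl
  | succ t ih => rw [Function.iterate_succ_apply', Function.iterate_succ_apply', hU, ih]

/-- The time average of the orbit of `ψ`. -/
noncomputable def average (U : (Ω → ℝ) → (Ω → ℝ)) (T : ℕ) (ψ : Ω → ℝ) : Ω → ℝ :=
  (T : ℝ)⁻¹ • ∑ t ∈ Finset.range T, U^[t] ψ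

/-- An invariant vector that overlaps with `ψ` keeps the average of the orbit large. -/
theorem le_dot_average {U : (Ω → ℝ) → (Ω → ℝ)} (hU : ∀ u v, U u ⬝ᵥ U v = u ⬝ᵥ v) {T : ℕ}
    (hT : 0 < T) {φ : Ω → ℝ} (hφ : U φ = φ) (ψ : Ω → ℝ) :
    (φ ⬝ᵥ ψ) ^ 2 ≤ (φ ⬝ᵥ φ) * (average U T ψ ⬝ᵥ average U T ψ) := by
  have h1 : φ ⬝ᵥ average U T ψ = φ ⬝ᵥ ψ := by
    have h2 : ∀ t, φ ⬝ᵥ U^[t] ψ = φ ⬝ᵥ ψ := fun t => by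
      conv_lhs => rw [← Function.iterate_fixed hφ t]
      exact dot_iterate hU t φ ψ
    rw [average, dotProduct_smul, dotProduct_sum, Finset.sum_congr rfl fun t _ => h2 t]
    simp [hT.ne']
  rw [← h1]
  have := Finset.sum_mul_sq_le_sq_mul_sq Finset.univ φ (average U T ψ)
  simpa [dotProduct, pow_two] using this

/-- If `ψ` is a coboundary `η - U η`, then the average of the orbit telescopes. -/
theorem dot_average_le {U : (Ω → ℝ) → (Ω → ℝ)} (hU : ∀ u v, U u ⬝ᵥ U v = u ⬝ᵥ v)
    (hsub : ∀ u v, U (u - v) = U u - U v) (T : ℕ) {ψ η : Ω → ℝ} (h : ψ = η - U η) :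
    average U T ψ ⬝ᵥ average U T ψ ≤ 4 * (η ⬝ᵥ η) / T ^ 2 := by
  have hit : ∀ t, U^[t] ψ = U^[t] η - U^[t + 1] η := by
    intro t
    induction t with
    | zero => exact h
    | succ t ih =>
      rw [Function.iterate_succ_apply', ih, hsub, ← Function.iterate_succ_apply' U,
        ← Function.iterate_succ_apply' U]
  have hsum : ∑ t ∈ Finset.range T, U^[t] ψ = η - U^[T] η := by
    rw [Finset.sum_congr rfl fun t _ => hit t]
    exact Finset.sum_range_sub' (fun t => U^[t] η) T
  rw [average, hsum, dotProduct_smul, smul_dotProduct, smul_eq_mul, smul_eq_mul, ← mul_assoc,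
    ← mul_inv, ← pow_two, inv_mul_eq_div]
  refine div_le_div_of_nonneg_right ?_ (by positivity)
  have h2 : U^[T] η ⬝ᵥ U^[T] η = η ⬝ᵥ η := dot_iterate hU T η η
  have h3 : 0 ≤ (η + U^[T] η) ⬝ᵥ (η + U^[T] η) := by
    simp only [dotProduct]
    exact Finset.sum_nonneg fun i _ => mul_self_nonneg _
  simp only [dotProduct_add, add_dotProduct, dotProduct_sub, sub_dotProduct] at h3 ⊢
  linarith

end PhaseDetection

/-! ### Coined walks -/

namespace CoinedWalk

open QRam

variable {Y : Type*} {w : ℕ}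

/-- The reflection about the uniform superposition of the `2 ^ L` directions at an unmarked vertex,
and about zero at a marked vertex. -/
noncomputable def coin (marked : Y → Prop) [DecidablePred marked] (L : ℕ)
    (f : Y × BitVec w → ℝ) : Y × BitVec w → ℝ := fun p =>
  if marked p.1 then -f p
  else (if p.2.toNat < 2 ^ L then
    2 * (∑ g : BitVec w, if g.toNat < 2 ^ L then f (p.1, g) else 0) / 2 ^ L else 0) - f p

/-- Traverse the chosen edge, and apply a sign. -/
def shift (π : Y × BitVec w → Y × BitVec w) (sgn : Y × BitVec w → ℝ)
    (f : Y × BitVec w → ℝ) : Y × BitVec w → ℝ := fun p => sgn p * f (π p)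

/-- One step of the walk: toss the coin, and traverse the edge. -/
noncomputable def step (marked : Y → Prop) [DecidablePred marked] (L : ℕ)
    (π : Y × BitVec w → Y × BitVec w) (sgn : Y × BitVec w → ℝ) (f : Y × BitVec w → ℝ) :
    Y × BitVec w → ℝ := shift π sgn (coin marked L f)

theorem step_sub (marked : Y → Prop) [DecidablePred marked] (L : ℕ)
    (π : Y × BitVec w → Y × BitVec w) (sgn : Y × BitVec w → ℝ) (u v : Y × BitVec w → ℝ) :
    step marked L π sgn (u - v) = step marked L π sgn u - step marked L π sgn v := by
  funext p
  simp only [step, shift, coin, Pi.sub_apply]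
  have : (∑ g : BitVec w, if g.toNat < 2 ^ L then u ((π p).1, g) - v ((π p).1, g) else 0) =
      (∑ g : BitVec w, if g.toNat < 2 ^ L then u ((π p).1, g) else 0) -
      ∑ g : BitVec w, if g.toNat < 2 ^ L then v ((π p).1, g) else 0 := by
    rw [← Finset.sum_sub_distrib]
    exact Finset.sum_congr rfl fun g _ => by split_ifs <;> simp
  rw [this]
  split_ifs <;> ring

theorem card_toNat_lt {L : ℕ} (hL : L ≤ w) :
    (Finset.univ.filter fun g : BitVec w => g.toNat < 2 ^ L).card = 2 ^ L := by
  have h : 2 ^ L ≤ 2 ^ w := Nat.pow_le_pow_right (by norm_num) hL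
  rw [← Finset.card_range (2 ^ L)]
  refine Finset.card_nbij' (fun g => g.toNat) (fun j => BitVec.ofNat w j) ?_ ?_ ?_ ?_
  · intro g hg; simpa using hg
  · intro j hj
    simp only [Finset.coe_range, Set.mem_Iio] at hj
    simp [Nat.mod_eq_of_lt (lt_of_lt_of_le hj h), hj]
  · intro g _; simp
  · intro j hj
    simp only [Finset.coe_range, Set.mem_Iio] at hj
    simp [Nat.mod_eq_of_lt (lt_of_lt_of_le hj h)]

theorem sum_toNat_lt {L : ℕ} (hL : L ≤ w) (c : ℝ) :
    (∑ g : BitVec w, if g.toNat < 2 ^ L then c else 0) = 2 ^ L * c := by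
  rw [← Finset.sum_filter, Finset.sum_const, card_toNat_lt hL, nsmul_eq_mul]
  push_cast; rfl

theorem dot_coin [Fintype Y] (marked : Y → Prop) [DecidablePred marked] {L : ℕ} (hL : L ≤ w)
    (u v : Y × BitVec w → ℝ) : coin marked L u ⬝ᵥ coin marked L v = u ⬝ᵥ v := by
  simp only [dotProduct, Fintype.sum_prod_type]
  refine Finset.sum_congr rfl fun y _ => ?_
  simp only [coin]
  by_cases hy : marked y
  · simp [hy]
  · simp only [hy, if_false]
    set A := ∑ g : BitVec w, if g.toNat < 2 ^ L then u (y, g) else 0 with hA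
    set B := ∑ g : BitVec w, if g.toNat < 2 ^ L then v (y, g) else 0 with hB
    have h : ∀ g : BitVec w,
        ((if g.toNat < 2 ^ L then 2 * A / 2 ^ L else 0) - u (y, g)) *
        ((if g.toNat < 2 ^ L then 2 * B / 2 ^ L else 0) - v (y, g)) =
        (if g.toNat < 2 ^ L then 4 * A * B / (2 ^ L * 2 ^ L) else 0)
        - (2 * B / 2 ^ L) * (if g.toNat < 2 ^ L then u (y, g) else 0)
        - (2 * A / 2 ^ L) * (if g.toNat < 2 ^ L then v (y, g) else 0) + u (y, g) * v (y, g) := by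
      intro g
      split_ifs
      · field_simp; ring
      · ring
    rw [Finset.sum_congr rfl fun g _ => h g, Finset.sum_add_distrib, Finset.sum_sub_distrib,
      Finset.sum_sub_distrib, ← Finset.mul_sum, ← Finset.mul_sum, ← hA, ← hB, sum_toNat_lt hL]
    field_simp; ring

theorem dot_shift [Fintype Y] {π : Y × BitVec w → Y × BitVec w} (hπ : Function.Involutive π)
    {sgn : Y × BitVec w → ℝ} (hs : ∀ p, sgn p * sgn p = 1) (u v : Y × BitVec w → ℝ) :
    shift π sgn u ⬝ᵥ shift π sgn v = u ⬝ᵥ v := by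
  simp only [dotProduct, shift]
  rw [← Equiv.sum_comp hπ.toPerm (fun p => u p * v p)]
  refine Finset.sum_congr rfl fun p _ => ?_
  simp only [Function.Involutive.coe_toPerm]
  linear_combination u (π p) * v (π p) * hs p

theorem dot_step [Fintype Y] (marked : Y → Prop) [DecidablePred marked] {L : ℕ} (hL : L ≤ w)
    {π : Y × BitVec w → Y × BitVec w} (hπ : Function.Involutive π)
    {sgn : Y × BitVec w → ℝ} (hs : ∀ p, sgn p * sgn p = 1) (u v : Y × BitVec w → ℝ) :
    step marked L π sgn u ⬝ᵥ step marked L π sgn v = u ⬝ᵥ v := by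
  rw [step, step, dot_shift hπ hs, dot_coin marked hL]

/-- The coin as two Hadamard transforms around a conditional phase. -/
theorem hadamard_coin (marked : Y → Prop) [DecidablePred marked] {L : ℕ} (hL : L ≤ w)
    (f : Y × BitVec w → ℝ) (y : Y) (g : BitVec w) :
    hdAsc L (fun g => (if g ≠ 0 ∨ marked y then -1 else 1) * hdDesc L (fun g => f (y, g)) g) g =
      coin marked L f (y, g) := by
  simp only [coin]
  by_cases hy : marked y
  · have : (fun g : BitVec w => (if g ≠ 0 ∨ marked y then (-1 : ℝ) else 1) *
        hdDesc L (fun g => f (y, g)) g) = (-1 : ℝ) • hdDesc L fun g => f (y, g) := by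
      funext g; simp [hy]
    rw [this, hdAsc_smul, hdAsc_hdDesc hL]
    simp [hy]
  · have : (fun g : BitVec w => (if g ≠ 0 ∨ marked y then (-1 : ℝ) else 1) *
        hdDesc L (fun g => f (y, g)) g) =
        (2 * hdDesc L (fun g => f (y, g)) 0) • Pi.single (0 : BitVec w) (1 : ℝ) +
          (-1 : ℝ) • hdDesc L fun g => f (y, g) := by
      funext g
      by_cases hg : g = 0
      · subst hg
        simp [hy]; ring
      · have hg' : ¬ g = 0#w := hg
        simp [hy, hg']
    rw [this, hdAsc_add, hdAsc_smul, hdAsc_smul, hdAsc_hdDesc hL, hdAsc_single hL, hdDesc_zero hL]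
    simp only [Pi.add_apply, Pi.smul_apply, smul_eq_mul, hy, if_false]
    have h2 : Real.sqrt (2 ^ L) * Real.sqrt (2 ^ L) = 2 ^ L := Real.mul_self_sqrt (by positivity)
    have h0 : Real.sqrt (2 ^ L) ≠ 0 := by positivity
    split_ifs
    · field_simp
      rw [pow_two, h2]
      field_simp
      ring
    · ring

/-- A vector whose amplitudes at every unmarked vertex add up to zero is negated by the coin. -/
theorem coin_eq_neg (marked : Y → Prop) [DecidablePred marked] (L : ℕ) (f : Y × BitVec w → ℝ)
    (h : ∀ y, ¬ marked y → (∑ g : BitVec w, if g.toNat < 2 ^ L then f (y, g) else 0) = 0) :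
    coin marked L f = -f := by
  funext ⟨y, g⟩
  simp only [coin, Pi.neg_apply]
  by_cases hy : marked y
  · simp [hy]
  · simp [hy, h y hy]

/-- A vector supported on unmarked vertices, whose amplitudes depend on the vertex only, is fixed
by the coin. -/
theorem coin_eq_self (marked : Y → Prop) [DecidablePred marked] {L : ℕ} (hL : L ≤ w) (c : Y → ℝ)
    (h : ∀ y, marked y → c y = 0) :
    coin marked L (fun p : Y × BitVec w => if p.2.toNat < 2 ^ L then c p.1 else 0) =
      fun p => if p.2.toNat < 2 ^ L then c p.1 else 0 := by
  funext ⟨y, g⟩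
  simp only [coin]
  by_cases hy : marked y
  · simp [hy, h y hy]
  · have : (∑ g : BitVec w, if g.toNat < 2 ^ L then (if g.toNat < 2 ^ L then c y else 0) else 0) =
        2 ^ L * c y := by
      rw [← sum_toNat_lt hL]
      exact Finset.sum_congr rfl fun g _ => by split_ifs <;> rfl
    simp only [hy, if_false, this]
    split_ifs
    · field_simp; ring
    · ring

end CoinedWalk

namespace KDistinctness

variable {n q : ℕ}

/-! ### Multiplicities -/

/-- The number of elements of `S` that carry the value `a`. -/
def mult (x : Fin n → Fin q) (S : Finset (Fin n)) (a : Fin q) : ℕ :=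
  (S.filter fun j => x j = a).card

/-- The number of values that occur exactly `i` times in `S`. -/
def hist (x : Fin n → Fin q) (S : Finset (Fin n)) (i : ℕ) : ℕ :=
  (Finset.univ.filter fun a : Fin q => mult x S a = i).card

theorem card_part (x : Fin n → Fin q) (S : Finset (Fin n)) (i : ℕ) :
    (part x S i).card = i * hist x S i := by
  have h : ∀ j ∈ part x S i, x j ∈ (Finset.univ.filter fun a : Fin q => mult x S a = i) := by
    intro j hj
    simp only [part, Finset.mem_filter, Finset.mem_univ, true_and] at hj ⊢
    exact hj.2
  rw [Finset.card_eq_sum_card_fiberwise h, hist, mul_comm, ← smul_eq_mul, ← Finset.sum_const]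
  refine Finset.sum_congr rfl fun a ha => ?_
  simp only [Finset.mem_filter, Finset.mem_univ, true_and] at ha
  have : (part x S i).filter (fun j => x j = a) = S.filter fun j => x j = a := by
    ext j
    simp only [part, Finset.mem_filter]
    constructor
    · rintro ⟨⟨h1, _⟩, h2⟩; exact ⟨h1, h2⟩
    · rintro ⟨h1, rfl⟩; exact ⟨⟨h1, ha⟩, rfl⟩
  rw [this]
  exact ha

theorem setType_apply (k : ℕ) (x : Fin n → Fin q) (S : Finset (Fin n)) (i : Fin k) :
    setType k x S i = hist x S (i + 1) := by
  rw [setType, card_part, Nat.mul_div_cancel_left _ (Nat.succ_pos _)]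

theorem mem_startSets {k : ℕ} {r : Fin (k - 1) → ℕ} {x : Fin n → Fin q} {S : Finset (Fin n)} :
    S ∈ startSets k r x ↔ ∀ i : Fin k, hist x S (i + 1) = startType k r i := by
  simp only [startSets, Finset.mem_filter, Finset.mem_univ, true_and, funext_iff, setType_apply]

theorem hist_of_mem_startSets {k : ℕ} {r : Fin (k - 1) → ℕ} {x : Fin n → Fin q}
    {S : Finset (Fin n)} (h : S ∈ startSets k r x) (i : Fin (k - 1)) :
    hist x S (i + 1) = r i := by
  have := mem_startSets.1 h ⟨i, by omega⟩
  simpa [startType] using this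

/-- The number of elements of a set of type `(r_1, …, r_{k-1}, 0)` in which no value occurs more
than `k` times. -/
def startSize (k : ℕ) (r : Fin (k - 1) → ℕ) : ℕ := ∑ i : Fin (k - 1), ((i : ℕ) + 1) * r i

theorem card_filter_mult_lt {k : ℕ} {r : Fin (k - 1) → ℕ} {x : Fin n → Fin q}
    {S : Finset (Fin n)} (h : S ∈ startSets k r x) (hk : 1 ≤ k) :
    (S.filter fun j => mult x S (x j) < k).card = startSize k r := by
  have h1 : ∀ j ∈ S.filter (fun j => mult x S (x j) < k), mult x S (x j) ∈ Finset.range k := by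
    intro j hj
    simpa using (Finset.mem_filter.1 hj).2
  rw [Finset.card_eq_sum_card_fiberwise h1]
  have h2 : ∀ i ∈ Finset.range k, ((S.filter fun j => mult x S (x j) < k).filter
      fun j => mult x S (x j) = i).card = i * hist x S i := by
    intro i hi
    rw [← card_part]
    congr 1
    rw [Finset.filter_filter]
    refine Finset.filter_congr fun j _ => ⟨fun h => h.2, fun h => ⟨?_, h⟩⟩
    rw [show mult x S (x j) = i from h]
    simpa using hi
  rw [Finset.sum_congr rfl h2]
  obtain ⟨k', rfl⟩ : ∃ k', k = k' + 1 := ⟨k - 1, by omega⟩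
  rw [Finset.sum_range_succ', zero_mul, add_zero, Finset.sum_range]
  exact Finset.sum_congr rfl fun i _ => by rw [hist_of_mem_startSets h]

theorem startSize_le {k : ℕ} {r : Fin (k - 1) → ℕ} {x : Fin n → Fin q}
    {S : Finset (Fin n)} (h : S ∈ startSets k r x) (hk : 1 ≤ k) : startSize k r ≤ n := by
  rw [← card_filter_mult_lt h hk]
  exact (Finset.card_le_univ _).trans_eq (Fintype.card_fin n)

/-- The type of a set ignores values that occur more than `k` times; the size of the set reveals
whether there are any. -/
theorem card_eq_startSize_iff {k : ℕ} {r : Fin (k - 1) → ℕ} {x : Fin n → Fin q}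
    {S : Finset (Fin n)} (h : S ∈ startSets k r x) (hk : 1 ≤ k) :
    S.card = startSize k r ↔ ∀ j ∈ S, mult x S (x j) < k := by
  rw [← card_filter_mult_lt h hk, eq_comm, Finset.card_filter_eq_iff]

theorem mult_lt_of_not_hasCollision {k : ℕ} {x : Fin n → Fin q} (h : ¬ HasCollision k x)
    (S : Finset (Fin n)) (a : Fin q) : mult x S a < k := by
  by_contra! hc
  obtain ⟨J, hJ, hcard⟩ := Finset.exists_subset_card_eq hc
  refine h ⟨J, hcard, fun i hi j hj => ?_⟩
  have h1 := hJ hi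
  have h2 := hJ hj
  simp only [Finset.mem_filter] at h1 h2
  rw [h1.2, h2.2]

theorem mult_insert {x : Fin n → Fin q} {S : Finset (Fin n)} {b : Fin n} (h : b ∉ S)
    (a : Fin q) : mult x (insert b S) a = mult x S a + if x b = a then 1 else 0 := by
  rw [mult, Finset.filter_insert]
  split_ifs
  · rw [Finset.card_insert_of_notMem (by simp [h])]; rfl
  · rfl

/-- The effect on the histogram of changing the multiplicity of a single value. -/
theorem hist_add_of_mult_eq {x : Fin n → Fin q} {S S' : Finset (Fin n)} {a : Fin q}
    (h : ∀ a', a' ≠ a → mult x S a' = mult x S' a') (l : ℕ) :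
    hist x S l + (if mult x S' a = l then 1 else 0) =
      hist x S' l + if mult x S a = l then 1 else 0 := by
  have e : ∀ S : Finset (Fin n), hist x S l = (if mult x S a = l then 1 else 0) +
      ((Finset.univ.erase a).filter fun a => mult x S a = l).card := by
    intro S
    rw [hist, ← Finset.insert_erase (Finset.mem_univ a), Finset.filter_insert]
    split_ifs
    · rw [Finset.card_insert_of_notMem (by simp), add_comm, Finset.erase_insert (by simp)]
    · rw [zero_add, Finset.erase_insert (by simp)]
  have e' : ((Finset.univ.erase a).filter fun a => mult x S a = l) =
      (Finset.univ.erase a).filter fun a => mult x S' a = l := by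
    refine Finset.filter_congr fun a' ha' => ?_
    rw [h a' (Finset.ne_of_mem_erase ha')]
  rw [e S, e S', e']
  omega

theorem hist_insert {x : Fin n → Fin q} {S : Finset (Fin n)} {b : Fin n} (hb : b ∉ S) (l : ℕ) :
    hist x (insert b S) l + (if mult x S (x b) = l then 1 else 0) =
      hist x S l + if mult x S (x b) + 1 = l then 1 else 0 := by
  have := hist_add_of_mult_eq (x := x) (S := insert b S) (S' := S) (a := x b)
    (fun a' ha' => by rw [mult_insert hb, if_neg (Ne.symm ha'), add_zero]) l
  rwa [mult_insert hb, if_pos rfl] at this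

/-! ### The sizes of the layers of the walk -/

/-- Without collisions, the sets of type `(r_1, …, r_{k-1}, 0)` are those with a certain
histogram. -/
theorem hist_eq_of_mem_startSets {k : ℕ} {r : Fin (k - 1) → ℕ} {x : Fin n → Fin q}
    (hx : ∀ S a, mult x S a < k) {S S₀ : Finset (Fin n)} (h₀ : S₀ ∈ startSets k r x) :
    S ∈ startSets k r x ↔ ∀ l, hist x S l = hist x S₀ l := by
  constructor
  · intro h
    have h1 : ∀ l, hist x S (l + 1) = hist x S₀ (l + 1) := by
      intro l
      by_cases hl : l < k
      · rw [mem_startSets.1 h ⟨l, hl⟩, mem_startSets.1 h₀ ⟨l, hl⟩]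
      · have z : ∀ S : Finset (Fin n), hist x S (l + 1) = 0 := by
          intro S
          rw [hist, Finset.card_eq_zero, Finset.filter_eq_empty_iff]
          intro a _ h
          have := hx S a
          omega
        rw [z, z]
    have h2 : ∀ S : Finset (Fin n), hist x S 0 + ∑ l ∈ Finset.range k, hist x S (l + 1) = q := by
      intro S
      rw [add_comm, ← Finset.sum_range_succ' (hist x S)]
      have := Finset.card_eq_sum_card_fiberwise (s := (Finset.univ : Finset (Fin q)))
        (t := Finset.range (k + 1)) (f := mult x S)
        (fun a _ => by have := hx S a; simp; omega)
      rw [Finset.card_univ, Fintype.card_fin] at this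
      exact this.symm
    intro l
    cases l with
    | zero =>
      have e1 := h2 S
      have e2 := h2 S₀
      rw [Finset.sum_congr rfl fun l _ => h1 l] at e1
      omega
    | succ l => exact h1 l
  · intro h
    rw [mem_startSets]
    intro i
    rw [h, mem_startSets.1 h₀ i]

open scoped Classical in
/-- The sets with the histogram `T - e_j + e_i`. -/
noncomputable def layer (x : Fin n → Fin q) (T : ℕ → ℕ) (j i : ℕ) : Finset (Finset (Fin n)) :=
  Finset.univ.filter fun S => ∀ l,
    hist x S l + (if j = l then 1 else 0) = T l + if i = l then 1 else 0

theorem mem_layer {x : Fin n → Fin q} {T : ℕ → ℕ} {S : Finset (Fin n)} {j i : ℕ} :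
    S ∈ layer x T j i ↔ ∀ l,
      hist x S l + (if j = l then 1 else 0) = T l + if i = l then 1 else 0 := by
  simp [layer]

/-- Removing from a set of the layer `(j, i)` all but `j` copies of a value of multiplicity `i`
gives a set with the original histogram; there are many such values and few ways back. -/
theorem card_layer_mul_le {k : ℕ} {r' : Fin (k - 1) → ℕ} {x : Fin n → Fin q}
    (hx : ∀ S a, mult x S a < k) {S₀ : Finset (Fin n)} (h₀ : S₀ ∈ startSets k r' x)
    {j i r : ℕ} (hji : j < i) (hr : r ≤ hist x S₀ i) :
    (layer x (hist x S₀) j i).card * r ≤ (startSets k r' x).card * (n * 2 ^ k) := by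
  classical
  set V := startSets k r' x with hV
  set La := layer x (hist x S₀) j i with hLa
  let Pairs : Finset ((_ : Finset (Fin n)) × Fin n) := La.sigma fun S => part x S i
  have h1 : La.card * r ≤ Pairs.card := by
    rw [Finset.card_sigma, ← smul_eq_mul, ← Finset.sum_const]
    refine Finset.sum_le_sum fun S hS => ?_
    have h := mem_layer.1 hS i
    rw [if_neg hji.ne, if_pos rfl] at h
    rw [card_part]
    nlinarith
  let Targets : Finset (Finset (Fin n) × ((_ : Fin n) × Finset (Fin n))) :=
    V ×ˢ (Finset.univ.sigma fun b => (Finset.univ.filter fun l => x l = x b).powerset)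
  have h2 : Targets.card ≤ V.card * (n * 2 ^ k) := by
    rw [Finset.card_product]
    refine Nat.mul_le_mul_left _ ?_
    rw [Finset.card_sigma]
    calc _ ≤ ∑ _b : Fin n, 2 ^ k := Finset.sum_le_sum fun b _ => by
            rw [Finset.card_powerset]
            exact Nat.pow_le_pow_right (by norm_num) (hx Finset.univ (x b)).le
      _ = n * 2 ^ k := by simp
  refine h1.trans (le_trans ?_ h2)
  -- the removed set is chosen inside the class of the value; it is recorded with a member of the class
  have hB : ∀ p : (_ : Finset (Fin n)) × Fin n, ∃ B : Finset (Fin n),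
      p ∈ Pairs → B ⊆ (p.1.filter fun l => x l = x p.2) ∧ B.card = i - j := by
    intro p
    by_cases hp : p ∈ Pairs
    · have hc : (p.1.filter fun l => x l = x p.2).card = i :=
        (Finset.mem_filter.1 (Finset.mem_sigma.1 hp).2).2
      obtain ⟨B, hB, hB'⟩ := Finset.exists_subset_card_eq
        (show i - j ≤ (p.1.filter fun l => x l = x p.2).card by omega)
      exact ⟨B, fun _ => ⟨hB, hB'⟩⟩
    · exact ⟨∅, fun h => absurd h hp⟩
  choose B hB using hB
  refine Finset.card_le_card_of_injOn (fun p => (p.1 \ B p, ⟨p.2, B p⟩)) ?_ ?_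
  · intro p hp
    obtain ⟨hsub, hcard⟩ := hB p hp
    have hpm := Finset.mem_sigma.1 hp
    have hc : (p.1.filter fun l => x l = x p.2).card = i := (Finset.mem_filter.1 hpm.2).2
    have hm : mult x (p.1 \ B p) (x p.2) = j := by
      have : (p.1 \ B p).filter (fun l => x l = x p.2) =
          (p.1.filter fun l => x l = x p.2) \ B p := by
        ext l; simp only [Finset.mem_filter, Finset.mem_sdiff]; tauto
      rw [mult, this, Finset.card_sdiff_of_subset hsub, hc, hcard]
      omega
    have hm' : ∀ a', a' ≠ x p.2 → mult x (p.1 \ B p) a' = mult x p.1 a' := by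
      intro a' ha'
      rw [mult, mult]
      congr 1
      ext l
      simp only [Finset.mem_filter, Finset.mem_sdiff]
      constructor
      · rintro ⟨⟨h1, _⟩, h2⟩; exact ⟨h1, h2⟩
      · rintro ⟨h1, h2⟩
        refine ⟨⟨h1, fun h3 => ha' ?_⟩, h2⟩
        rw [← h2]
        exact (Finset.mem_filter.1 (hsub h3)).2
    simp only [Targets, Finset.mem_coe, Finset.mem_product, Finset.mem_sigma, Finset.mem_univ,
      true_and, Finset.mem_powerset, hV]
    refine ⟨(hist_eq_of_mem_startSets hx h₀).2 fun l => ?_, fun l hl => ?_⟩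
    · have h3 := hist_add_of_mult_eq hm' l
      have h4 := mem_layer.1 hpm.1 l
      rw [hm] at h3
      have h5 : mult x p.1 (x p.2) = i := hc
      rw [h5] at h3
      omega
    · have := hsub hl
      simp only [Finset.mem_filter, Finset.mem_univ, true_and] at this ⊢
      exact this.2
  · rintro ⟨S, b⟩ hp ⟨S', b'⟩ hp' h
    simp only [Prod.mk.injEq, Sigma.mk.injEq] at h
    obtain ⟨h1, rfl, h2⟩ := h
    have h2 := eq_of_heq h2
    have e1 : B ⟨S, b⟩ ⊆ S := (hB _ hp).1.trans (Finset.filter_subset _ _)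
    have e2 : B ⟨S', b⟩ ⊆ S' := (hB _ hp').1.trans (Finset.filter_subset _ _)
    have : S = S' := by
      rw [← Finset.sdiff_union_of_subset e1, ← Finset.sdiff_union_of_subset e2, h1, h2]
    rw [this]

end KDistinctness

namespace KDistinctness

open CoinedWalk PhaseDetection

variable {n q w : ℕ}

/-! ### The walk -/

/-- The vertices of the walk.  The vertex `(S, d, c, z)` stands for a set `S` obtained from a
starting set of size `z` by adding `d` elements of a single value; if `d > 0`, then `c` is the
multiplicity of this value in `S`.  A starting vertex has `d = 0`, and `c = 0` unless it is marked
from the outset. -/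
abbrev Vertex (n w : ℕ) : Type := Finset (Fin n) × BitVec w × BitVec w × BitVec w

/-- The distinguished value of the vertex occurs `k` times: a collision has been found. -/
def Marked (k : ℕ) (y : Vertex n w) : Prop := y.2.2.1 = BitVec.ofNat w k

instance (k : ℕ) : DecidablePred (Marked (n := n) (w := w) k) := fun _ => decEq _ _

/-- The label of a vertex at depth `d` whose distinguished value has multiplicity `c`. -/
def label (d c : BitVec w) : BitVec w := if d = 0 then 0 else c

/-- Follow the edge with the direction `g`: the position `b = g / 2 ^ s` is added to the set or
removed from it, provided that the value at `b` is the distinguished one (at depth `0`, where no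
value is distinguished yet, any value may be) and occurs at most `k` times.  All other directions,
and the direction `0`, are loops. -/
def move (k s : ℕ) (x : Fin n → Fin q) (p : Vertex n w × BitVec w) : Vertex n w × BitVec w :=
  if hb : p.2.toNat / 2 ^ s < n then
    let b : Fin n := ⟨p.2.toNat / 2 ^ s, hb⟩
    let c := mult x (p.1.1.erase b) (x b)
    if b ∈ p.1.1 then
      if p.2 ≠ 0 ∧ c < k ∧ p.1.2.2.1 = BitVec.ofNat w c + 1 then
        ((p.1.1.erase b, p.1.2.1 - 1, label (p.1.2.1 - 1) (BitVec.ofNat w c), p.1.2.2.2), p.2)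
      else p
    else
      if p.2 ≠ 0 ∧ c < k ∧ p.1.2.2.1 = label p.1.2.1 (BitVec.ofNat w c) then
        ((insert b p.1.1, p.1.2.1 + 1, BitVec.ofNat w c + 1, p.1.2.2.2), p.2)
      else p
  else p

theorem move_snd (k s : ℕ) (x : Fin n → Fin q) (p : Vertex n w × BitVec w) :
    (move k s x p).2 = p.2 := by
  simp only [move]
  split_ifs <;> rfl

theorem move_of_snd_eq_zero (k s : ℕ) (x : Fin n → Fin q) {p : Vertex n w × BitVec w}
    (h : p.2 = 0) : move k s x p = p := by
  simp only [move]
  split_ifs with h1 h2 h3 h3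
  · exact absurd h h3.1
  · rfl
  · exact absurd h h3.1
  · rfl
  · rfl

theorem move_involutive (k s : ℕ) (x : Fin n → Fin q) :
    Function.Involutive (move (w := w) k s x) := by
  rintro ⟨⟨S, d, c, z⟩, g⟩
  by_cases hb : g.toNat / 2 ^ s < n
  · by_cases hS : (⟨g.toNat / 2 ^ s, hb⟩ : Fin n) ∈ S
    · by_cases h : g ≠ 0 ∧ mult x (S.erase ⟨g.toNat / 2 ^ s, hb⟩) (x ⟨g.toNat / 2 ^ s, hb⟩) < k ∧
          c = BitVec.ofNat w (mult x (S.erase ⟨g.toNat / 2 ^ s, hb⟩)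
            (x ⟨g.toNat / 2 ^ s, hb⟩)) + 1
      · have h1 : move k s x ((S, d, c, z), g) = ((S.erase ⟨g.toNat / 2 ^ s, hb⟩, d - 1,
            label (d - 1) (BitVec.ofNat w (mult x (S.erase ⟨g.toNat / 2 ^ s, hb⟩)
              (x ⟨g.toNat / 2 ^ s, hb⟩))), z), g) := by
          simp only [move, dif_pos hb, if_pos hS, if_pos h]
        rw [h1]
        have hS' : (⟨g.toNat / 2 ^ s, hb⟩ : Fin n) ∉ S.erase ⟨g.toNat / 2 ^ s, hb⟩ :=
          Finset.notMem_erase _ _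
        simp only [move, dif_pos hb, if_neg hS', Finset.erase_idem]
        rw [if_pos ⟨h.1, h.2.1, trivial⟩, Finset.insert_erase hS, ← h.2.2]
        simp
      · have h1 : move k s x ((S, d, c, z), g) = ((S, d, c, z), g) := by
          simp only [move, dif_pos hb, if_pos hS, if_neg h]
        rw [h1, h1]
    · by_cases h : g ≠ 0 ∧ mult x (S.erase ⟨g.toNat / 2 ^ s, hb⟩) (x ⟨g.toNat / 2 ^ s, hb⟩) < k ∧
          c = label d (BitVec.ofNat w (mult x (S.erase ⟨g.toNat / 2 ^ s, hb⟩)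
            (x ⟨g.toNat / 2 ^ s, hb⟩)))
      · have h1 : move k s x ((S, d, c, z), g) = ((insert ⟨g.toNat / 2 ^ s, hb⟩ S, d + 1,
            BitVec.ofNat w (mult x (S.erase ⟨g.toNat / 2 ^ s, hb⟩)
              (x ⟨g.toNat / 2 ^ s, hb⟩)) + 1, z), g) := by
          simp only [move, dif_pos hb, if_neg hS, if_pos h]
        rw [h1]
        have hS' : (⟨g.toNat / 2 ^ s, hb⟩ : Fin n) ∈ insert ⟨g.toNat / 2 ^ s, hb⟩ S :=
          Finset.mem_insert_self _ _
        have hE : S.erase ⟨g.toNat / 2 ^ s, hb⟩ = S := Finset.erase_eq_of_notMem hS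
        rw [hE] at h
        simp only [move, dif_pos hb, if_pos hS', Finset.erase_insert hS, hE, BitVec.add_sub_cancel]
        rw [if_pos ⟨h.1, h.2.1, trivial⟩, ← h.2.2]
      · have h1 : move k s x ((S, d, c, z), g) = ((S, d, c, z), g) := by
          simp only [move, dif_pos hb, if_neg hS, if_neg h]
        rw [h1, h1]
  · have h1 : move k s x ((S, d, c, z), g) = ((S, d, c, z), g) := by
      simp only [move, dif_neg hb]
    rw [h1, h1]

/-- The sign of a direction after the move: `-1` at the loop `0` of a vertex with the label `0`, which
is the case for unmarked starting vertices, and of a marked vertex, where it makes up for the sign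
of the coin. -/
def sign (k : ℕ) (p : Vertex n w × BitVec w) : ℝ :=
  if p.2 = 0 ∧ (p.1.2.2.1 = 0 ∨ p.1.2.2.1 = BitVec.ofNat w k) then -1 else 1

theorem sign_mul_sign (k : ℕ) (p : Vertex n w × BitVec w) : sign k p * sign k p = 1 := by
  simp only [sign]
  split_ifs <;> norm_num

/-- The vertex at which the walk starts when the given set is `S`; it is marked if `S` contains
more than `k` equal values. -/
def startVertex (w k : ℕ) (r : Fin (k - 1) → ℕ) (S : Finset (Fin n)) : Vertex n w :=
  (S, 0, if BitVec.ofNat w S.card = BitVec.ofNat w (startSize k r) then 0 else BitVec.ofNat w k,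
    BitVec.ofNat w S.card)

/-- The uniform superposition of the starting vertices, with the direction `0`. -/
noncomputable def startVector (w k : ℕ) (r : Fin (k - 1) → ℕ) (x : Fin n → Fin q)
    (p : Vertex n w × BitVec w) : ℝ :=
  if p.2 = 0 ∧ p.1 = startVertex w k r p.1.1 ∧ p.1.1 ∈ startSets k r x then
    (Real.sqrt (startSets k r x).card)⁻¹ else 0

/-- One step of the walk. -/
noncomputable def walk (k s L : ℕ) (x : Fin n → Fin q) (f : Vertex n w × BitVec w → ℝ) :
    Vertex n w × BitVec w → ℝ :=
  step (Marked k) L (move k s x) (sign k) f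

theorem dot_walk (k s : ℕ) {L : ℕ} (hL : L ≤ w) (x : Fin n → Fin q)
    (u v : Vertex n w × BitVec w → ℝ) : walk k s L x u ⬝ᵥ walk k s L x v = u ⬝ᵥ v :=
  dot_step _ hL (move_involutive k s x) (sign_mul_sign k) u v

theorem ofNat_inj {a b : ℕ} (ha : a < 2 ^ w) (hb : b < 2 ^ w) :
    BitVec.ofNat w a = BitVec.ofNat w b ↔ a = b := by
  constructor
  · intro h
    have := congrArg BitVec.toNat h
    rwa [BitVec.toNat_ofNat, BitVec.toNat_ofNat, Nat.mod_eq_of_lt ha, Nat.mod_eq_of_lt hb] at this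
  · rintro rfl; rfl

theorem ofNat_add_one (a : ℕ) : BitVec.ofNat w a + 1 = BitVec.ofNat w (a + 1) := by
  rw [BitVec.ofNat_add]; rfl

theorem ofNat_zero' : (0 : BitVec w) = BitVec.ofNat w 0 := rfl

/-! ### Inputs without collisions -/

section NoCollision

variable (w) in
/-- The vertices that can be reached from the starting vertices, when no value occurs `k` times. -/
def Reached (k : ℕ) (r : Fin (k - 1) → ℕ) (x : Fin n → Fin q) (S₀ : Finset (Fin n))
    (y : Vertex n w) : Prop :=
  y.2.2.2 = BitVec.ofNat w (startSize k r) ∧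
  ((y.1 ∈ startSets k r x ∧ y.2.1 = 0 ∧ y.2.2.1 = 0) ∨
    ∃ j i, j < i ∧ i < k ∧ y.1 ∈ layer x (hist x S₀) j i ∧
      y.2.1 = BitVec.ofNat w (i - j) ∧ y.2.2.1 = BitVec.ofNat w i)

variable {k : ℕ} {r : Fin (k - 1) → ℕ} {x : Fin n → Fin q} {S₀ : Finset (Fin n)}

theorem Reached.not_marked (hkw : k < 2 ^ w) (hk : 1 ≤ k) {y : Vertex n w}
    (h : Reached w k r x S₀ y) : ¬ Marked k y := by
  intro hm
  rw [Marked] at hm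
  rcases h.2 with ⟨_, _, h0⟩ | ⟨j, i, hji, hik, _, _, hi⟩
  · rw [h0, ofNat_zero', ofNat_inj (by omega) hkw] at hm
    omega
  · rw [hi, ofNat_inj (by omega) hkw] at hm
    omega

theorem Reached.move (hx : ∀ S a, mult x S a < k) (h₀ : S₀ ∈ startSets k r x)
    (hkw : k < 2 ^ w) (s : ℕ) {p : Vertex n w × BitVec w} (h : Reached w k r x S₀ p.1) :
    Reached w k r x S₀ (move k s x p).1 := by
  obtain ⟨⟨S, d, c, z⟩, g⟩ := p
  obtain ⟨hz, h⟩ := h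
  simp only at hz h
  by_cases hb : g.toNat / 2 ^ s < n
  swap
  · simp only [KDistinctness.move, dif_neg hb]; exact ⟨hz, h⟩
  simp only [KDistinctness.move, dif_pos hb]
  set b : Fin n := ⟨g.toNat / 2 ^ s, hb⟩
  by_cases hS : b ∈ S
  · simp only [if_pos hS]
    set E := S.erase b with hE
    have hbE : b ∉ E := Finset.notMem_erase _ _
    have hSE : S = insert b E := (Finset.insert_erase hS).symm
    have hist1 := hist_insert (x := x) hbE
    rw [← hSE] at hist1
    set m := mult x E (x b) with hm
    split_ifs with hc
    swap
    · exact ⟨hz, h⟩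
    obtain ⟨_, hmk, hc⟩ := hc
    rw [ofNat_add_one] at hc
    refine ⟨hz, ?_⟩
    simp only
    rcases h with ⟨_, _, h0⟩ | ⟨j, i, hji, hik, hl, hd, hi⟩
    · rw [h0, ofNat_zero', ofNat_inj (by omega) (by omega)] at hc
      omega
    · rw [hi, ofNat_inj (by omega) (by omega)] at hc
      subst hc
      rw [mem_layer] at hl
      have hd1 : d - 1 = BitVec.ofNat w (m - j) := by
        rw [hd, show m + 1 - j = (m - j) + 1 by omega, ← ofNat_add_one, BitVec.add_sub_cancel]
      rcases Nat.lt_or_ge j m with hjm | hjm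
      · right
        have hne : ¬ (d - 1 = 0) := by
          rw [hd1, ofNat_zero', ofNat_inj (by omega) (by omega)]
          omega
        refine ⟨j, m, hjm, by omega, ?_, hd1, by rw [label, if_neg hne]⟩
        rw [mem_layer]
        intro l
        have e1 := hist1 l
        have e2 := hl l
        omega
      · left
        have hjm : j = m := by omega
        subst hjm
        have hd0 : d - 1 = 0 := by rw [hd1, Nat.sub_self]; rfl
        refine ⟨?_, hd0, by rw [label, if_pos hd0]⟩
        rw [hist_eq_of_mem_startSets hx h₀]
        intro l
        have e1 := hist1 l
        have e2 := hl l
        omega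
  · simp only [if_neg hS]
    have hE : S.erase b = S := Finset.erase_eq_of_notMem hS
    rw [hE]
    have hist1 := hist_insert (x := x) hS
    have hlt := hx (insert b S) (x b)
    rw [mult_insert hS, if_pos rfl] at hlt
    set m := mult x S (x b) with hm
    split_ifs with hc
    swap
    · exact ⟨hz, h⟩
    obtain ⟨_, hmk, hc⟩ := hc
    rw [ofNat_add_one]
    refine ⟨hz, Or.inr ?_⟩
    simp only
    rcases h with ⟨hV, hd, h0⟩ | ⟨j, i, hji, hik, hl, hd, hi⟩
    · refine ⟨m, m + 1, by omega, hlt, ?_, ?_, rfl⟩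
      · rw [mem_layer]
        intro l
        have e1 := hist1 l
        have e2 := (hist_eq_of_mem_startSets hx h₀).1 hV l
        omega
      · rw [hd, ofNat_zero', ofNat_add_one]
        congr 1
        omega
    · have hne : ¬ (d = 0) := by
        rw [hd, ofNat_zero', ofNat_inj (by omega) (by omega)]
        omega
      rw [label, if_neg hne, hi, ofNat_inj (by omega) (by omega)] at hc
      rw [hc] at hl hd hji
      refine ⟨j, m + 1, by omega, hlt, ?_, ?_, rfl⟩
      · rw [mem_layer] at hl ⊢
        intro l
        have e1 := hist1 l
        have e2 := hl l
        omega
      · rw [hd, ofNat_add_one]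
        congr 1
        omega

theorem reached_move_iff (hx : ∀ S a, mult x S a < k) (h₀ : S₀ ∈ startSets k r x)
    (hkw : k < 2 ^ w) (s : ℕ) {p : Vertex n w × BitVec w} :
    Reached w k r x S₀ (move k s x p).1 ↔ Reached w k r x S₀ p.1 := by
  refine ⟨fun h => ?_, fun h => h.move hx h₀ hkw s⟩
  have := h.move hx h₀ hkw s
  rwa [move_involutive] at this

open scoped Classical in
/-- The number of vertices that can be reached exceeds the number of starting sets by a factor of
the order `n / ρ` only. -/
theorem card_reached_mul_le (hx : ∀ S a, mult x S a < k) (h₀ : S₀ ∈ startSets k r x)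
    {ρ : ℕ} (hρ : ∀ i, ρ ≤ r i) (hρn : ρ ≤ n) :
    (Finset.univ.filter fun y : Vertex n w => Reached w k r x S₀ y).card * ρ ≤
      (startSets k r x).card * (n * (k ^ 2 * 2 ^ k + 1)) := by
  set V := startSets k r x with hV
  let z := BitVec.ofNat w (startSize k r)
  let A : Finset (Vertex n w) := V.image fun S => (S, 0, 0, z)
  let ij := ((Finset.range k) ×ˢ (Finset.range k)).filter fun p => p.1 < p.2
  let B : ℕ × ℕ → Finset (Vertex n w) := fun p =>
    (layer x (hist x S₀) p.1 p.2).image fun S => (S, BitVec.ofNat w (p.2 - p.1),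
      BitVec.ofNat w p.2, z)
  have hsub : (Finset.univ.filter fun y : Vertex n w => Reached w k r x S₀ y) ⊆
      A ∪ ij.biUnion B := by
    rintro ⟨S, d, c, z'⟩ hy
    simp only [Finset.mem_filter, Finset.mem_univ, true_and] at hy
    obtain ⟨rfl, h⟩ := hy
    rcases h with ⟨h1, rfl, rfl⟩ | ⟨j, i, hji, hik, h1, rfl, rfl⟩
    · exact Finset.mem_union_left _ (Finset.mem_image.2 ⟨S, h1, rfl⟩)
    · refine Finset.mem_union_right _ (Finset.mem_biUnion.2 ⟨(j, i), ?_,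
        Finset.mem_image.2 ⟨S, h1, rfl⟩⟩)
      simp only [ij, Finset.mem_filter, Finset.mem_product, Finset.mem_range]
      omega
  have hB : ∀ p ∈ ij, (B p).card * ρ ≤ V.card * (n * 2 ^ k) := by
    intro p hp
    simp only [ij, Finset.mem_filter, Finset.mem_product, Finset.mem_range] at hp
    refine (Nat.mul_le_mul_right _ Finset.card_image_le).trans
      (card_layer_mul_le hx h₀ hp.2 ?_)
    have := hist_of_mem_startSets h₀ ⟨p.2 - 1, by omega⟩
    simp only [show p.2 - 1 + 1 = p.2 by omega] at this
    rw [this]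
    exact hρ _
  calc _ ≤ (A.card + ∑ p ∈ ij, (B p).card) * ρ := by
        refine Nat.mul_le_mul_right _ ((Finset.card_le_card hsub).trans
          ((Finset.card_union_le _ _).trans ?_))
        exact Nat.add_le_add_left Finset.card_biUnion_le _
    _ ≤ V.card * n + k ^ 2 * (V.card * (n * 2 ^ k)) := by
        rw [add_mul, Finset.sum_mul]
        refine Nat.add_le_add (Nat.mul_le_mul Finset.card_image_le hρn) ?_
        refine (Finset.sum_le_sum hB).trans ?_
        rw [Finset.sum_const, smul_eq_mul]
        refine Nat.mul_le_mul_right _ ((Finset.card_filter_le _ _).trans ?_)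
        rw [Finset.card_product, Finset.card_range, pow_two]
    _ = _ := by ring

/-- Without collisions the starting vector is a coboundary of small norm, hence the average of its
orbit is small. -/
theorem dot_average_le_of_not_hasCollision (hc : ¬ HasCollision k x) (hk : 1 ≤ k)
    (h₀ : S₀ ∈ startSets k r x) (hkw : k < 2 ^ w) {L : ℕ} (hL : L ≤ w) (s T : ℕ)
    {ρ : ℕ} (hρ : ∀ i, ρ ≤ r i) (hρn : ρ ≤ n) (hρ0 : 0 < ρ) :
    average (walk (w := w) k s L x) T (startVector w k r x) ⬝ᵥ
      average (walk (w := w) k s L x) T (startVector w k r x) ≤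
      2 ^ L * (n * (k ^ 2 * 2 ^ k + 1)) / (ρ * T ^ 2) := by
  classical
  have hx := mult_lt_of_not_hasCollision hc
  set V := startSets k r x with hV
  have hVpos : (0 : ℝ) < V.card := by
    exact_mod_cast Finset.card_pos.2 ⟨S₀, h₀⟩
  have hsq : Real.sqrt V.card ^ 2 = V.card := Real.sq_sqrt hVpos.le
  have hsq0 : Real.sqrt V.card ≠ 0 := by positivity
  -- `η` is uniform on the reached vertices, and `startVector = η - walk η`: the step preserves `η`
  -- except for the sign at the direction `0` of the starting vertices
  let a : ℝ := (2 * Real.sqrt V.card)⁻¹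
  let c : Vertex n w → ℝ := fun y => if Reached w k r x S₀ y then a else 0
  let η : Vertex n w × BitVec w → ℝ := fun p => if p.2.toNat < 2 ^ L then c p.1 else 0
  have hcoin : coin (Marked k) L η = η := by
    refine coin_eq_self _ hL c fun y hy => ?_
    simp only [c]
    rw [if_neg fun h => h.not_marked hkw hk hy]
  have hη : startVector w k r x = η - walk k s L x η := by
    funext p
    have h1 : walk k s L x η p = sign k p * η p := by
      rw [walk, step, hcoin, shift]
      simp only [η, c, move_snd, reached_move_iff hx h₀ hkw s]
    rw [Pi.sub_apply, h1]
    obtain ⟨⟨S, d, c', z⟩, g⟩ := p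
    by_cases hg : g = 0
    swap
    · have hg' : ¬ g = 0#w := hg
      simp [startVector, sign, hg']
    subst hg
    have hcard : ∀ S ∈ V, S.card = startSize k r := fun S hS =>
      (card_eq_startSize_iff hS hk).2 fun j _ => hx S _
    have hiff : ((S, d, c', z) = startVertex w k r S ∧ S ∈ V) ↔
        (Reached w k r x S₀ (S, d, c', z) ∧ (c' = 0 ∨ c' = BitVec.ofNat w k)) := by
      constructor
      · rintro ⟨h, hS⟩
        rw [startVertex, hcard S hS, if_pos rfl] at h
        simp only [Prod.mk.injEq, true_and] at h
        obtain ⟨rfl, rfl, rfl⟩ := h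
        exact ⟨⟨rfl, Or.inl ⟨hS, rfl, rfl⟩⟩, Or.inl rfl⟩
      · rintro ⟨h, hc'⟩
        have hc0 : c' = 0 := hc'.resolve_right fun h' => h.not_marked hkw hk h'
        subst hc0
        obtain ⟨hz, h⟩ := h
        simp only at hz h
        rcases h with ⟨hS, rfl, _⟩ | ⟨j, i, hji, hik, _, _, hi⟩
        · refine ⟨?_, hS⟩
          rw [startVertex, hcard S hS, if_pos rfl, hz]
        · rw [ofNat_zero', ofNat_inj (by omega) (by omega)] at hi
          omega
    simp only [startVector, true_and, ← hV, hiff, sign, η, c]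
    have h2L : (0 : BitVec w).toNat < 2 ^ L := by simp
    simp only [h2L, if_true]
    by_cases h1 : Reached w k r x S₀ (S, d, c', z)
    · by_cases h2 : c' = 0 ∨ c' = BitVec.ofNat w k
      · simp only [h1, h2, and_self, if_true, a]
        field_simp; norm_num
      · simp only [h1, h2, and_false, if_true, if_false]; ring
    · simp [h1]
  refine (dot_average_le (dot_walk k s hL x) (step_sub _ _ _ _) T hη).trans ?_
  have hηη : η ⬝ᵥ η = 2 ^ L * ((Finset.univ.filter fun y : Vertex n w =>
      Reached w k r x S₀ y).card * a ^ 2) := by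
    rw [dotProduct, Fintype.sum_prod_type]
    simp only [η]
    have h1 : ∀ y : Vertex n w, (∑ g : BitVec w, (if g.toNat < 2 ^ L then c y else 0) *
        (if g.toNat < 2 ^ L then c y else 0)) = 2 ^ L * (c y * c y) := by
      intro y
      rw [← sum_toNat_lt hL]
      exact Finset.sum_congr rfl fun g _ => by split_ifs <;> simp
    rw [Finset.sum_congr rfl fun y _ => h1 y, ← Finset.mul_sum]
    congr 1
    rw [← nsmul_eq_mul, ← Finset.sum_const, Finset.sum_filter]
    refine Finset.sum_congr rfl fun y _ => ?_
    simp only [c]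
    split_ifs
    · ring
    · ring
  have hcard := card_reached_mul_le (w := w) hx h₀ hρ hρn
  have hcard' : ((Finset.univ.filter fun y : Vertex n w => Reached w k r x S₀ y).card : ℝ) * ρ ≤
      V.card * (n * (k ^ 2 * 2 ^ k + 1)) := by exact_mod_cast hcard
  have hρ0' : (0 : ℝ) < ρ := by exact_mod_cast hρ0
  rcases Nat.eq_zero_or_pos T with rfl | hT
  · simp
  have hT' : (0 : ℝ) < T := by exact_mod_cast hT
  rw [hηη, div_le_div_iff₀ (by positivity) (by positivity)]
  have ha : a ^ 2 = 1 / (4 * V.card) := by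
    simp only [a]
    rw [inv_pow, mul_pow, hsq, one_div]; norm_num
  rw [ha]
  have : 4 * (2 ^ L * (((Finset.univ.filter fun y : Vertex n w =>
      Reached w k r x S₀ y).card : ℝ) * (1 / (4 * V.card)))) * (ρ * (T : ℝ) ^ 2) =
      2 ^ L * T ^ 2 * ((((Finset.univ.filter fun y : Vertex n w =>
      Reached w k r x S₀ y).card : ℝ) * ρ) / V.card) := by
    field_simp
  rw [this]
  have h3 : (((Finset.univ.filter fun y : Vertex n w =>
      Reached w k r x S₀ y).card : ℝ) * ρ) / V.card ≤ n * (k ^ 2 * 2 ^ k + 1) := by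
    rw [div_le_iff₀ hVpos]
    linarith
  calc _ ≤ 2 ^ L * (T : ℝ) ^ 2 * (n * (k ^ 2 * 2 ^ k + 1)) :=
        mul_le_mul_of_nonneg_left h3 (by positivity)
    _ = _ := by ring

end NoCollision

end KDistinctness

namespace KDistinctness

open CoinedWalk PhaseDetection

variable {n q w : ℕ}

/-! ### Inputs with a collision -/

section Collision

/-- The position that the flow adds to `S`: the least element of `J` not in `S`. -/
def nextPos (J S : Finset (Fin n)) : ℕ :=
  if h : (J \ S).Nonempty then ((J \ S).min' h : Fin n) else 0

/-- Add to `S` the least element of `J` not in `S`, if there is one. -/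
def extendBy (J S : Finset (Fin n)) : Finset (Fin n) :=
  if h : (J \ S).Nonempty then insert ((J \ S).min' h) S else S

theorem extendBy_sdiff (J S : Finset (Fin n)) : extendBy J S \ J = S \ J := by
  rw [extendBy]
  split_ifs with h
  · have := Finset.min'_mem (J \ S) h
    exact Finset.insert_sdiff_of_mem _ (Finset.mem_sdiff.1 this).1
  · rfl

theorem iterate_extendBy_sdiff (J S : Finset (Fin n)) (l : ℕ) :
    (extendBy J)^[l] S \ J = S \ J := by
  induction l with
  | zero => rfl
  | succ l ih => rw [Function.iterate_succ_apply', extendBy_sdiff, ih]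

variable {k : ℕ} {r : Fin (k - 1) → ℕ} {x : Fin n → Fin q} {J : Finset (Fin n)} {v : Fin q}

theorem sdiff_nonempty_of_mult_lt (hJ : J.card = k) (hv : ∀ j ∈ J, x j = v)
    {S : Finset (Fin n)} (h : mult x S v < k) : (J \ S).Nonempty := by
  rw [Finset.sdiff_nonempty]
  intro hsub
  have : J.card ≤ mult x S v := Finset.card_le_card fun j hj => by
    simp [hsub hj, hv j hj]
  omega

theorem mult_extendBy (hJ : J.card = k) (hv : ∀ j ∈ J, x j = v)
    {S : Finset (Fin n)} (h : mult x S v < k) : mult x (extendBy J S) v = mult x S v + 1 := by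
  have hne := sdiff_nonempty_of_mult_lt hJ hv h
  have hm := Finset.mem_sdiff.1 (Finset.min'_mem _ hne)
  rw [extendBy, dif_pos hne, mult_insert hm.2, if_pos (hv _ hm.1)]

theorem mult_iterate_extendBy (hJ : J.card = k) (hv : ∀ j ∈ J, x j = v)
    {S : Finset (Fin n)} {l : ℕ} (h : mult x S v + l ≤ k) :
    mult x ((extendBy J)^[l] S) v = mult x S v + l := by
  induction l with
  | zero => rfl
  | succ l ih =>
    have h1 := ih (by omega)
    rw [Function.iterate_succ_apply', mult_extendBy hJ hv (by omega), h1]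
    rfl

/-- The number of steps that the flow takes from the starting set `S`; it stays at a starting vertex
that is already marked. -/
def pathLength (k : ℕ) (r : Fin (k - 1) → ℕ) (x : Fin n → Fin q) (v : Fin q)
    (S : Finset (Fin n)) : ℕ :=
  if S.card = startSize k r then k - mult x S v else 0

/-- The `l`-th vertex on the path of the flow from the starting set `S`. -/
def pathVertex (w k : ℕ) (r : Fin (k - 1) → ℕ) (x : Fin n → Fin q) (J : Finset (Fin n))
    (v : Fin q) (S : Finset (Fin n)) (l : ℕ) : Vertex n w :=
  if l = 0 then startVertex w k r S
  else ((extendBy J)^[l] S, BitVec.ofNat w l, BitVec.ofNat w (mult x S v + l),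
    BitVec.ofNat w S.card)

/-- The `e`-th of the parallel edges that the path takes from its `l`-th vertex. -/
def pathDir (w s : ℕ) (J : Finset (Fin n)) (S : Finset (Fin n)) (l e : ℕ) : BitVec w :=
  BitVec.ofNat w (nextPos J ((extendBy J)^[l] S) * 2 ^ s + e)

theorem pathLength_le (S : Finset (Fin n)) : pathLength k r x v S ≤ k := by
  rw [pathLength]
  split_ifs <;> omega

theorem pathVertex_fst (S : Finset (Fin n)) (l : ℕ) :
    (pathVertex w k r x J v S l).1 = (extendBy J)^[l] S := by
  rw [pathVertex]
  split_ifs with h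
  · subst h; rfl
  · rfl

theorem pathVertex_depth (S : Finset (Fin n)) (l : ℕ) :
    (pathVertex w k r x J v S l).2.1 = BitVec.ofNat w l := by
  rw [pathVertex]
  split_ifs with h
  · subst h; rfl
  · rfl

theorem mult_lt_of_card_eq {S : Finset (Fin n)} (hS : S ∈ startSets k r x) (hk : 1 ≤ k)
    (hg : S.card = startSize k r) (a : Fin q) : mult x S a < k := by
  by_cases h : ∃ j ∈ S, x j = a
  · obtain ⟨j, hj, rfl⟩ := h
    exact (card_eq_startSize_iff hS hk).1 hg j hj
  · have : mult x S a = 0 := by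
      rw [mult, Finset.card_eq_zero, Finset.filter_eq_empty_iff]
      intro j hj hja
      exact h ⟨j, hj, hja⟩
    omega

theorem pathVertex_zero (S : Finset (Fin n)) :
    pathVertex w k r x J v S 0 = startVertex w k r S := if_pos rfl

theorem marked_pathVertex {S : Finset (Fin n)} (hS : S ∈ startSets k r x) (hk : 1 ≤ k)
    (hnw : n < 2 ^ w) : Marked k (pathVertex w k r x J v S (pathLength k r x v S)) := by
  by_cases hg : S.card = startSize k r
  · have h1 := mult_lt_of_card_eq hS hk hg v
    have h2 : pathLength k r x v S = k - mult x S v := if_pos hg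
    rw [h2, pathVertex, if_neg (by omega), Marked]
    simp only
    congr 1
    omega
  · have h2 : pathLength k r x v S = 0 := if_neg hg
    have h3 : S.card ≤ n := (Finset.card_le_univ _).trans_eq (Fintype.card_fin n)
    rw [h2, pathVertex_zero, startVertex, Marked]
    simp only
    rw [if_neg]
    rw [ofNat_inj (by omega) (lt_of_le_of_lt (startSize_le hS hk) hnw)]
    exact hg

theorem nextPos_lt {J S : Finset (Fin n)} (h : (J \ S).Nonempty) : nextPos J S < n := by
  rw [nextPos, dif_pos h]
  exact Fin.isLt _

theorem pathDir_toNat {s L : ℕ} (hL : L ≤ w) (hn : n * 2 ^ s ≤ 2 ^ L) {S : Finset (Fin n)} {l e : ℕ}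
    (h : (J \ (extendBy J)^[l] S).Nonempty) (he : e < 2 ^ s) :
    (pathDir w s J S l e).toNat = nextPos J ((extendBy J)^[l] S) * 2 ^ s + e ∧
      nextPos J ((extendBy J)^[l] S) * 2 ^ s + e < 2 ^ L := by
  have h1 := nextPos_lt h
  have h2 : nextPos J ((extendBy J)^[l] S) * 2 ^ s + e < 2 ^ L := by
    have : (nextPos J ((extendBy J)^[l] S) + 1) * 2 ^ s ≤ n * 2 ^ s :=
      Nat.mul_le_mul_right _ h1
    rw [add_mul] at this
    omega
  refine ⟨?_, h2⟩
  rw [pathDir, BitVec.toNat_ofNat, Nat.mod_eq_of_lt]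
  exact lt_of_lt_of_le h2 (Nat.pow_le_pow_right (by norm_num) hL)

/-- Each of the parallel edges leads from one vertex of the path to the next. -/
theorem move_pathVertex (hJ : J.card = k) (hv : ∀ j ∈ J, x j = v) (hk : 1 ≤ k) {S : Finset (Fin n)}
    (hkw : k < 2 ^ w) {s L : ℕ} (hL : L ≤ w) (hn : n * 2 ^ s ≤ 2 ^ L)
    {l e : ℕ} (hl : l < pathLength k r x v S) (he1 : 1 ≤ e) (he : e < 2 ^ s) :
    move k s x (pathVertex w k r x J v S l, pathDir w s J S l e) =
      (pathVertex w k r x J v S (l + 1), pathDir w s J S l e) := by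
  have hg : S.card = startSize k r := by
    by_contra hg
    rw [pathLength, if_neg hg] at hl
    omega
  rw [pathLength, if_pos hg] at hl
  have hm := mult_iterate_extendBy hJ hv (S := S) (l := l) (by omega)
  have hne := sdiff_nonempty_of_mult_lt hJ hv (S := (extendBy J)^[l] S) (by omega)
  obtain ⟨ht, _⟩ := pathDir_toNat (w := w) hL hn hne he
  set Sl := (extendBy J)^[l] S with hSl
  have hdiv : (pathDir w s J S l e).toNat / 2 ^ s = nextPos J Sl := by
    rw [ht, mul_comm, Nat.mul_add_div (by positivity), Nat.div_eq_of_lt he, add_zero]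
  have hb : (pathDir w s J S l e).toNat / 2 ^ s < n := by rw [hdiv]; exact nextPos_lt hne
  have hbe : (⟨(pathDir w s J S l e).toNat / 2 ^ s, hb⟩ : Fin n) = (J \ Sl).min' hne := by
    apply Fin.ext
    simp only [hdiv, nextPos, dif_pos hne]
  have hmem := Finset.mem_sdiff.1 (Finset.min'_mem _ hne)
  have h0 : pathDir w s J S l e ≠ 0 := by
    intro h
    rw [h] at ht
    simp at ht
    omega
  have hext : (extendBy J)^[l + 1] S = insert ((J \ Sl).min' hne) Sl := by
    rw [Function.iterate_succ_apply', ← hSl, extendBy, dif_pos hne]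
  simp only [move, dif_pos hb, hbe, pathVertex_fst, pathVertex_depth]
  rw [← hSl, if_neg hmem.2, Finset.erase_eq_of_notMem hmem.2, hv _ hmem.1, hm, if_pos]
  · have hlast : (pathVertex w k r x J v S l).2.2.2 = BitVec.ofNat w S.card := by
      rw [pathVertex]
      split_ifs <;> rfl
    have hsucc : pathVertex w k r x J v S (l + 1) = ((extendBy J)^[l + 1] S,
        BitVec.ofNat w (l + 1), BitVec.ofNat w (mult x S v + (l + 1)), BitVec.ofNat w S.card) :=
      if_neg (Nat.succ_ne_zero l)
    rw [hsucc, hext, hlast, ofNat_add_one, ofNat_add_one, add_assoc]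
  · refine ⟨h0, by omega, ?_⟩
    rw [pathVertex, label]
    rcases Nat.eq_zero_or_pos l with rfl | hl0
    · simp [startVertex, hg]
    · rw [if_neg (by omega), if_neg]
      rw [ofNat_zero', ofNat_inj (by omega) (by omega)]
      omega

open scoped Classical in
/-- The sum, over all paths, of the indicator of their edges in the forward direction. -/
noncomputable def pathEdges (w k s : ℕ) (r : Fin (k - 1) → ℕ) (x : Fin n → Fin q)
    (J : Finset (Fin n)) (v : Fin q) (p : Vertex n w × BitVec w) : ℝ :=
  ∑ S ∈ startSets k r x, ∑ l ∈ Finset.range (pathLength k r x v S), ∑ e ∈ Finset.Ico 1 (2 ^ s),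
    if (pathVertex w k r x J v S l, pathDir w s J S l e) = p then 1 else 0

theorem pathEdges_nonneg {s : ℕ} (p : Vertex n w × BitVec w) :
    0 ≤ pathEdges w k s r x J v p :=
  Finset.sum_nonneg fun _ _ => Finset.sum_nonneg fun _ _ => Finset.sum_nonneg fun _ _ => by
    split_ifs <;> norm_num

theorem sdiff_nonempty_of_lt_pathLength (hJ : J.card = k) (hv : ∀ j ∈ J, x j = v)
    {S : Finset (Fin n)} {l : ℕ} (hl : l < pathLength k r x v S) :
    (J \ (extendBy J)^[l] S).Nonempty := by
  rw [pathLength] at hl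
  split_ifs at hl with hg
  · have hm := mult_iterate_extendBy hJ hv (S := S) (l := l) (by omega)
    exact sdiff_nonempty_of_mult_lt hJ hv (by omega)
  · omega

/-- Every edge carries at most `2 ^ k` paths, since a starting set is determined by an edge of its
path and by its trace on `J`. -/
theorem pathEdges_le (hJ : J.card = k) (hv : ∀ j ∈ J, x j = v) (hkw : k < 2 ^ w) {s L : ℕ}
    (hL : L ≤ w) (hn : n * 2 ^ s ≤ 2 ^ L) (p : Vertex n w × BitVec w) :
    pathEdges w k s r x J v p ≤ 2 ^ k := by
  classical
  let idx : Finset (Finset (Fin n) × ℕ × ℕ) :=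
    (startSets k r x ×ˢ Finset.range (k + 1) ×ˢ Finset.Ico 1 (2 ^ s)).filter fun t =>
      t.2.1 < pathLength k r x v t.1 ∧ (pathVertex w k r x J v t.1 t.2.1,
        pathDir w s J t.1 t.2.1 t.2.2) = p
  have h1 : pathEdges w k s r x J v p = idx.card := by
    rw [pathEdges, Finset.card_filter, Finset.sum_product]
    push_cast
    refine Finset.sum_congr rfl fun S _ => ?_
    rw [Finset.sum_product]
    have hsub : Finset.range (pathLength k r x v S) ⊆ Finset.range (k + 1) :=
      Finset.range_subset_range.2 ((pathLength_le S).trans (Nat.le_succ k))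
    rw [← Finset.sum_subset hsub]
    · refine Finset.sum_congr rfl fun l hl => Finset.sum_congr rfl fun e _ => ?_
      rw [Finset.mem_range] at hl
      simp [hl]
    · intro l _ hl
      rw [Finset.mem_range] at hl
      exact Finset.sum_eq_zero fun e _ => by simp [hl]
  rw [h1]
  have h2 : idx.card ≤ J.powerset.card := by
    refine Finset.card_le_card_of_injOn (fun t => t.1 ∩ J) ?_ ?_
    · intro t _
      simp
    · rintro ⟨S, l, e⟩ ht ⟨S', l', e'⟩ ht' hSJ
      simp only [idx, Finset.coe_filter, Finset.mem_product, Finset.mem_range, Finset.mem_Ico,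
        Set.mem_ofPred_eq] at ht ht'
      obtain ⟨⟨_, hlk, he⟩, hl, hp⟩ := ht
      obtain ⟨⟨_, hlk', he'⟩, hl', hp'⟩ := ht'
      simp only at hSJ
      have hpp := hp.trans hp'.symm
      rw [Prod.ext_iff] at hpp
      obtain ⟨hv1, hd1⟩ := hpp
      simp only at hv1 hd1
      have e1 : l = l' := by
        have := congrArg (fun y : Vertex n w => y.2.1) hv1
        simp only [pathVertex_depth] at this
        exact (ofNat_inj (by omega) (by omega)).1 this
      subst e1
      have hfst := congrArg Prod.fst hv1
      rw [pathVertex_fst, pathVertex_fst] at hfst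
      have e2 : S = S' := by
        have := congrArg (· \ J) hfst
        simp only [iterate_extendBy_sdiff] at this
        rw [← Finset.sdiff_union_inter S J, ← Finset.sdiff_union_inter S' J, this, hSJ]
      subst e2
      have hne := sdiff_nonempty_of_lt_pathLength hJ hv hl
      have t1 := (pathDir_toNat (w := w) hL hn hne he.2).1
      have t2 := (pathDir_toNat (w := w) hL hn hne he'.2).1
      rw [hd1, t2] at t1
      have e3 : e = e' := by omega
      rw [e3]
  rw [Finset.card_powerset, hJ] at h2
  exact_mod_cast h2

theorem sum_pathEdges_le {s : ℕ} (hs : 1 ≤ 2 ^ s) :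
    ∑ p, pathEdges w k s r x J v p ≤ (startSets k r x).card * (k * (2 ^ s - 1)) := by
  classical
  simp only [pathEdges]
  rw [Finset.sum_comm, ← nsmul_eq_mul, ← Finset.sum_const]
  refine Finset.sum_le_sum fun S _ => ?_
  rw [Finset.sum_comm]
  have : ∀ l ∈ Finset.range (pathLength k r x v S),
      ∑ p : Vertex n w × BitVec w, ∑ e ∈ Finset.Ico 1 (2 ^ s),
        (if (pathVertex w k r x J v S l, pathDir w s J S l e) = p then (1 : ℝ) else 0) =
        2 ^ s - 1 := by
    intro l _
    rw [Finset.sum_comm]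
    simp [Finset.sum_ite_eq, Nat.cast_sub hs]
  rw [Finset.sum_congr rfl this, Finset.sum_const, Finset.card_range, nsmul_eq_mul]
  refine mul_le_mul_of_nonneg_right (by exact_mod_cast pathLength_le S) ?_
  have : (1 : ℝ) ≤ 2 ^ s := by exact_mod_cast hs
  linarith

/-- The invariant vector of the walk: the starting vector, and a flow along the paths that feeds on
it and ends at marked vertices. -/
noncomputable def flowVector (w k s : ℕ) (r : Fin (k - 1) → ℕ) (x : Fin n → Fin q)
    (J : Finset (Fin n)) (v : Fin q) (p : Vertex n w × BitVec w) : ℝ :=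
  startVector w k r x p - (Real.sqrt (startSets k r x).card)⁻¹ / (2 ^ s - 1) *
    (pathEdges w k s r x J v p - pathEdges w k s r x J v (move k s x p))

theorem startVector_dot_self (hne : (startSets k r x).Nonempty) :
    startVector w k r x ⬝ᵥ startVector w k r x = 1 := by
  classical
  have hVpos : (0 : ℝ) < (startSets k r x).card := by
    exact_mod_cast Finset.card_pos.2 hne
  have h : ∀ p : Vertex n w × BitVec w, startVector w k r x p * startVector w k r x p =
      if p ∈ (startSets k r x).image (fun S => (startVertex w k r S, (0 : BitVec w))) then
        ((startSets k r x).card : ℝ)⁻¹ else 0 := by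
    intro p
    have hiff : p ∈ (startSets k r x).image (fun S => (startVertex w k r S, (0 : BitVec w))) ↔
        (p.2 = 0 ∧ p.1 = startVertex w k r p.1.1 ∧ p.1.1 ∈ startSets k r x) := by
      rw [Finset.mem_image]
      constructor
      · rintro ⟨S, hS, rfl⟩
        exact ⟨rfl, rfl, hS⟩
      · rintro ⟨h1, h2, h3⟩
        exact ⟨p.1.1, h3, by rw [← h2, ← h1]⟩
    simp only [hiff, startVector]
    split_ifs
    · rw [← mul_inv, Real.mul_self_sqrt hVpos.le]
    · simp
  rw [dotProduct, Finset.sum_congr rfl fun p _ => h p, Finset.sum_ite_mem, Finset.univ_inter,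
    Finset.sum_const, Finset.card_image_of_injective, nsmul_eq_mul, mul_inv_cancel₀ hVpos.ne']
  intro S S' h
  exact congrArg (fun p : Vertex n w × BitVec w => p.1.1) h

theorem startVector_of_snd_ne_zero {p : Vertex n w × BitVec w} (h : p.2 ≠ 0) :
    startVector w k r x p = 0 := if_neg fun h' => h h'.1

theorem startVector_mul_flow {s : ℕ} (p : Vertex n w × BitVec w) :
    startVector w k r x p *
      (pathEdges w k s r x J v p - pathEdges w k s r x J v (move k s x p)) = 0 := by
  by_cases h : p.2 = 0
  · rw [move_of_snd_eq_zero _ _ _ h, sub_self, mul_zero]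
  · rw [startVector_of_snd_ne_zero h, zero_mul]

theorem flowVector_dot_startVector {s : ℕ} (hne : (startSets k r x).Nonempty) :
    flowVector w k s r x J v ⬝ᵥ startVector w k r x = 1 := by
  rw [← startVector_dot_self (w := w) hne]
  refine Finset.sum_congr rfl fun p _ => ?_
  rw [flowVector]
  linear_combination (-(Real.sqrt (startSets k r x).card)⁻¹ / (2 ^ s - 1)) *
    startVector_mul_flow (J := J) (v := v) (s := s) p

/-- The starting vector and the flow are orthogonal, and the flow is spread over `2 ^ s - 1` parallel
edges, which makes its norm small. -/
theorem flowVector_dot_self_le (hJ : J.card = k) (hv : ∀ j ∈ J, x j = v) (hkw : k < 2 ^ w)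
    {s L : ℕ} (hL : L ≤ w) (hn : n * 2 ^ s ≤ 2 ^ L) (hs : 2 ^ (k + 2) * k + 1 ≤ 2 ^ s)
    (hne : (startSets k r x).Nonempty) :
    flowVector w k s r x J v ⬝ᵥ flowVector w k s r x J v ≤ 3 / 2 := by
  have hVpos : (0 : ℝ) < (startSets k r x).card := by
    exact_mod_cast Finset.card_pos.2 hne
  rcases Nat.eq_zero_or_pos k with rfl | hk
  · have h0 : ∀ p, pathEdges w 0 s r x J v p = 0 := by
      intro p
      have : ∀ S, pathLength 0 r x v S = 0 := fun S => Nat.le_zero.1 (pathLength_le S)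
      simp [pathEdges, this]
    have : flowVector w 0 s r x J v = startVector w 0 r x := by
      funext p
      simp [flowVector, h0]
    rw [this, startVector_dot_self hne]
    norm_num
  have hs' : (2 : ℝ) ^ (k + 2) * k + 1 ≤ 2 ^ s := by exact_mod_cast hs
  have hk' : (1 : ℝ) ≤ k := by exact_mod_cast hk
  have hM : (0 : ℝ) < 2 ^ s - 1 := by
    have : (0 : ℝ) < 2 ^ (k + 2) * k := by positivity
    linarith
  set κ := (Real.sqrt (startSets k r x).card)⁻¹ / (2 ^ s - 1) with hκ
  set a := pathEdges w k s r x J v with ha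
  have h1 : flowVector w k s r x J v ⬝ᵥ flowVector w k s r x J v =
      1 + κ ^ 2 * ∑ p, (a p - a (move k s x p)) ^ 2 := by
    rw [← startVector_dot_self (w := w) hne, dotProduct, dotProduct, Finset.mul_sum,
      ← Finset.sum_add_distrib]
    refine Finset.sum_congr rfl fun p _ => ?_
    rw [flowVector, ← hκ, ← ha]
    linear_combination (-2 * κ) * startVector_mul_flow (J := J) (v := v) (s := s) p
  have h2 : ∑ p, (a p - a (move k s x p)) ^ 2 ≤ 2 ^ k * (2 * ∑ p, a p) := by
    have h3 : ∑ p, a (move k s x p) = ∑ p, a p :=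
      Equiv.sum_comp (move_involutive k s x).toPerm a
    rw [two_mul]
    nth_rewrite 2 [← h3]
    rw [← Finset.sum_add_distrib, Finset.mul_sum]
    refine Finset.sum_le_sum fun p _ => ?_
    have b1 := pathEdges_le (r := r) hJ hv hkw hL hn p
    have b2 := pathEdges_le (r := r) hJ hv hkw hL hn (move k s x p)
    have b3 := pathEdges_nonneg (w := w) (k := k) (r := r) (x := x) (J := J) (v := v) (s := s) p
    have b4 := pathEdges_nonneg (w := w) (k := k) (r := r) (x := x) (J := J) (v := v) (s := s)
      (move k s x p)
    rw [← ha] at b1 b2 b3 b4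
    nlinarith
  have h4 := sum_pathEdges_le (w := w) (k := k) (r := r) (x := x) (J := J) (v := v) (s := s)
    Nat.one_le_two_pow
  rw [← ha] at h4
  have h5 : κ ^ 2 = 1 / ((startSets k r x).card * (2 ^ s - 1) ^ 2) := by
    rw [hκ, div_pow, inv_pow, Real.sq_sqrt hVpos.le, one_div, mul_inv, div_eq_mul_inv]
  rw [h1]
  have h6 : κ ^ 2 * ∑ p, (a p - a (move k s x p)) ^ 2 ≤
      κ ^ 2 * (2 ^ k * (2 * ((startSets k r x).card * (k * (2 ^ s - 1))))) := by
    refine mul_le_mul_of_nonneg_left (h2.trans ?_) (by positivity)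
    gcongr
  have h7 : κ ^ 2 * (2 ^ k * (2 * ((startSets k r x).card * (k * ((2 : ℝ) ^ s - 1))))) =
      2 ^ (k + 1) * k / (2 ^ s - 1) := by
    rw [h5]
    field_simp
    ring
  have h8 : 2 ^ (k + 1) * k / ((2 : ℝ) ^ s - 1) ≤ 1 / 2 := by
    rw [div_le_div_iff₀ hM (by norm_num)]
    have : (2 : ℝ) ^ (k + 2) = 2 ^ (k + 1) * 2 := pow_succ _ _
    rw [this] at hs'
    nlinarith
  linarith

/-- At every unmarked vertex the flow out of the vertex, including the starting vector, cancels, so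
that the coin negates the flow. -/
theorem coin_flowVector (hJ : J.card = k) (hv : ∀ j ∈ J, x j = v) (hk : 1 ≤ k)
    (hkw : k < 2 ^ w) (hnw : n < 2 ^ w)
    {s L : ℕ} (hL : L ≤ w) (hn : n * 2 ^ s ≤ 2 ^ L) (hs : 2 ≤ 2 ^ s) :
    coin (Marked k) L (flowVector w k s r x J v) = -flowVector w k s r x J v := by
  classical
  refine coin_eq_neg _ _ _ fun y hy => ?_
  have hM : (0 : ℝ) < 2 ^ s - 1 := by
    have : (2 : ℝ) ≤ 2 ^ s := by exact_mod_cast hs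
    linarith
  set c := (Real.sqrt (startSets k r x).card)⁻¹ with hc
  -- the amplitudes of the starting vector add up to the number of paths starting at `y`
  have h1 : (∑ g : BitVec w, if g.toNat < 2 ^ L then startVector w k r x (y, g) else 0) =
      c * ∑ S ∈ startSets k r x, if startVertex w k r S = y then (1 : ℝ) else 0 := by
    rw [Finset.sum_eq_single (0 : BitVec w)]
    · have h2 : ∀ S ∈ startSets k r x, (if startVertex w k r S = y then (1 : ℝ) else 0) =
          if S = y.1 then (if y = startVertex w k r y.1 then (1 : ℝ) else 0) else 0 := by
        intro S _
        by_cases hS : S = y.1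
        · subst hS
          simp [eq_comm]
        · rw [if_neg hS, if_neg]
          rintro rfl
          exact hS rfl
      rw [Finset.sum_congr rfl h2, Finset.sum_ite_eq']
      simp only [startVector, true_and, ← hc]
      by_cases h3 : y = startVertex w k r y.1
      · by_cases h4 : y.1 ∈ startSets k r x
        · rw [if_pos (by simp), if_pos ⟨h3, h4⟩, if_pos h4, if_pos h3, mul_one]
        · simp [h4]
      · simp only [h3, false_and, if_false]
        simp
    · intro g _ hg
      rw [startVector_of_snd_ne_zero hg]
      simp
    · simp
  have hdir : ∀ S, ∀ l ∈ Finset.range (pathLength k r x v S), ∀ e ∈ Finset.Ico 1 (2 ^ s),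
      (pathDir w s J S l e).toNat < 2 ^ L := by
    intro S l hl e he
    rw [Finset.mem_range] at hl
    rw [Finset.mem_Ico] at he
    obtain ⟨t1, t2⟩ := pathDir_toNat (w := w) hL hn (sdiff_nonempty_of_lt_pathLength hJ hv hl) he.2
    rw [t1]
    exact t2
  have hsum : ∀ (z : Vertex n w) (d : BitVec w), d.toNat < 2 ^ L →
      (∑ g : BitVec w, if g.toNat < 2 ^ L then (if (z, d) = (y, g) then (1 : ℝ) else 0) else 0) =
        if z = y then 1 else 0 := by
    intro z d hd
    rw [Finset.sum_eq_single d]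
    · simp [hd]
    · intro g _ hg
      simp [Ne.symm hg]
    · simp
  have hswap : ∀ f : Finset (Fin n) → ℕ → ℕ → BitVec w → ℝ,
      (∑ g : BitVec w, if g.toNat < 2 ^ L then (∑ S ∈ startSets k r x,
        ∑ l ∈ Finset.range (pathLength k r x v S), ∑ e ∈ Finset.Ico 1 (2 ^ s), f S l e g) else 0) =
      ∑ S ∈ startSets k r x, ∑ l ∈ Finset.range (pathLength k r x v S),
        ∑ e ∈ Finset.Ico 1 (2 ^ s), ∑ g : BitVec w, if g.toNat < 2 ^ L then f S l e g else 0 := by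
    intro f
    simp only [← Finset.sum_filter]
    rw [Finset.sum_comm]
    refine Finset.sum_congr rfl fun S _ => ?_
    rw [Finset.sum_comm]
    refine Finset.sum_congr rfl fun l _ => ?_
    rw [Finset.sum_comm]
  have hconst : ∀ z : Vertex n w, (∑ _e ∈ Finset.Ico 1 (2 ^ s), if z = y then (1 : ℝ) else 0) =
      (2 ^ s - 1) * if z = y then 1 else 0 := by
    intro z
    rw [Finset.sum_const, Nat.card_Ico, nsmul_eq_mul, Nat.cast_sub (by omega)]
    push_cast; rfl
  have h2 : (∑ g : BitVec w, if g.toNat < 2 ^ L then pathEdges w k s r x J v (y, g) else 0) =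
      (2 ^ s - 1) * ∑ S ∈ startSets k r x, ∑ l ∈ Finset.range (pathLength k r x v S),
        if pathVertex w k r x J v S l = y then (1 : ℝ) else 0 := by
    simp only [pathEdges]
    rw [hswap, Finset.mul_sum]
    refine Finset.sum_congr rfl fun S _ => ?_
    rw [Finset.mul_sum]
    refine Finset.sum_congr rfl fun l hl => ?_
    rw [← hconst]
    exact Finset.sum_congr rfl fun e he => hsum _ _ (hdir S l hl e he)
  have h3 : (∑ g : BitVec w, if g.toNat < 2 ^ L then
      pathEdges w k s r x J v (move k s x (y, g)) else 0) =
      (2 ^ s - 1) * ∑ S ∈ startSets k r x, ∑ l ∈ Finset.range (pathLength k r x v S),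
        if pathVertex w k r x J v S (l + 1) = y then (1 : ℝ) else 0 := by
    simp only [pathEdges]
    rw [hswap, Finset.mul_sum]
    refine Finset.sum_congr rfl fun S hS => ?_
    rw [Finset.mul_sum]
    refine Finset.sum_congr rfl fun l hl => ?_
    rw [← hconst]
    refine Finset.sum_congr rfl fun e he => ?_
    rw [← hsum _ _ (hdir S l hl e he)]
    refine Finset.sum_congr rfl fun g _ => ?_
    have he' := Finset.mem_Ico.1 he
    have hm := move_pathVertex (w := w) hJ hv hk hkw hL hn (Finset.mem_range.1 hl) he'.1 he'.2
    have : ((pathVertex w k r x J v S l, pathDir w s J S l e) = move k s x (y, g)) ↔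
        ((pathVertex w k r x J v S (l + 1), pathDir w s J S l e) = (y, g)) := by
      rw [← hm]
      constructor
      · intro h; rw [h, move_involutive]
      · intro h; rw [← h, move_involutive]
    simp only [this]
  -- the sum over the vertices of a path telescopes
  have h4 : ∀ S ∈ startSets k r x, (∑ l ∈ Finset.range (pathLength k r x v S),
      if pathVertex w k r x J v S l = y then (1 : ℝ) else 0) -
      (∑ l ∈ Finset.range (pathLength k r x v S),
        if pathVertex w k r x J v S (l + 1) = y then (1 : ℝ) else 0) =
      if startVertex w k r S = y then 1 else 0 := by
    intro S hS
    rw [← Finset.sum_sub_distrib, Finset.sum_range_sub' (fun l =>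
      if pathVertex w k r x J v S l = y then (1 : ℝ) else 0), pathVertex_zero,
      if_neg (c := pathVertex w k r x J v S (pathLength k r x v S) = y), sub_zero]
    rintro rfl
    exact hy (marked_pathVertex hS hk hnw)
  have h5 : (∑ g : BitVec w, if g.toNat < 2 ^ L then flowVector w k s r x J v (y, g) else 0) =
      (∑ g : BitVec w, if g.toNat < 2 ^ L then startVector w k r x (y, g) else 0) -
      c / (2 ^ s - 1) * ((∑ g : BitVec w, if g.toNat < 2 ^ L then
        pathEdges w k s r x J v (y, g) else 0) -
        ∑ g : BitVec w, if g.toNat < 2 ^ L then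
          pathEdges w k s r x J v (move k s x (y, g)) else 0) := by
    rw [← Finset.sum_sub_distrib, Finset.mul_sum, ← Finset.sum_sub_distrib]
    refine Finset.sum_congr rfl fun g _ => ?_
    split_ifs
    · rfl
    · simp
  rw [h5, h1, h2, h3, ← mul_sub, ← Finset.sum_sub_distrib, Finset.sum_congr rfl h4]
  field_simp
  ring

/-- The flow is antisymmetric under reversal of the edges, so that the shift undoes the sign of the
coin. -/
theorem walk_flowVector (hJ : J.card = k) (hv : ∀ j ∈ J, x j = v) (hk : 1 ≤ k)
    (hkw : k < 2 ^ w) (hnw : n < 2 ^ w)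
    {s L : ℕ} (hL : L ≤ w) (hn : n * 2 ^ s ≤ 2 ^ L) (hs : 2 ≤ 2 ^ s) :
    walk k s L x (flowVector w k s r x J v) = flowVector w k s r x J v := by
  funext p
  rw [walk, step, coin_flowVector hJ hv hk hkw hnw hL hn hs, shift, Pi.neg_apply]
  by_cases hg : p.2 = 0
  · rw [move_of_snd_eq_zero _ _ _ hg]
    by_cases hI : p.1.2.2.1 = 0 ∨ p.1.2.2.1 = BitVec.ofNat w k
    · rw [sign, if_pos ⟨hg, hI⟩]; ring
    · have h0 : startVector w k r x p = 0 := by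
        rw [startVector, if_neg]
        rintro ⟨_, h, _⟩
        apply hI
        rw [h, startVertex]
        simp only
        split_ifs
        · exact Or.inl rfl
        · exact Or.inr rfl
      rw [flowVector, h0, move_of_snd_eq_zero _ _ _ hg]
      ring
  · rw [sign, if_neg fun h => hg h.1, flowVector, flowVector, startVector_of_snd_ne_zero hg,
      startVector_of_snd_ne_zero (by rw [move_snd]; exact hg), move_involutive]
    ring

/-- With a collision, the average of the orbit of the starting vector is large. -/
theorem le_dot_average_of_hasCollision (hc : HasCollision k x) (hk : 1 ≤ k)
    (hne : (startSets k r x).Nonempty) (hkw : k < 2 ^ w) (hnw : n < 2 ^ w)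
    {s L T : ℕ} (hL : L ≤ w) (hn : n * 2 ^ s ≤ 2 ^ L) (hs : 2 ^ (k + 2) * k + 1 ≤ 2 ^ s)
    (hT : 0 < T) :
    2 / 3 ≤ average (walk (w := w) k s L x) T (startVector w k r x) ⬝ᵥ
      average (walk (w := w) k s L x) T (startVector w k r x) := by
  obtain ⟨J, hJ, hJx⟩ := hc
  obtain ⟨j, hj⟩ := Finset.card_pos.1 (by omega : 0 < J.card)
  have hv : ∀ i ∈ J, x i = x j := fun i hi => hJx i hi j hj
  have hs2 : 2 ≤ 2 ^ s := by
    have : 0 < 2 ^ (k + 2) * k := by positivity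
    omega
  have h1 := le_dot_average (dot_walk k s hL x) hT
    (walk_flowVector (r := r) hJ hv hk hkw hnw hL hn hs2) (startVector w k r x)
  rw [flowVector_dot_startVector hne] at h1
  have h2 := flowVector_dot_self_le (r := r) hJ hv hkw hL hn hs hne
  have h3 : 0 ≤ average (walk (w := w) k s L x) T (startVector w k r x) ⬝ᵥ
      average (walk (w := w) k s L x) T (startVector w k r x) :=
    Finset.sum_nonneg fun i _ => mul_self_nonneg _
  nlinarith

end Collision

end KDistinctness

namespace QRam

variable {w : ℕ}

/-! ### Register files -/

/-- Registers with the given contents, followed by zeros. -/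
def file (l : List (BitVec w)) : ℕ → BitVec w := fun i => l.getD i 0

theorem update_file (l : List (BitVec w)) (i : ℕ) (v : BitVec w) (h : i < l.length) :
    Function.update (file l) i v = file (l.set i v) := by
  funext j
  by_cases hj : j = i
  · subst hj
    simp [file, List.getD, h]
  · simp [file, List.getD, hj, Ne.symm hj]

theorem file_apply (l : List (BitVec w)) (i : ℕ) : file l i = l.getD i 0 := rfl

theorem file_of_length_le {l : List (BitVec w)} {i : ℕ} (h : l.length ≤ i) : file l i = 0 := by
  simp [file, List.getD, h]

end QRam

namespace KDistinctness

open QRam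

variable {n q w : ℕ}

/-- The memory that represents the set `S`, with the cell for the size cleared. -/
def setMemory (w k : ℕ) (r : Fin (k - 1) → ℕ) (x : Fin n → Fin q) (S : Finset (Fin n)) :
    BitVec w → BitVec w := fun a =>
  if a.toNat < q then BitVec.ofNat w (S.filter fun j => (x j : ℕ) = a.toNat).card
  else if h : a.toNat - q < n then
    if (⟨a.toNat - q, h⟩ : Fin n) ∈ S then BitVec.ofNat w ((x ⟨a.toNat - q, h⟩ : ℕ) + 1) else 0
  else if a.toNat = q + n then 0
  else if h : a.toNat - (q + n + 1) < k then
    BitVec.ofNat w (startType k r ⟨a.toNat - (q + n + 1), h⟩)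
  else 0

/-- The registers and the memory that encode a content `t` of the time register, a vertex
`(S, d, c, z)` and a direction `g`.  The registers `1, …, 5` hold `t`, `g`, `d`, `c` and `z`, the
registers `6, …, 13`, `15` and `17` are work space, and the registers `18, …, 24` hold the constants
`n`, `q`, `k`, `s`, `1`, `0` and the size of the starting sets.  The registers `14` and `16`, with the
contents `ct` and `sq`, serve to switch the step on and off according to the time. -/
def encode (k s : ℕ) (r : Fin (k - 1) → ℕ) (x : Fin n → Fin q) (sq : BitVec w)
    (ct : BitVec w → BitVec w) (p : BitVec w × Vertex n w × BitVec w) : RegMem w :=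
  (file [0, p.1, p.2.2, p.2.1.2.1, p.2.1.2.2.1, p.2.1.2.2.2, 0, 0, 0, 0, 0, 0, 0, 0, ct p.1, 0, sq,
    0, BitVec.ofNat w n, BitVec.ofNat w q, BitVec.ofNat w k, BitVec.ofNat w s, 1, 0,
    BitVec.ofNat w (startSize k r)], setMemory w k r x p.2.1.1)

open Expr BinOp

/-- The label of the lower end of the edge: `0` if this end is a starting vertex, otherwise the
multiplicity of the distinguished value without the position of the edge. -/
abbrev lowExpr : Expr := bin mul (bin lt (reg 23) (reg 13)) (reg 12)

/-- Whether the edge may be traversed. -/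
abbrev allowedExpr : Expr :=
  bin and (bin and (bin and (reg 14) (bin lt (reg 23) (reg 2)))
    (bin and (bin lt (reg 17) (reg 18)) (bin lt (reg 12) (reg 20))))
    (bin or (bin and (reg 11) (bin eq (reg 4) lowExpr))
      (bin and (bin sub (reg 22) (reg 11)) (bin eq (reg 4) (bin add (reg 12) (reg 22)))))

/-- Read the data of the edge whose direction is in the register `2` into work registers: the
position `17`, its value `6`, and the two memory cells `8` and `9` for the value and the position.
The register `11` tells whether the position is outside the set; `12` and `13` are the multiplicity
and the depth without the position, and `10` tells whether the edge may be traversed.  All of these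
except `8`, `9` and `11` are the same at both ends of the edge. -/
def readEdge : List Instr :=
  [.xor 17 (bin shiftRight (reg 2) (reg 21)), .query 6 17, .xor 7 (bin add (reg 19) (reg 17)),
   .swap 8 6, .swap 9 7, .xor 11 (bin eq (reg 9) (reg 23)),
   .xor 12 (bin sub (reg 8) (bin sub (reg 22) (reg 11))),
   .xor 13 (bin sub (reg 3) (bin sub (reg 22) (reg 11))),
   .xor 10 allowedExpr]

/-- Exchange the ends of the edge if it may be traversed. -/
def flipEdge : List Instr :=
  [.xor 9 (bin mul (reg 10) (bin add (reg 6) (reg 22))),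
   .xor 8 (bin mul (reg 10) (bin xor (reg 12) (bin add (reg 12) (reg 22)))),
   .xor 3 (bin mul (reg 10) (bin xor (reg 13) (bin add (reg 13) (reg 22)))),
   .xor 4 (bin mul (reg 10) (bin xor lowExpr (bin add (reg 12) (reg 22)))),
   .xor 11 (reg 10)]

theorem readEdge_ok : readEdge.all Instr.ok = true := by decide

/-- The contents of the machine between `readEdge` and its inverse. -/
def edgeState (k s : ℕ) (r : Fin (k - 1) → ℕ) (n q : ℕ)
    (sq ct t g z B V A : BitVec w) (M : BitVec w → BitVec w)
    (d c CNT P F U C D : BitVec w) : RegMem w :=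
  (file [0, t, g, d, c, z, V, A, CNT, P, F, U, C, D, ct, 0, sq, B,
    BitVec.ofNat w n, BitVec.ofNat w q, BitVec.ofNat w k, BitVec.ofNat w s, 1, 0,
    BitVec.ofNat w (startSize k r)], M)

theorem toNat_zero_lt_iff (g : BitVec w) : (0 : BitVec w).toNat < g.toNat ↔ g ≠ 0 := by
  constructor
  · rintro h rfl
    exact absurd h (lt_irrefl _)
  · intro h
    rw [show (0 : BitVec w).toNat = 0 by simp]
    refine Nat.pos_of_ne_zero fun h0 => h (BitVec.eq_of_toNat_eq ?_)
    rw [h0]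
    simp

theorem mult_le (x : Fin n → Fin q) (S : Finset (Fin n)) (a : Fin q) : mult x S a ≤ n :=
  (Finset.card_le_univ _).trans_eq (Fintype.card_fin n)

theorem mul_lt_eq_label (D C : BitVec w) :
    (if (0 : BitVec w).toNat < D.toNat then (1 : BitVec w) else 0) * C = label D C := by
  have h0 : (0 : BitVec w) * C = 0 := BitVec.zero_mul
  have h1 : (1 : BitVec w) * C = C := BitVec.one_mul C
  by_cases h : D = 0
  · rw [if_neg (by rw [toNat_zero_lt_iff]; simp [h]), label, if_pos h, h0]
  · rw [if_pos ((toNat_zero_lt_iff D).2 h), label, if_neg h, h1]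

theorem runs_readEdge (O : BitVec w → BitVec w) (cl : ℕ → BitVec w) (k s : ℕ)
    (r : Fin (k - 1) → ℕ) (x : Fin n → Fin q) (sq : BitVec w)
    (ct : BitVec w → BitVec w) (t g d c z : BitVec w) (S : Finset (Fin n)) :
    Instr.runs O cl readEdge (encode k s r x sq ct (t, (S, d, c, z), g)) =
      let B := g >>> (BitVec.ofNat w s).toNat
      let V := O B
      let A := BitVec.ofNat w q + B
      let M := Function.update (setMemory w k r x S) V 0
      let CNT := setMemory w k r x S V
      let P := M A
      let U : BitVec w := if P = 0 then 1 else 0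
      let C := CNT - (1 - U)
      let D := d - (1 - U)
      let F := (ct t &&& (if (0 : BitVec w).toNat < g.toNat then 1 else 0)) &&&
        ((if B.toNat < (BitVec.ofNat w n).toNat then 1 else 0) &&&
          (if C.toNat < (BitVec.ofNat w k).toNat then 1 else 0)) &&&
        ((U &&& (if c = (if (0 : BitVec w).toNat < D.toNat then 1 else 0) * C then 1 else 0)) |||
          ((1 - U) &&& (if c = C + 1 then 1 else 0)))
      edgeState k s r n q sq (ct t) t g z B V A (Function.update M A 0) d c CNT P F U C D := by
  simp only [Instr.runs, readEdge, List.foldl, encode, Instr.run, Expr.eval, BinOp.eval, edgeState]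
  simp [update_file, file_apply]

theorem runs_flipEdge (O : BitVec w → BitVec w) (cl : ℕ → BitVec w) (k s : ℕ)
    (r : Fin (k - 1) → ℕ) (n q : ℕ) (sq ct t g z B V A : BitVec w) (M : BitVec w → BitVec w)
    (d c CNT P F U C D : BitVec w) :
    Instr.runs O cl flipEdge (edgeState k s r n q sq ct t g z B V A M d c CNT P F U C D) =
      edgeState k s r n q sq ct t g z B V A M (d ^^^ F * (D ^^^ (D + 1)))
        (c ^^^ F * (label D C ^^^ (C + 1))) (CNT ^^^ F * (C ^^^ (C + 1))) (P ^^^ F * (V + 1)) F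
        (U ^^^ F) C D := by
  rw [← mul_lt_eq_label]
  simp only [Instr.runs, flipEdge, List.foldl, edgeState, Instr.run, Expr.eval, BinOp.eval]
  simp [update_file, file_apply]

/-! ### The data read for an edge -/

section Edge

variable {k s : ℕ} {r : Fin (k - 1) → ℕ} {x : Fin n → Fin q}

theorem toNat_ofNat_of_lt {a : ℕ} (h : a < 2 ^ w) : (BitVec.ofNat w a).toNat = a := by
  rw [BitVec.toNat_ofNat, Nat.mod_eq_of_lt h]

theorem setMemory_value (hw : q + n + k + 1 < 2 ^ w) (S : Finset (Fin n)) (a : Fin q) :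
    setMemory w k r x S (BitVec.ofNat w a) = BitVec.ofNat w (mult x S a) := by
  have ha := a.isLt
  rw [setMemory, toNat_ofNat_of_lt (by omega), if_pos ha, mult]
  congr 2
  exact Finset.filter_congr fun j _ => by rw [Fin.ext_iff]

theorem setMemory_position (hw : q + n + k + 1 < 2 ^ w) (S : Finset (Fin n)) (b : Fin n) :
    setMemory w k r x S (BitVec.ofNat w (q + b)) =
      if b ∈ S then BitVec.ofNat w (x b + 1) else 0 := by
  have hb := b.isLt
  rw [setMemory, toNat_ofNat_of_lt (by omega), if_neg (by omega),
    dif_pos (show q + (b : ℕ) - q < n by omega)]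
  simp only [Nat.add_sub_cancel_left]

/-- Away from the two cells that are read for the position `b`, the memory does not depend on
whether `b` belongs to the set. -/
theorem setMemory_insert (hw : q + n + k + 1 < 2 ^ w) {S : Finset (Fin n)} {b : Fin n}
    {a : BitVec w} (h1 : a ≠ BitVec.ofNat w (x b)) (h2 : a ≠ BitVec.ofNat w (q + b)) :
    setMemory w k r x (insert b S) a = setMemory w k r x S a := by
  simp only [setMemory]
  split_ifs with c1 c2 c3 c4 c4
  · congr 2
    rw [Finset.filter_insert, if_neg]
    intro h
    apply h1
    rw [h]
    simp
  · rfl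
  · exfalso
    rcases Finset.mem_insert.1 c3 with h | h
    · apply h2
      rw [← h]
      apply BitVec.eq_of_toNat_eq
      rw [toNat_ofNat_of_lt]
      · simp only; omega
      · simp only; omega
    · exact c4 h
  · exact absurd (Finset.mem_insert_of_mem c4) c3
  · rfl
  · rfl
  · rfl
  · rfl

theorem oracle_of_lt {B : BitVec w} (h : B.toNat < n) :
    oracle w x B = BitVec.ofNat w (x ⟨B.toNat, h⟩) := dif_pos h

/-- The memory in which the two cells for the position `b` are cleared. -/
def clearedMemory (w k : ℕ) (r : Fin (k - 1) → ℕ) (x : Fin n → Fin q) (S : Finset (Fin n))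
    (b : Fin n) : BitVec w → BitVec w :=
  Function.update (Function.update (setMemory w k r x S) (BitVec.ofNat w (x b)) 0)
    (BitVec.ofNat w (q + b)) 0

theorem clearedMemory_insert (hw : q + n + k + 1 < 2 ^ w) (S : Finset (Fin n)) (b : Fin n) :
    clearedMemory w k r x (insert b S) b = clearedMemory w k r x S b := by
  funext a
  simp only [clearedMemory]
  by_cases h2 : a = BitVec.ofNat w (q + b)
  · subst h2; simp
  · by_cases h1 : a = BitVec.ofNat w (x b)
    · subst h1; simp [h2]
    · simp only [Function.update_of_ne h1, Function.update_of_ne h2]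
      exact setMemory_insert hw h1 h2

theorem toNat_shiftRight (hs : s < 2 ^ w) (g : BitVec w) :
    (g >>> (BitVec.ofNat w s).toNat).toNat = g.toNat / 2 ^ s := by
  rw [toNat_ofNat_of_lt hs, BitVec.toNat_ushiftRight, Nat.shiftRight_eq_div_pow]

/-- What `readEdge` computes when the direction belongs to a position `b < n`. -/
theorem runs_readEdge_of_lt (hw : q + n + k + 1 < 2 ^ w) (hs : s < 2 ^ w) (cl : ℕ → BitVec w)
    (sq : BitVec w) (ct : BitVec w → BitVec w) {act : Prop} [Decidable act] (t g d c z : BitVec w)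
    (hct : ct t = if act then 1 else 0) (S : Finset (Fin n)) (hb : g.toNat / 2 ^ s < n) :
    let b : Fin n := ⟨g.toNat / 2 ^ s, hb⟩
    let m := mult x (S.erase b) (x b)
    Instr.runs (oracle w x) cl readEdge (encode k s r x sq ct (t, (S, d, c, z), g)) =
      edgeState k s r n q sq (ct t) t g z (BitVec.ofNat w b) (BitVec.ofNat w (x b))
        (BitVec.ofNat w (q + b)) (clearedMemory w k r x S b) d c (BitVec.ofNat w (mult x S (x b)))
        (if b ∈ S then BitVec.ofNat w (x b + 1) else 0)
        (if act ∧ g ≠ 0 ∧ m < k ∧ (if b ∈ S then c = BitVec.ofNat w m + 1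
          else c = label d (BitVec.ofNat w m)) then 1 else 0)
        (if b ∈ S then 0 else 1) (BitVec.ofNat w m) (if b ∈ S then d - 1 else d) := by
  intro b m
  have hbn : (b : ℕ) < n := b.isLt
  have hxq : (x b : ℕ) < q := (x b).isLt
  rw [runs_readEdge]
  have hB : g >>> (BitVec.ofNat w s).toNat = BitVec.ofNat w b := by
    apply BitVec.eq_of_toNat_eq
    rw [toNat_shiftRight hs, toNat_ofNat_of_lt (by omega)]
  have hBn : (BitVec.ofNat w (b : ℕ)).toNat = b := toNat_ofNat_of_lt (by omega)
  have hV : oracle w x (BitVec.ofNat w b) = BitVec.ofNat w (x b) := by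
    rw [oracle_of_lt (by rw [hBn]; exact hbn)]
    simp only [hBn]
  have hA : BitVec.ofNat w q + BitVec.ofNat w b = BitVec.ofNat w (q + b) := by
    rw [BitVec.ofNat_add]
  have hne : BitVec.ofNat w (q + b) ≠ BitVec.ofNat w (x b) := by
    rw [Ne, ofNat_inj (by omega) (by omega)]
    omega
  have hU : (if (if b ∈ S then BitVec.ofNat w (x b + 1) else 0) = 0 then (1 : BitVec w) else 0) =
      if b ∈ S then 0 else 1 := by
    by_cases h : b ∈ S
    · rw [if_pos h, if_pos h, if_neg]
      rw [ofNat_zero', ofNat_inj (by omega) (by omega)]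
      omega
    · rw [if_neg h, if_neg h, if_pos rfl]
  have hm1 : (1 : BitVec w) - (if b ∈ S then 0 else 1) = if b ∈ S then 1 else 0 := by
    split_ifs <;> simp
  have hC : BitVec.ofNat w (mult x S (x b)) - (if b ∈ S then 1 else 0) = BitVec.ofNat w m := by
    by_cases h : b ∈ S
    · have : mult x S (x b) = m + 1 := by
        conv_lhs => rw [← Finset.insert_erase h]
        rw [mult_insert (Finset.notMem_erase _ _), if_pos rfl]
      rw [if_pos h, this, ← ofNat_add_one, BitVec.add_sub_cancel]
    · have : mult x S (x b) = m := by
        simp only [m, Finset.erase_eq_of_notMem h]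
      rw [if_neg h, this]
      exact BitVec.sub_zero _
  have hmn : m ≤ n := mult_le _ _ _
  simp only [hB, hV, hA, Function.update_of_ne hne, setMemory_value hw, setMemory_position hw, hU,
    hm1, hC, mul_lt_eq_label, hBn, toNat_ofNat_of_lt (show n < 2 ^ w by omega),
    toNat_ofNat_of_lt (show k < 2 ^ w by omega), toNat_ofNat_of_lt (show m < 2 ^ w by omega), hbn,
    hct]
  have hD : d - (if b ∈ S then 1 else 0) = if b ∈ S then d - 1 else d := by
    split_ifs
    · rfl
    · exact BitVec.sub_zero _
  rw [hD]
  have hbits : ∀ (p q : Prop) [Decidable p] [Decidable q],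
      ((if p then (1 : BitVec w) else 0) &&& (if q then 1 else 0)) = if p ∧ q then 1 else 0 := by
    intro p q _ _
    by_cases hp : p <;> by_cases hq : q <;> simp [hp, hq]
  congr 1
  have hone : ∀ (p : Prop) [Decidable p], ((1 : BitVec w) &&& (if p then 1 else 0)) =
      if p then 1 else 0 := by
    intro p _
    split_ifs <;> simp
  simp only [toNat_zero_lt_iff]
  by_cases hbS : b ∈ S
  · simp only [hbS, if_true, hone, hbits]
    have : ((0 : BitVec w) &&& (if c = label (d - 1) (BitVec.ofNat w m) then 1 else 0)) = 0 :=
      BitVec.zero_and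
    have h0 : ∀ v : BitVec w, (0 : BitVec w) ||| v = v := fun v => BitVec.zero_or
    rw [this, h0, hbits]
    simp only [and_assoc]
  · simp only [hbS, if_true, if_false, hone, hbits]
    have : ((0 : BitVec w) &&& (if c = BitVec.ofNat w m + 1 then 1 else 0)) = 0 :=
      BitVec.zero_and
    have h0 : ∀ v : BitVec w, v ||| (0 : BitVec w) = v := fun v => BitVec.or_zero
    rw [this, h0, hbits]
    simp only [and_assoc]

/-- Reading an edge and exchanging its ends is the same as moving and then reading the edge; hence
reading, exchanging and unreading implement `move`. -/
theorem runs_flipEdge_readEdge (hw : q + n + k + 1 < 2 ^ w) (hs : s < 2 ^ w) (cl : ℕ → BitVec w)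
    (sq : BitVec w) (ct : BitVec w → BitVec w) {act : Prop} [Decidable act] (t : BitVec w)
    (hct : ct t = if act then 1 else 0) (p : Vertex n w × BitVec w) :
    Instr.runs (oracle w x) cl flipEdge
      (Instr.runs (oracle w x) cl readEdge (encode k s r x sq ct (t, p))) =
      Instr.runs (oracle w x) cl readEdge
        (encode k s r x sq ct (t, if act then move k s x p else p)) := by
  obtain ⟨⟨S, d, c, z⟩, g⟩ := p
  have hz : ∀ v : BitVec w, (0 : BitVec w) * v = 0 := fun v => BitVec.zero_mul
  have hxz : ∀ v : BitVec w, v ^^^ (0 : BitVec w) = v := fun v => BitVec.xor_zero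
  by_cases hb : g.toNat / 2 ^ s < n
  swap
  · have hm : move k s x ((S, d, c, z), g) = ((S, d, c, z), g) := by
      simp only [move, dif_neg hb]
    rw [hm, ite_self, runs_readEdge]
    simp only
    rw [runs_flipEdge, if_neg (c := _ < (BitVec.ofNat w n).toNat)]
    · have h1 : ∀ v : BitVec w, (0 : BitVec w) &&& v = 0 := fun v => BitVec.zero_and
      have h2 : ∀ v : BitVec w, v &&& (0 : BitVec w) = 0 := fun v => BitVec.and_zero
      simp only [h1, h2, hz, hxz]
    · rw [toNat_shiftRight hs, toNat_ofNat_of_lt (by omega)]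
      exact hb
  rw [runs_readEdge_of_lt hw hs cl sq ct t g d c z hct S hb]
  set b : Fin n := ⟨g.toNat / 2 ^ s, hb⟩ with hbdef
  set m := mult x (S.erase b) (x b) with hm
  rw [runs_flipEdge]
  by_cases hF : act ∧ g ≠ 0 ∧ m < k ∧ (if b ∈ S then c = BitVec.ofNat w m + 1
      else c = label d (BitVec.ofNat w m))
  swap
  · rw [if_neg hF]
    simp only [hz, hxz]
    have hmv : (if act then move k s x ((S, d, c, z), g) else ((S, d, c, z), g)) =
        ((S, d, c, z), g) := by
      by_cases ha : act
      · rw [if_pos ha]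
        simp only [move, dif_pos hb]
        by_cases hbS : b ∈ S
        · rw [if_pos hbS, if_neg]
          rintro ⟨h1, h2, h3⟩
          exact hF ⟨ha, h1, h2, by rw [if_pos hbS]; exact h3⟩
        · rw [if_neg hbS, if_neg]
          rintro ⟨h1, h2, h3⟩
          exact hF ⟨ha, h1, h2, by rw [if_neg hbS]; exact h3⟩
      · rw [if_neg ha]
    rw [hmv, runs_readEdge_of_lt hw hs cl sq ct t g d c z hct S hb]
    simp only
    rw [if_neg hF]
  have h1m : ∀ v : BitVec w, (1 : BitVec w) * v = v := fun v => BitVec.one_mul v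
  have hzx : ∀ v : BitVec w, (0 : BitVec w) ^^^ v = v := fun v => BitVec.zero_xor
  have hxx : ∀ u v : BitVec w, u ^^^ (u ^^^ v) = v := fun u v => by
    rw [← BitVec.xor_assoc, BitVec.xor_self, BitVec.zero_xor]
  have hxy : ∀ u v : BitVec w, u ^^^ (v ^^^ u) = v := fun u v => by
    rw [BitVec.xor_comm v, hxx]
  rw [if_pos hF, if_pos hF.1]
  obtain ⟨ha, hg, hmk, hc⟩ := hF
  by_cases hbS : b ∈ S
  · rw [if_pos hbS] at hc
    have hmv : move k s x ((S, d, c, z), g) =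
        ((S.erase b, d - 1, label (d - 1) (BitVec.ofNat w m), z), g) := by
      simp only [move, dif_pos hb]
      rw [if_pos hbS, if_pos ⟨hg, hmk, hc⟩]
    have hnE : b ∉ S.erase b := Finset.notMem_erase _ _
    have hmult : mult x S (x b) = m + 1 := by
      conv_lhs => rw [← Finset.insert_erase hbS]
      rw [mult_insert hnE, if_pos rfl]
    rw [hmv, runs_readEdge_of_lt hw hs cl sq ct t g _ _ z hct (S.erase b) hb]
    simp only [← hbdef, Finset.erase_idem, ← hm, hbS, hnE, if_true, if_false]
    rw [if_pos ⟨ha, hg, hmk, trivial⟩, hmult, h1m, h1m, h1m, h1m, ← ofNat_add_one, hxy, hc, hxy,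
      BitVec.sub_add_cancel, hxy]
    rw [← clearedMemory_insert hw (S.erase b) b, Finset.insert_erase hbS, ← ofNat_add_one,
      BitVec.xor_self, hzx]
    rfl
  · rw [if_neg hbS] at hc
    have hE : S.erase b = S := Finset.erase_eq_of_notMem hbS
    have hmv : move k s x ((S, d, c, z), g) =
        ((insert b S, d + 1, BitVec.ofNat w m + 1, z), g) := by
      simp only [move, dif_pos hb]
      rw [if_neg hbS, if_pos ⟨hg, hmk, hc⟩]
    have hmS : mult x S (x b) = m := by rw [hm, hE]
    have hmem : b ∈ insert b S := Finset.mem_insert_self _ _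
    have hmult : mult x (insert b S) (x b) = m + 1 := by
      rw [mult_insert hbS, if_pos rfl, hmS]
    rw [hmv, runs_readEdge_of_lt hw hs cl sq ct t g _ _ z hct (insert b S) hb]
    simp only [← hbdef, Finset.erase_insert hbS, hmem, hbS, if_true, if_false, hmS]
    rw [if_pos ⟨ha, hg, hmk, trivial⟩, hmult, h1m, h1m, h1m, h1m, hxx, hc, hxx,
      BitVec.add_sub_cancel, hxx, clearedMemory_insert hw S b, ofNat_add_one, ofNat_add_one,
      hzx, BitVec.xor_self]
    rfl

end Edge

end KDistinctness

namespace QRam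

variable {w : ℕ} {X : Type*}

/-! ### Programs that apply Hadamard gates to all bits of a register -/

/-- Apply `H (L - 1)`, …, `H 0` in this order. -/
def iterDesc {A : Type*} (H : ℕ → A → A) : ℕ → A → A
  | 0, φ => φ
  | L + 1, φ => iterDesc H L (H L φ)

/-- Apply `H 0`, …, `H (L - 1)` in this order. -/
def iterAsc {A : Type*} (H : ℕ → A → A) : ℕ → A → A
  | 0, φ => φ
  | L + 1, φ => H L (iterAsc H L φ)

/-- Hadamard gates on the bits of the register `i` below the number in the classical register `cL`,
ending with bit `0`.  The classical register `b` contains `1`, and `b + 8` is a counter. -/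
def hadDesc (i : Fin (63 + 1)) (b cL : ℕ) : Prog 63 :=
  .seq (.arith .or (b + 8) cL cL) (.loop (b + 8)
    (.seq (.arith .sub (b + 8) (b + 8) b) (.gate (.had i (b + 8)))))

/-- Hadamard gates on the bits of the register `i` below the number in the classical register `cL`,
starting with bit `0`. -/
def hadAsc (i : Fin (63 + 1)) (b cL : ℕ) : Prog 63 :=
  .seq (.arith .or (b + 8) cL cL) (.loop (b + 8)
    (.seq (.arith .sub (b + 8) (b + 8) b) (.seq (.arith .sub (b + 9) cL (b + 8))
      (.seq (.arith .sub (b + 9) (b + 9) b) (.gate (.had i (b + 9)))))))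

theorem ofNat_succ_ne_zero {a : ℕ} (h : a + 1 < 2 ^ w) : BitVec.ofNat w (a + 1) ≠ 0 := by
  intro h0
  have := congrArg BitVec.toNat h0
  rw [BitVec.toNat_ofNat, Nat.mod_eq_of_lt h] at this
  simp at this

theorem ofNat_succ_sub_one (a : ℕ) : BitVec.ofNat w (a + 1) - 1 = BitVec.ofNat w a := by
  rw [BitVec.ofNat_add]
  exact BitVec.add_sub_cancel _ _

variable {O : BitVec w → BitVec w} {i : Fin (63 + 1)} {enc : X → Basis w 63}
  {H : ℕ → (X → ℝ) → (X → ℝ)}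

theorem runs_hadDesc_loop (hH : ∀ (cl : ℕ → BitVec w) (c : ℕ) (φ : X → ℝ), (cl c).toNat < w →
      (Gate.had i c).apply O cl (embed enc φ) = embed enc (H (cl c).toNat φ))
    {L : ℕ} (hL : L ≤ w) (b : ℕ) (cl : ℕ → BitVec w) (h1 : cl b = 1)
    (hc : cl (b + 8) = BitVec.ofNat w L) (φ : X → ℝ) :
    ∃ cl', (∀ j < b + 8, cl' j = cl j) ∧
      Runs O (.loop (b + 8) (.seq (.arith .sub (b + 8) (b + 8) b) (.gate (.had i (b + 8)))))
        (cl, embed enc φ) (3 * L + 1) (cl', embed enc (iterDesc H L φ)) := by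
  induction L generalizing cl φ with
  | zero => exact ⟨cl, fun _ _ => rfl, Runs.loopFalse hc⟩
  | succ L ih =>
    have hlt : L + 1 < 2 ^ w := lt_of_le_of_lt hL Nat.lt_two_pow_self
    let cl1 := Function.update cl (b + 8) (BitVec.ofNat w L)
    have h8 : cl1 (b + 8) = BitVec.ofNat w L := by simp [cl1]
    have hpos : (cl1 (b + 8)).toNat = L := by
      rw [h8, BitVec.toNat_ofNat, Nat.mod_eq_of_lt (by omega)]
    obtain ⟨cl', hcl', hr⟩ := ih (by omega) cl1 (by simp [cl1, h1]) h8 (H L φ)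
    refine ⟨cl', fun j hj => ?_, ?_⟩
    · rw [hcl' j hj]
      exact Function.update_of_ne (by omega) _ _
    · have step1 : Runs O (.arith .sub (b + 8) (b + 8) b) (cl, embed enc φ) 1
          (cl1, embed enc φ) := by
        have := Runs.arith (O := O) (m := 63) .sub (b + 8) (b + 8) b (cl, embed enc φ)
        simp only [BinOp.eval, hc, h1, ofNat_succ_sub_one] at this
        exact this
      have step2 : Runs O (.gate (.had i (b + 8))) (cl1, embed enc φ) 1
          (cl1, embed enc (H L φ)) := by
        have := Runs.gate (O := O) (.had i (b + 8)) (cl1, embed enc φ)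
        simp only at this
        rw [hH _ _ _ (by rw [hpos]; omega), hpos] at this
        exact this
      have hne : (cl, embed enc φ).1 (b + 8) ≠ 0 := by
        show cl (b + 8) ≠ 0
        rw [hc]; exact ofNat_succ_ne_zero hlt
      have := Runs.loopTrue hne (Runs.seq step1 step2) hr
      rwa [show 1 + (1 + 1) + (3 * L + 1) = 3 * (L + 1) + 1 by ring] at this

theorem runs_hadDesc (hH : ∀ (cl : ℕ → BitVec w) (c : ℕ) (φ : X → ℝ), (cl c).toNat < w →
      (Gate.had i c).apply O cl (embed enc φ) = embed enc (H (cl c).toNat φ))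
    {L : ℕ} (hL : L ≤ w) (b cL : ℕ) (cl : ℕ → BitVec w) (h1 : cl b = 1)
    (hc : cl cL = BitVec.ofNat w L) (φ : X → ℝ) :
    ∃ cl', (∀ j < b + 8, cl' j = cl j) ∧
      Runs O (hadDesc i b cL) (cl, embed enc φ) (3 * L + 2)
        (cl', embed enc (iterDesc H L φ)) := by
  let cl1 := Function.update cl (b + 8) (BitVec.ofNat w L)
  obtain ⟨cl', hcl', hr⟩ := runs_hadDesc_loop hH hL b cl1 (by simp [cl1, h1]) (by simp [cl1]) φ
  refine ⟨cl', fun j hj => ?_, ?_⟩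
  · rw [hcl' j hj]
    exact Function.update_of_ne (by omega) _ _
  · have step1 : Runs O (.arith .or (b + 8) cL cL) (cl, embed enc φ) 1 (cl1, embed enc φ) := by
      have := Runs.arith (O := O) (m := 63) .or (b + 8) cL cL (cl, embed enc φ)
      simp only [BinOp.eval, hc, BitVec.or_self] at this
      exact this
    have := Runs.seq step1 hr
    rwa [show 1 + (3 * L + 1) = 3 * L + 2 by ring] at this

theorem runs_hadAsc_loop (hH : ∀ (cl : ℕ → BitVec w) (c : ℕ) (φ : X → ℝ), (cl c).toNat < w →
      (Gate.had i c).apply O cl (embed enc φ) = embed enc (H (cl c).toNat φ))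
    {L a m : ℕ} (hL : L ≤ w) (ham : a + m = L) (b cL : ℕ) (hcL : cL < b + 8) (cl : ℕ → BitVec w)
    (h1 : cl b = 1) (hcl : cl cL = BitVec.ofNat w L)
    (hc : cl (b + 8) = BitVec.ofNat w m) (φ : X → ℝ) :
    ∃ cl', (∀ j < b + 8, cl' j = cl j) ∧
      Runs O (.loop (b + 8) (.seq (.arith .sub (b + 8) (b + 8) b)
        (.seq (.arith .sub (b + 9) cL (b + 8)) (.seq (.arith .sub (b + 9) (b + 9) b)
          (.gate (.had i (b + 9)))))))
        (cl, embed enc (iterAsc H a φ)) (5 * m + 1) (cl', embed enc (iterAsc H L φ)) := by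
  induction m generalizing cl a with
  | zero =>
    rw [add_zero] at ham
    subst ham
    exact ⟨cl, fun _ _ => rfl, Runs.loopFalse hc⟩
  | succ m ih =>
    have hlt : L < 2 ^ w := lt_of_le_of_lt hL Nat.lt_two_pow_self
    let cl1 := Function.update cl (b + 8) (BitVec.ofNat w m)
    let cl2 := Function.update cl1 (b + 9) (BitVec.ofNat w (a + 1))
    let cl3 := Function.update cl2 (b + 9) (BitVec.ofNat w a)
    have hpos : (cl3 (b + 9)).toNat = a := by
      simp only [cl3, Function.update_self]
      rw [BitVec.toNat_ofNat, Nat.mod_eq_of_lt (by omega)]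
    obtain ⟨cl', hcl', hr⟩ := ih (a := a + 1) (by omega) cl3 (by simp [cl3, cl2, cl1, h1])
      (by simp only [cl3, cl2, cl1]; rw [Function.update_of_ne (by omega),
            Function.update_of_ne (by omega), Function.update_of_ne (by omega), hcl])
      (by simp [cl3, cl2, cl1])
    refine ⟨cl', fun j hj => ?_, ?_⟩
    · rw [hcl' j hj]
      simp only [cl3, cl2, cl1]
      rw [Function.update_of_ne (by omega), Function.update_of_ne (by omega),
        Function.update_of_ne (by omega)]
    · have step1 : Runs O (.arith .sub (b + 8) (b + 8) b) (cl, embed enc (iterAsc H a φ)) 1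
          (cl1, embed enc (iterAsc H a φ)) := by
        have := Runs.arith (O := O) (m := 63) .sub (b + 8) (b + 8) b (cl, embed enc (iterAsc H a φ))
        simp only [BinOp.eval, hc, h1, ofNat_succ_sub_one] at this
        exact this
      have step2 : Runs O (.arith .sub (b + 9) cL (b + 8)) (cl1, embed enc (iterAsc H a φ)) 1
          (cl2, embed enc (iterAsc H a φ)) := by
        have := Runs.arith (O := O) (m := 63) .sub (b + 9) cL (b + 8)
          (cl1, embed enc (iterAsc H a φ))
        have e : cl1 cL - cl1 (b + 8) = BitVec.ofNat w (a + 1) := by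
          simp only [cl1, Function.update_self]
          rw [Function.update_of_ne (by omega), hcl, ← ham,
            show a + (m + 1) = (a + 1) + m by ring, BitVec.ofNat_add (a + 1), BitVec.add_sub_cancel]
        simp only [BinOp.eval, e] at this
        exact this
      have step3 : Runs O (.arith .sub (b + 9) (b + 9) b) (cl2, embed enc (iterAsc H a φ)) 1
          (cl3, embed enc (iterAsc H a φ)) := by
        have := Runs.arith (O := O) (m := 63) .sub (b + 9) (b + 9) b
          (cl2, embed enc (iterAsc H a φ))
        have e : cl2 (b + 9) - cl2 b = BitVec.ofNat w a := by
          simp only [cl2, cl1, Function.update_self]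
          rw [Function.update_of_ne (by omega), Function.update_of_ne (by omega), h1,
            ofNat_succ_sub_one]
        simp only [BinOp.eval, e] at this
        exact this
      have step4 : Runs O (.gate (.had i (b + 9))) (cl3, embed enc (iterAsc H a φ)) 1
          (cl3, embed enc (iterAsc H (a + 1) φ)) := by
        have := Runs.gate (O := O) (.had i (b + 9)) (cl3, embed enc (iterAsc H a φ))
        simp only at this
        rw [hH _ _ _ (by rw [hpos]; omega), hpos] at this
        exact this
      have hne : (cl, embed enc (iterAsc H a φ)).1 (b + 8) ≠ 0 := by
        show cl (b + 8) ≠ 0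
        rw [hc]; exact ofNat_succ_ne_zero (by omega)
      have := Runs.loopTrue hne (Runs.seq step1 (Runs.seq step2 (Runs.seq step3 step4))) hr
      rwa [show 1 + (1 + (1 + (1 + 1))) + (5 * m + 1) = 5 * (m + 1) + 1 by ring] at this

theorem runs_hadAsc (hH : ∀ (cl : ℕ → BitVec w) (c : ℕ) (φ : X → ℝ), (cl c).toNat < w →
      (Gate.had i c).apply O cl (embed enc φ) = embed enc (H (cl c).toNat φ))
    {L : ℕ} (hL : L ≤ w) (b cL : ℕ) (hcL : cL < b + 8) (cl : ℕ → BitVec w) (h1 : cl b = 1)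
    (hc : cl cL = BitVec.ofNat w L) (φ : X → ℝ) :
    ∃ cl', (∀ j < b + 8, cl' j = cl j) ∧
      Runs O (hadAsc i b cL) (cl, embed enc φ) (5 * L + 2)
        (cl', embed enc (iterAsc H L φ)) := by
  let cl1 := Function.update cl (b + 8) (BitVec.ofNat w L)
  obtain ⟨cl', hcl', hr⟩ := runs_hadAsc_loop hH hL (zero_add L) b cL hcL cl1 (by simp [cl1, h1])
    (by simp only [cl1]; rw [Function.update_of_ne (by omega), hc]) (by simp [cl1]) φ
  refine ⟨cl', fun j hj => ?_, ?_⟩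
  · rw [hcl' j hj]
    exact Function.update_of_ne (by omega) _ _
  · have step1 : Runs O (.arith .or (b + 8) cL cL) (cl, embed enc φ) 1 (cl1, embed enc φ) := by
      have := Runs.arith (O := O) (m := 63) .or (b + 8) cL cL (cl, embed enc φ)
      simp only [BinOp.eval, hc, BitVec.or_self] at this
      exact this
    have := Runs.seq step1 hr
    rwa [show 1 + (5 * L + 1) = 5 * L + 2 by ring] at this

/-! ### Conditional phases -/

/-- Apply the sign `-1` if the value of `e` is odd; the register `15` is used as work space. -/
def phaseGates (e : Expr) : List (Gate 63) :=
  (Instr.xor 15 e).gates ++ (.phase (rg 15) :: (Instr.xor 15 e).gates)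

theorem applyGates_phaseGates (O : BitVec w → BitVec w) (cl : ℕ → BitVec w) {e : Expr}
    (he : (Instr.xor 15 e).ok = true) (enc : X → RegMem w) (hclean : ∀ x, Instr.Clean (enc x))
    (hinj : Function.Injective fun x => (enc x).toBasis) (h15 : ∀ x, (enc x).1 15 = 0)
    (φ : X → ℝ) :
    applyGates O cl (phaseGates e) (embed (fun x => (enc x).toBasis) φ) =
      embed (fun x => (enc x).toBasis)
        fun x => (if (e.eval (enc x).1).getLsbD 0 then -1 else 1) * φ x := by
  have hall : [Instr.xor 15 e].all Instr.ok = true := by simpa using he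
  have hg : (Instr.xor 15 e).gates = [Instr.xor 15 e].flatMap Instr.gates := by simp
  have hback : ∀ x, actGates O cl (Instr.xor 15 e).gates
      (Instr.runs O cl [Instr.xor 15 e] (enc x)).toBasis = (enc x).toBasis := fun x => by
    rw [hg, Instr.actGates_flatMap O cl hall (Instr.Clean.runs hall (hclean x))]
    congr 1
    exact Instr.runs_reverse O cl hall (enc x)
  rw [phaseGates, applyGates_append, applyGates, hg,
    Instr.applyGates_flatMap O cl hall enc hclean,
    apply_phase_embed O cl _ _ (fun x y hxy => hinj (by
      simp only at hxy ⊢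
      rw [← hback x, ← hback y, hxy])),
    Instr.applyGates_flatMap O cl hall _ (fun x => Instr.Clean.runs hall (hclean x))]
  have h1 : ∀ x, Instr.runs O cl [Instr.xor 15 e] (Instr.runs O cl [Instr.xor 15 e] (enc x)) =
      enc x := fun x => Instr.runs_reverse O cl hall (enc x)
  simp only [h1]
  congr 1
  funext x
  congr 3
  rw [toBasis_fst _ (by norm_num)]
  simp [Instr.runs, Instr.run, h15 x]

end QRam

namespace KDistinctness

open QRam CoinedWalk PhaseDetection Expr BinOp

variable {n q w : ℕ}

/-! ### The program for one step of the walk -/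

section Step

variable {k s : ℕ} {r : Fin (k - 1) → ℕ} {x : Fin n → Fin q}

theorem clean_encode (k s : ℕ) (r : Fin (k - 1) → ℕ) (x : Fin n → Fin q) (sq : BitVec w)
    (ct : BitVec w → BitVec w) (p : BitVec w × Vertex n w × BitVec w) :
    Instr.Clean (encode k s r x sq ct p) := by
  intro j hj
  refine file_of_length_le ?_
  simp only [List.length_cons, List.length_nil]
  simp only [stackBase] at hj
  omega

theorem encode_injective (hw : q + n + k + 1 < 2 ^ w) (sq : BitVec w) (ct : BitVec w → BitVec w) :
    Function.Injective fun p => (encode k s r x sq ct p).toBasis := by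
  rintro ⟨t, ⟨S, d, c, z⟩, g⟩ ⟨t', ⟨S', d', c', z'⟩, g'⟩ h
  simp only at h
  have hr : ∀ i < 64, (encode k s r x sq ct (t, (S, d, c, z), g)).1 i =
      (encode k s r x sq ct (t', (S', d', c', z'), g')).1 i := by
    intro i hi
    rw [← toBasis_fst _ hi, ← toBasis_fst _ hi, h]
  have e1 : t = t' := hr 1 (by norm_num)
  have e2 : g = g' := hr 2 (by norm_num)
  have e3 : d = d' := hr 3 (by norm_num)
  have e4 : c = c' := hr 4 (by norm_num)
  have e5 : z = z' := hr 5 (by norm_num)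
  have hM : setMemory w k r x S = setMemory w k r x S' := congrArg Prod.snd h
  have e6 : S = S' := by
    have key : ∀ (S : Finset (Fin n)) (b : Fin n),
        b ∈ S ↔ setMemory w k r x S (BitVec.ofNat w (q + b)) ≠ 0 := by
      intro S b
      rw [setMemory_position hw]
      have := (x b).isLt
      split_ifs with hb
      · simp only [hb, true_iff]
        exact ofNat_succ_ne_zero (by omega)
      · simp [hb]
    ext b
    rw [key, key, hM]
  rw [e1, e2, e3, e4, e5, e6]

/-- The action of a Hadamard gate on the direction. -/
noncomputable def hadDir (b : ℕ) (φ : BitVec w × Vertex n w × BitVec w → ℝ) :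
    BitVec w × Vertex n w × BitVec w → ℝ :=
  fun p => hd b (fun g => φ (p.1, p.2.1, g)) p.2.2

/-- The action of a Hadamard gate on the time register. -/
noncomputable def hadTime (b : ℕ) (φ : BitVec w × Vertex n w × BitVec w → ℝ) :
    BitVec w × Vertex n w × BitVec w → ℝ :=
  fun p => hd b (fun t => φ (t, p.2)) p.1

theorem iterDesc_hadDir (L : ℕ) (φ : BitVec w × Vertex n w × BitVec w → ℝ) :
    iterDesc hadDir L φ = fun p => hdDesc L (fun g => φ (p.1, p.2.1, g)) p.2.2 := by
  induction L generalizing φ with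
  | zero => rfl
  | succ L ih => rw [iterDesc, ih]; rfl

theorem iterAsc_hadDir (L : ℕ) (φ : BitVec w × Vertex n w × BitVec w → ℝ) :
    iterAsc hadDir L φ = fun p => hdAsc L (fun g => φ (p.1, p.2.1, g)) p.2.2 := by
  induction L with
  | zero => rfl
  | succ L ih => rw [iterAsc, ih]; rfl

theorem iterDesc_hadTime (L : ℕ) (φ : BitVec w × Vertex n w × BitVec w → ℝ) :
    iterDesc hadTime L φ = fun p => hdDesc L (fun t => φ (t, p.2)) p.1 := by
  induction L generalizing φ with
  | zero => rfl
  | succ L ih => rw [iterDesc, ih]; rfl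

theorem iterAsc_hadTime (L : ℕ) (φ : BitVec w × Vertex n w × BitVec w → ℝ) :
    iterAsc hadTime L φ = fun p => hdAsc L (fun t => φ (t, p.2)) p.1 := by
  induction L with
  | zero => rfl
  | succ L ih => rw [iterAsc, ih]; rfl

theorem apply_hadDir (hw : q + n + k + 1 < 2 ^ w) (O : BitVec w → BitVec w) (sq : BitVec w)
    (ct : BitVec w → BitVec w) (cl : ℕ → BitVec w) (c : ℕ)
    (φ : BitVec w × Vertex n w × BitVec w → ℝ) (hc : (cl c).toNat < w) :
    (Gate.had (rg 2) c).apply O cl (embed (fun p => (encode k s r x sq ct p).toBasis) φ) =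
      embed (fun p => (encode k s r x sq ct p).toBasis) (hadDir (cl c).toNat φ) := by
  refine apply_had_embed O cl (rg 2) c hc (encode_injective hw sq ct)
    (fun v p => (p.1, p.2.1, v)) (fun p => p.2.2) (fun p => ?_) (fun v p => ?_) φ
  · rw [toBasis_fst _ (by norm_num)]; rfl
  · rw [xorReg_toBasis _ (by norm_num)]
    congr 1
    simp [encode, update_file, file_apply]

theorem apply_hadTime (hw : q + n + k + 1 < 2 ^ w) (O : BitVec w → BitVec w)
    (cl : ℕ → BitVec w) (c : ℕ)
    (φ : BitVec w × Vertex n w × BitVec w → ℝ) (hc : (cl c).toNat < w) :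
    (Gate.had (rg 1) c).apply O cl
      (embed (fun p => (encode k s r x 0 (fun _ => 0) p).toBasis) φ) =
      embed (fun p => (encode k s r x 0 (fun _ => 0) p).toBasis) (hadTime (cl c).toNat φ) := by
  refine apply_had_embed O cl (rg 1) c hc (encode_injective hw 0 _)
    (fun v p => (v, p.2)) (fun p => p.1) (fun p => ?_) (fun v p => ?_) φ
  · rw [toBasis_fst _ (by norm_num)]; rfl
  · rw [xorReg_toBasis _ (by norm_num)]
    congr 1
    simp [encode, update_file, file_apply]

/-- The condition for the phase between the Hadamard transforms of the coin: the step is switched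
on, and the direction is not `0` or the vertex is marked. -/
def coinPhase : Expr :=
  bin and (reg 14) (bin or (bin lt (reg 23) (reg 2)) (bin eq (reg 4) (reg 20)))

/-- The condition for the phase after the move, which is the one in `sign`. -/
def signPhase : Expr :=
  bin and (reg 14) (bin and (bin eq (reg 2) (reg 23))
    (bin or (bin eq (reg 4) (reg 23)) (bin eq (reg 4) (reg 20))))

theorem ite_bits_and (p q : Prop) [Decidable p] [Decidable q] :
    ((if p then (1 : BitVec w) else 0) &&& (if q then 1 else 0)) = if p ∧ q then 1 else 0 := by
  by_cases hp : p <;> by_cases hq : q <;> simp [hp, hq]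

theorem ite_bits_or (p q : Prop) [Decidable p] [Decidable q] :
    ((if p then (1 : BitVec w) else 0) ||| (if q then 1 else 0)) = if p ∨ q then 1 else 0 := by
  by_cases hp : p <;> by_cases hq : q <;> simp [hp, hq]

theorem ite_bits_lsb (hw : 0 < w) (p : Prop) [Decidable p] :
    (if p then (1 : BitVec w) else 0).getLsbD 0 = decide p := by
  by_cases hp : p <;> simp [hp, hw]

theorem applyGates_coinPhase (hw : q + n + k + 1 < 2 ^ w) (hw0 : 0 < w) (O : BitVec w → BitVec w)
    (cl : ℕ → BitVec w) (sq : BitVec w) (act : BitVec w → Prop) [DecidablePred act]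
    (φ : BitVec w × Vertex n w × BitVec w → ℝ) :
    applyGates O cl (phaseGates coinPhase)
      (embed (fun p => (encode k s r x sq (fun t => if act t then 1 else 0) p).toBasis) φ) =
      embed (fun p => (encode k s r x sq (fun t => if act t then 1 else 0) p).toBasis)
        (fun p => (if act p.1 ∧ (p.2.2 ≠ 0 ∨ Marked k p.2.1) then -1 else 1) * φ p) := by
  rw [applyGates_phaseGates O cl (by decide) _ (clean_encode k s r x sq _) (encode_injective hw sq _)
    (fun _ => rfl)]
  congr 1
  funext p
  have : coinPhase.eval (encode k s r x sq (fun t => if act t then 1 else 0) p).1 =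
      if act p.1 ∧ (p.2.2 ≠ 0 ∨ Marked k p.2.1) then 1 else 0 := by
    rw [← ite_bits_and, ← ite_bits_or]
    simp only [← toNat_zero_lt_iff]
    rfl
  rw [this, ite_bits_lsb hw0]
  simp only [decide_eq_true_eq]

theorem applyGates_signPhase (hw : q + n + k + 1 < 2 ^ w) (hw0 : 0 < w) (O : BitVec w → BitVec w)
    (cl : ℕ → BitVec w) (sq : BitVec w) (act : BitVec w → Prop) [DecidablePred act]
    (φ : BitVec w × Vertex n w × BitVec w → ℝ) :
    applyGates O cl (phaseGates signPhase)
      (embed (fun p => (encode k s r x sq (fun t => if act t then 1 else 0) p).toBasis) φ) =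
      embed (fun p => (encode k s r x sq (fun t => if act t then 1 else 0) p).toBasis)
        (fun p => (if act p.1 then sign k p.2 else 1) * φ p) := by
  rw [applyGates_phaseGates O cl (by decide) _ (clean_encode k s r x sq _) (encode_injective hw sq _)
    (fun _ => rfl)]
  congr 1
  funext p
  have : signPhase.eval (encode k s r x sq (fun t => if act t then 1 else 0) p).1 =
      if act p.1 ∧ (p.2.2 = 0 ∧ (p.2.1.2.2.1 = 0 ∨ p.2.1.2.2.1 = BitVec.ofNat w k)) then 1
        else 0 := by
    rw [← ite_bits_and, ← ite_bits_and, ← ite_bits_or]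
    rfl
  rw [this, ite_bits_lsb hw0]
  simp only [decide_eq_true_eq, sign]
  by_cases h : act p.1 <;> simp [h]

/-- The gates that traverse an edge, and restore the work registers. -/
def moveGates : List (Gate 63) := (readEdge ++ flipEdge ++ readEdge.reverse).flatMap Instr.gates

theorem applyGates_moveGates (hw : q + n + k + 1 < 2 ^ w) (hs : s < 2 ^ w)
    (cl : ℕ → BitVec w) (sq : BitVec w) (act : BitVec w → Prop) [DecidablePred act]
    (φ : BitVec w × Vertex n w × BitVec w → ℝ) :
    applyGates (oracle w x) cl moveGates
      (embed (fun p => (encode k s r x sq (fun t => if act t then 1 else 0) p).toBasis) φ) =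
      embed (fun p => (encode k s r x sq (fun t => if act t then 1 else 0) p).toBasis)
        (fun p => φ (p.1, if act p.1 then move k s x p.2 else p.2)) := by
  rw [moveGates, Instr.applyGates_flatMap _ _ (by decide) _ (clean_encode k s r x sq _)]
  let f : BitVec w × Vertex n w × BitVec w → BitVec w × Vertex n w × BitVec w :=
    fun p => (p.1, if act p.1 then move k s x p.2 else p.2)
  have hf : Function.Involutive f := by
    rintro ⟨t, p⟩
    simp only [f]
    by_cases h : act t
    · simp only [h, if_true, move_involutive k s x p]
    · simp only [h, if_false]
  have h1 : ∀ p, Instr.runs (oracle w x) cl (readEdge ++ flipEdge ++ readEdge.reverse)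
      (encode k s r x sq (fun t => if act t then 1 else 0) p) =
      encode k s r x sq (fun t => if act t then 1 else 0) (f p) := by
    rintro ⟨t, p⟩
    rw [Instr.runs_append, Instr.runs_append, runs_flipEdge_readEdge hw hs cl sq _ t rfl p,
      Instr.runs_reverse _ _ readEdge_ok]
  simp only [h1]
  exact embed_comp_involutive_index (fun p => (encode k s r x sq
    (fun t => if act t then 1 else 0) p).toBasis) φ (encode_injective hw sq _) hf

/-- Compare the time register with the counter, to decide whether the step takes place. -/
def clockInstrs (b : ℕ) : List Instr := [.load 16 (b + 7), .xor 14 (bin lt (reg 16) (reg 1))]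

theorem runs_clockInstrs (O : BitVec w → BitVec w) (cl : ℕ → BitVec w) (b : ℕ)
    (p : BitVec w × Vertex n w × BitVec w) :
    Instr.runs O cl (clockInstrs b) (encode k s r x 0 (fun _ => 0) p) =
      encode k s r x (cl (b + 7))
        (fun t => if (cl (b + 7)).toNat < t.toNat then 1 else 0) p := by
  simp only [Instr.runs, clockInstrs, List.foldl, Instr.run, Expr.eval, BinOp.eval, encode]
  simp [update_file, file_apply]

/-- One step of the walk, for those values of the time register that exceed the counter. -/
def stepProg (b : ℕ) : Prog 63 :=
  .seq (Prog.ofGates ((clockInstrs b).flatMap Instr.gates))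
    (.seq (hadDesc (rg 2) b (b + 5)) (.seq (Prog.ofGates (phaseGates coinPhase))
      (.seq (hadAsc (rg 2) b (b + 5)) (Prog.ofGates
        (moveGates ++ (phaseGates signPhase ++ (clockInstrs b).reverse.flatMap Instr.gates))))))

/-- The number of steps of `stepProg`, except for those of the Hadamard transforms. -/
def stepOverhead (b : ℕ) : ℕ :=
  ((clockInstrs b).flatMap Instr.gates).length + (phaseGates coinPhase).length +
    (moveGates ++ (phaseGates signPhase ++ (clockInstrs b).reverse.flatMap Instr.gates)).length + 3

theorem runs_stepProg (hw : q + n + k + 1 < 2 ^ w) (hs : s < 2 ^ w) (hw0 : 0 < w) {L : ℕ}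
    (hL : L ≤ w) (b : ℕ) (cl : ℕ → BitVec w) (h1 : cl b = 1) (h5 : cl (b + 5) = BitVec.ofNat w L)
    (φ : BitVec w × Vertex n w × BitVec w → ℝ) :
    ∃ cl', (∀ j < b + 8, cl' j = cl j) ∧
      Runs (oracle w x) (stepProg b)
        (cl, embed (fun p => (encode k s r x 0 (fun _ => 0) p).toBasis) φ)
        (8 * L + 4 + stepOverhead b)
        (cl', embed (fun p => (encode k s r x 0 (fun _ => 0) p).toBasis) fun p =>
          if (cl (b + 7)).toNat < p.1.toNat then walk k s L x (fun u => φ (p.1, u)) p.2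
          else φ p) := by
  let act : BitVec w → Prop := fun t => (cl (b + 7)).toNat < t.toNat
  let enc := fun p => (encode k s r x (cl (b + 7)) (fun t => if act t then 1 else 0) p).toBasis
  let enc0 := fun p => (encode k s r x (0 : BitVec w) (fun _ => 0) p).toBasis
  have hok : ∀ b, (clockInstrs b).all Instr.ok = true := fun b => by
    simp [clockInstrs, Instr.ok, Expr.all, Expr.height, stackBase]
  have hok' : ∀ b, (clockInstrs b).reverse.all Instr.ok = true := fun b => by
    rw [List.all_reverse]; exact hok b
  -- switch the clock on
  have s1 : Runs (oracle w x) (Prog.ofGates ((clockInstrs b).flatMap Instr.gates))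
      (cl, embed enc0 φ) (((clockInstrs b).flatMap Instr.gates).length + 1) (cl, embed enc φ) := by
    have := runs_ofGates (oracle w x) ((clockInstrs b).flatMap Instr.gates) (cl, embed enc0 φ)
    simp only [enc0] at this
    rw [Instr.applyGates_flatMap _ _ (hok b) _ (clean_encode k s r x 0 _)] at this
    simp only [runs_clockInstrs] at this
    exact this
  obtain ⟨cl2, hcl2, s2⟩ := runs_hadDesc (O := oracle w x) (i := rg 2) (enc := enc) (H := hadDir)
    (fun cl c φ hc => apply_hadDir hw _ _ _ cl c φ hc) hL b (b + 5) cl h1 h5 φ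
  set φ2 := iterDesc hadDir L φ with hφ2
  let φ3 : BitVec w × Vertex n w × BitVec w → ℝ := fun p =>
    (if act p.1 ∧ (p.2.2 ≠ 0 ∨ Marked k p.2.1) then -1 else 1) * φ2 p
  have s3 : Runs (oracle w x) (Prog.ofGates (phaseGates coinPhase)) (cl2, embed enc φ2)
      ((phaseGates coinPhase).length + 1) (cl2, embed enc φ3) := by
    have := runs_ofGates (oracle w x) (phaseGates coinPhase) (cl2, embed enc φ2)
    simp only [enc] at this
    rw [applyGates_coinPhase hw hw0] at this
    exact this
  obtain ⟨cl4, hcl4, s4⟩ := runs_hadAsc (O := oracle w x) (i := rg 2) (enc := enc) (H := hadDir)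
    (fun cl c φ hc => apply_hadDir hw _ _ _ cl c φ hc) hL b (b + 5) (by omega) cl2
    (by rw [hcl2 _ (by omega), h1]) (by rw [hcl2 _ (by omega), h5]) φ3
  set φ4 := iterAsc hadDir L φ3 with hφ4
  let φ5 : BitVec w × Vertex n w × BitVec w → ℝ := fun p =>
    φ4 (p.1, if act p.1 then move k s x p.2 else p.2)
  let φ6 : BitVec w × Vertex n w × BitVec w → ℝ := fun p =>
    (if act p.1 then sign k p.2 else 1) * φ5 p
  have hcl7 : cl4 (b + 7) = cl (b + 7) := by rw [hcl4 _ (by omega), hcl2 _ (by omega)]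
  have s5 : Runs (oracle w x) (Prog.ofGates (moveGates ++ (phaseGates signPhase ++
      (clockInstrs b).reverse.flatMap Instr.gates))) (cl4, embed enc φ4)
      ((moveGates ++ (phaseGates signPhase ++
        (clockInstrs b).reverse.flatMap Instr.gates)).length + 1) (cl4, embed enc0 φ6) := by
    have := runs_ofGates (oracle w x) (moveGates ++ (phaseGates signPhase ++
      (clockInstrs b).reverse.flatMap Instr.gates)) (cl4, embed enc φ4)
    simp only [enc] at this
    rw [applyGates_append, applyGates_append, applyGates_moveGates hw hs,
      applyGates_signPhase hw hw0,
      Instr.applyGates_flatMap _ _ (hok' b) _ (clean_encode k s r x _ _)] at this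
    have hback : ∀ p : BitVec w × Vertex n w × BitVec w,
        Instr.runs (oracle w x) cl4 (clockInstrs b).reverse
          (encode k s r x (cl (b + 7)) (fun t => if act t then 1 else 0) p) =
        encode k s r x 0 (fun _ => 0) p := fun p => by
      have h := runs_clockInstrs (k := k) (s := s) (r := r) (x := x) (oracle w x) cl4 b p
      rw [hcl7] at h
      simp only [act]
      rw [← h, Instr.runs_reverse _ _ (hok b)]
    simp only [hback] at this
    exact this
  have hfinal : φ6 = fun p => if (cl (b + 7)).toNat < p.1.toNat then
      walk k s L x (fun u => φ (p.1, u)) p.2 else φ p := by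
    funext ⟨t, p⟩
    by_cases ha : act t
    · have ha' : (cl (b + 7)).toNat < t.toNat := ha
      have h4 : ∀ u : Vertex n w × BitVec w, φ4 (t, u) = coin (Marked k) L (fun u => φ (t, u)) u := by
        rintro ⟨y, g⟩
        rw [← hadamard_coin (Marked k) hL, hφ4, iterAsc_hadDir]
        simp only [φ3, hφ2, iterDesc_hadDir, ha, true_and]
      simp only [φ6, φ5, if_pos ha, if_pos ha', h4]
      rfl
    · have ha' : ¬ (cl (b + 7)).toNat < t.toNat := ha
      obtain ⟨y, g⟩ := p
      simp only [φ6, φ5, if_neg ha, if_neg ha', one_mul]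
      rw [hφ4, iterAsc_hadDir]
      simp only [φ3, hφ2, iterDesc_hadDir, ha, false_and, if_false, one_mul]
      exact congrFun (hdAsc_hdDesc hL (fun g => φ (t, y, g))) g
  refine ⟨cl4, fun j hj => by rw [hcl4 j hj, hcl2 j hj], ?_⟩
  rw [← hfinal]
  refine (Runs.seq s1 (Runs.seq s2 (Runs.seq s3 (Runs.seq s4 s5)))).cast ?_
  simp only [stepOverhead]
  omega

end Step

end KDistinctness

namespace KDistinctness

open QRam CoinedWalk PhaseDetection Expr BinOp

variable {n q w : ℕ} {k s : ℕ} {r : Fin (k - 1) → ℕ} {x : Fin n → Fin q}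

/-! ### Preparation of the starting vector -/

theorem file_replicate (m i : ℕ) : file (List.replicate m (0 : BitVec w)) i = 0 := by
  rw [file_apply, List.getD, List.getElem?_replicate]
  split_ifs <;> rfl

/-- The basis states in the initial superposition. -/
def startBasis (w k : ℕ) (x : Fin n → Fin q) (S : Finset (Fin n)) : RegMem w :=
  (file (List.replicate 25 0), dataStructure w k x S)

theorem startBasis_toBasis (S : Finset (Fin n)) :
    (startBasis w k x S).toBasis = (0, dataStructure w k x S) := by
  refine Prod.ext (funext fun i => ?_) rfl
  exact file_replicate 25 i

theorem dataStructure_size (hw : q + n + k + 1 < 2 ^ w) (S : Finset (Fin n)) :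
    dataStructure w k x S (BitVec.ofNat w (q + n)) = BitVec.ofNat w S.card := by
  have h : (BitVec.ofNat w (q + n)).toNat = q + n := toNat_ofNat_of_lt (by omega)
  rw [dataStructure, h, if_neg (by omega), dif_neg (by omega), if_pos rfl]

theorem update_dataStructure (hw : q + n + k + 1 < 2 ^ w) {S : Finset (Fin n)}
    (h : S ∈ startSets k r x) :
    Function.update (dataStructure w k x S) (BitVec.ofNat w (q + n)) 0 = setMemory w k r x S := by
  have ht : setType k x S = startType k r := by simpa [startSets] using h
  funext a
  by_cases ha : a = BitVec.ofNat w (q + n)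
  · subst ha
    have h : (BitVec.ofNat w (q + n)).toNat = q + n := toNat_ofNat_of_lt (by omega)
    rw [Function.update_self, setMemory, h, if_neg (by omega), dif_neg (by omega), if_pos rfl]
  · have ha' : a.toNat ≠ q + n := by
      rintro h
      apply ha
      apply BitVec.eq_of_toNat_eq
      rw [h, toNat_ofNat_of_lt (by omega)]
    rw [Function.update_of_ne ha, dataStructure, setMemory, if_neg ha', if_neg ha', ht]

/-- Load the constants into the quantum registers, move the size of the set into the register `5`,
and compute the label of the starting vertex. -/
def initInstrs (b : ℕ) : List Instr :=
  [.load 18 0, .load 19 1, .load 20 (b + 1), .load 21 (b + 2), .load 22 b, .load 24 (b + 3),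
    .xor 7 (bin add (reg 19) (reg 18)), .swap 5 7, .xor 7 (bin add (reg 19) (reg 18)),
    .xor 4 (bin mul (bin sub (reg 22) (bin eq (reg 5) (reg 24))) (reg 20))]

theorem initInstrs_ok (b : ℕ) : (initInstrs b).all Instr.ok = true := by
  simp [initInstrs, Instr.ok, Expr.all, Expr.height, stackBase]

theorem runs_initInstrs (hw : q + n + k + 1 < 2 ^ w) (O : BitVec w → BitVec w)
    (cl : ℕ → BitVec w) (b : ℕ) (c0 : cl 0 = BitVec.ofNat w n) (c1 : cl 1 = BitVec.ofNat w q)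
    (b0 : cl b = 1) (b1 : cl (b + 1) = BitVec.ofNat w k) (b2 : cl (b + 2) = BitVec.ofNat w s)
    (b3 : cl (b + 3) = BitVec.ofNat w (startSize k r))
    {S : Finset (Fin n)} (h : S ∈ startSets k r x) :
    Instr.runs O cl (initInstrs b) (startBasis w k x S) =
      encode k s r x 0 (fun _ => 0) (0, startVertex w k r S, 0) := by
  have hlab : (1 - (if BitVec.ofNat w S.card = BitVec.ofNat w (startSize k r) then (1 : BitVec w)
      else 0)) * BitVec.ofNat w k =
      if BitVec.ofNat w S.card = BitVec.ofNat w (startSize k r) then 0 else BitVec.ofNat w k := by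
    split_ifs <;> simp
  rw [encode, startVertex]
  simp only
  rw [← update_dataStructure hw h, ← hlab, ← dataStructure_size (x := x) hw S]
  simp only [Instr.runs, initInstrs, List.foldl, Instr.run, Expr.eval, BinOp.eval, startBasis,
    List.replicate, c0, c1, b0, b1, b2, b3]
  simp [update_file, file_apply, BitVec.ofNat_add]

theorem applyGates_initInstrs (hw : q + n + k + 1 < 2 ^ w) (O : BitVec w → BitVec w)
    (cl : ℕ → BitVec w) (b : ℕ) (c0 : cl 0 = BitVec.ofNat w n) (c1 : cl 1 = BitVec.ofNat w q)
    (b0 : cl b = 1) (b1 : cl (b + 1) = BitVec.ofNat w k) (b2 : cl (b + 2) = BitVec.ofNat w s)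
    (b3 : cl (b + 3) = BitVec.ofNat w (startSize k r)) :
    applyGates O cl ((initInstrs b).flatMap Instr.gates) (initialState w 63 k r x).2 =
      embed (fun p => (encode k s r x 0 (fun _ => 0) p).toBasis)
        (fun p => if p.1 = 0 then startVector w k r x p.2 else 0) := by
  classical
  let ι : {S // S ∈ startSets k r x} → BitVec w × Vertex n w × BitVec w :=
    fun S => (0, startVertex w k r S.1, 0)
  have hι : Function.Injective ι := fun S S' h =>
    Subtype.ext (congrArg (fun p => p.2.1.1) h)
  let enc : {S // S ∈ startSets k r x} → RegMem w := fun S => startBasis w k x S.1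
  have hclean : ∀ S, Instr.Clean (enc S) := fun S j _ => file_replicate 25 j
  have hruns : ∀ S, Instr.runs O cl (initInstrs b) (enc S) = encode k s r x 0 (fun _ => 0) (ι S) :=
    fun S => runs_initInstrs hw O cl b c0 c1 b0 b1 b2 b3 S.2
  have hinj : Function.Injective fun S => (enc S).toBasis := by
    intro S S' h
    apply hι
    apply encode_injective (s := s) (r := r) (x := x) hw 0 (fun _ => 0)
    simp only [← hruns]
    rw [← Instr.actGates_flatMap O cl (initInstrs_ok b) (hclean S),
      ← Instr.actGates_flatMap O cl (initInstrs_ok b) (hclean S')]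
    exact congrArg _ h
  have hψ : (initialState w 63 k r x).2 = embed (fun S => (enc S).toBasis)
      (fun _ => (Real.sqrt (startSets k r x).card)⁻¹) := by
    funext v
    simp only [initialState]
    by_cases hv : ∃ S, (enc S).toBasis = v
    · obtain ⟨S, rfl⟩ := hv
      rw [embed_apply hinj, Finset.sum_eq_single_of_mem S.1 S.2]
      · rw [if_pos (startBasis_toBasis _)]
        push_cast
        ring
      · intro S' hS' hne
        rw [if_neg]
        intro h
        apply hne
        rw [← startBasis_toBasis] at h
        exact (congrArg Subtype.val (@hinj S ⟨S', hS'⟩ h)).symm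
    · rw [embed_of_notMem _ hv, Finset.sum_eq_zero, mul_zero]
      intro S hS
      rw [if_neg]
      rintro rfl
      exact hv ⟨⟨S, hS⟩, startBasis_toBasis _⟩
  rw [hψ, Instr.applyGates_flatMap O cl (initInstrs_ok b) enc hclean]
  simp only [hruns]
  have := embed_comp_injective (fun p => (encode k s r x 0 (fun _ => 0) p).toBasis) (ι := ι)
    (fun _ => (Real.sqrt (startSets k r x).card)⁻¹) (encode_injective hw 0 _) hι
  rw [Function.comp_def] at this
  rw [this]
  congr 1
  funext p
  by_cases hp : ∃ S, ι S = p
  · obtain ⟨S, rfl⟩ := hp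
    rw [hι.extend_apply]
    simp only [ι, if_true, startVector]
    rw [if_pos ⟨trivial, rfl, S.2⟩]
  · rw [Function.extend_apply' _ _ _ hp]
    obtain ⟨t, y, g⟩ := p
    simp only [startVector, Pi.zero_apply]
    split_ifs with h1 h2
    · exfalso
      obtain ⟨h2, h3, h4⟩ := h2
      refine hp ⟨⟨y.1, h4⟩, ?_⟩
      simp only [ι]
      rw [← h3, h1, h2]
    · rfl
    · rfl

/-! ### The walk, controlled by the time register -/

theorem walk_smul (k s L : ℕ) (x : Fin n → Fin q) (c : ℝ) (f : Vertex n w × BitVec w → ℝ) :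
    walk k s L x (c • f) = c • walk k s L x f := by
  funext p
  simp only [walk, step, shift, coin, Pi.smul_apply, smul_eq_mul]
  have : (∑ g : BitVec w, if g.toNat < 2 ^ L then c * f ((move k s x p).1, g) else 0) =
      c * ∑ g : BitVec w, if g.toNat < 2 ^ L then f ((move k s x p).1, g) else 0 := by
    rw [Finset.mul_sum]
    exact Finset.sum_congr rfl fun g _ => by split_ifs <;> simp
  rw [this]
  split_ifs <;> ring

/-- The amplitudes when the counter of the main loop has reached `σ`: the component with the time
`t` has undergone `t - σ` steps of the walk. -/
noncomputable def clockVector (k s L a : ℕ) (r : Fin (k - 1) → ℕ) (x : Fin n → Fin q) (σ : ℕ)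
    (p : BitVec w × Vertex n w × BitVec w) : ℝ :=
  if p.1.toNat < 2 ^ a then
    (Real.sqrt (2 ^ a))⁻¹ * (walk k s L x)^[p.1.toNat - σ] (startVector w k r x) p.2 else 0

/-- The main loop, with a decreasing counter in the classical register `b + 7`. -/
def mainLoop (b : ℕ) : Prog 63 :=
  .loop (b + 7) (.seq (.arith .sub (b + 7) (b + 7) b) (stepProg b))

theorem runs_mainLoop (hw : q + n + k + 1 < 2 ^ w) (hs : s < 2 ^ w) (hw0 : 0 < w) {L : ℕ}
    (hL : L ≤ w) (a b : ℕ) {σ : ℕ} (hσ : σ < 2 ^ w) (cl : ℕ → BitVec w) (h1 : cl b = 1)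
    (h5 : cl (b + 5) = BitVec.ofNat w L) (h7 : cl (b + 7) = BitVec.ofNat w σ) :
    ∃ cl', (∀ j < b + 7, cl' j = cl j) ∧
      Runs (oracle w x) (mainLoop b)
        (cl, embed (fun p => (encode k s r x 0 (fun _ => 0) p).toBasis) (clockVector k s L a r x σ))
        (σ * (8 * L + 6 + stepOverhead b) + 1)
        (cl', embed (fun p => (encode k s r x 0 (fun _ => 0) p).toBasis)
          (clockVector k s L a r x 0)) := by
  induction σ generalizing cl with
  | zero => exact ⟨cl, fun _ _ => rfl, by rw [zero_mul, zero_add]; exact Runs.loopFalse h7⟩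
  | succ σ ih =>
    let cl1 := Function.update cl (b + 7) (BitVec.ofNat w σ)
    have h7' : cl1 (b + 7) = BitVec.ofNat w σ := by simp [cl1]
    obtain ⟨cl2, hcl2, hr2⟩ := runs_stepProg (k := k) (s := s) (r := r) (x := x) hw hs hw0 hL b cl1
      (by simp [cl1, h1]) (by simp [cl1, h5]) (clockVector k s L a r x (σ + 1))
    rw [h7', toNat_ofNat_of_lt (by omega)] at hr2
    have hnext : (fun p : BitVec w × Vertex n w × BitVec w => if σ < p.1.toNat then
        walk k s L x (fun u => clockVector k s L a r x (σ + 1) (p.1, u)) p.2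
        else clockVector k s L a r x (σ + 1) p) = clockVector k s L a r x σ := by
      funext p
      simp only [clockVector]
      by_cases hp : p.1.toNat < 2 ^ a
      · simp only [if_pos hp]
        split_ifs with ht
        · have := walk_smul k s L x (Real.sqrt (2 ^ a))⁻¹
            ((walk k s L x)^[p.1.toNat - (σ + 1)] (startVector w k r x))
          refine (congrFun this p.2).trans ?_
          rw [Pi.smul_apply, smul_eq_mul, ← Function.iterate_succ_apply' (walk k s L x),
            show (p.1.toNat - (σ + 1)).succ = p.1.toNat - σ by omega]
        · rw [show p.1.toNat - (σ + 1) = 0 by omega, show p.1.toNat - σ = 0 by omega]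
      · simp only [if_neg hp]
        split_ifs with ht
        · have := walk_smul k s L x 0 (0 : Vertex n w × BitVec w → ℝ)
          rw [zero_smul, zero_smul] at this
          exact congrFun this p.2
        · rfl
    rw [hnext] at hr2
    obtain ⟨cl3, hcl3, hr3⟩ := ih (by omega) cl2 (by rw [hcl2 _ (by omega)]; simp [cl1, h1])
      (by rw [hcl2 _ (by omega)]; simp [cl1, h5]) (by rw [hcl2 _ (by omega), h7'])
    refine ⟨cl3, fun j hj => ?_, ?_⟩
    · rw [hcl3 j hj, hcl2 j (by omega)]
      exact Function.update_of_ne (by omega) _ _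
    · have step1 : Runs (oracle w x) (.arith .sub (b + 7) (b + 7) b)
          (cl, embed (fun p => (encode k s r x 0 (fun _ => 0) p).toBasis)
            (clockVector k s L a r x (σ + 1))) 1
          (cl1, embed (fun p => (encode k s r x 0 (fun _ => 0) p).toBasis)
            (clockVector k s L a r x (σ + 1))) := by
        have := Runs.arith (O := oracle w x) (m := 63) .sub (b + 7) (b + 7) b
          (cl, embed (fun p => (encode k s r x 0 (fun _ => 0) p).toBasis)
            (clockVector k s L a r x (σ + 1)))
        simp only [BinOp.eval, h7, h1, ofNat_succ_sub_one] at this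
        exact this
      refine (Runs.loopTrue ?_ (Runs.seq step1 hr2) hr3).cast (by ring)
      show cl (b + 7) ≠ 0
      rw [h7]
      exact ofNat_succ_ne_zero hσ

/-- The quantum part of the algorithm: prepare the starting vector and a uniform superposition of
times, walk for that time, and test whether the register of times returns to zero. -/
def quantumProg (b : ℕ) : Prog 63 :=
  .seq (Prog.ofGates ((initInstrs b).flatMap Instr.gates)) (.seq (hadAsc (rg 1) b (b + 6))
    (.seq (mainLoop b) (.seq (hadDesc (rg 1) b (b + 6))
      (Prog.ofGates ([Instr.xor 0 (bin eq (reg 1) (reg 23))].flatMap Instr.gates)))))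

/-- The number of steps of `quantumProg` outside of loops. -/
def quantumOverhead (b : ℕ) : ℕ :=
  ((initInstrs b).flatMap Instr.gates).length +
    ([Instr.xor 0 (bin eq (reg 1) (reg 23))].flatMap Instr.gates).length + 7

/-- The registers and the memory after the final comparison. -/
def finalState (k s : ℕ) (r : Fin (k - 1) → ℕ) (x : Fin n → Fin q)
    (p : BitVec w × Vertex n w × BitVec w) : RegMem w :=
  (Function.update (encode k s r x 0 (fun _ => 0) p).1 0 (if p.1 = 0 then 1 else 0),
    (encode k s r x 0 (fun _ => 0) p).2)

theorem runs_compare (O : BitVec w → BitVec w) (cl : ℕ → BitVec w)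
    (p : BitVec w × Vertex n w × BitVec w) :
    Instr.runs O cl [Instr.xor 0 (bin eq (reg 1) (reg 23))]
      (encode k s r x 0 (fun _ => 0) p) = finalState k s r x p := by
  simp only [Instr.runs, List.foldl, Instr.run, Expr.eval, BinOp.eval, finalState, encode]
  simp [file_apply]

theorem finalState_injective (hw : q + n + k + 1 < 2 ^ w) :
    Function.Injective fun p : BitVec w × Vertex n w × BitVec w =>
      (finalState k s r x p).toBasis := by
  intro p p' h
  have hok : [Instr.xor 0 (bin eq (reg 1) (reg 23))].all Instr.ok = true := by decide
  apply encode_injective (s := s) (r := r) (x := x) hw 0 (fun _ => 0)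
  have hc : ∀ p : BitVec w × Vertex n w × BitVec w, Instr.Clean (finalState k s r x p) := fun p => by
    rw [← runs_compare (fun _ => 0) (fun _ => 0)]
    exact Instr.Clean.runs hok (clean_encode k s r x 0 _ p)
  have hb : ∀ p : BitVec w × Vertex n w × BitVec w,
      actGates (fun _ => (0 : BitVec w)) (fun _ => 0)
        ([Instr.xor 0 (bin eq (reg 1) (reg 23))].reverse.flatMap Instr.gates)
        (finalState k s r x p).toBasis = (encode k s r x 0 (fun _ => 0) p).toBasis := fun p => by
    rw [Instr.actGates_flatMap _ _ (by decide) (hc p), ← runs_compare (fun _ => 0) (fun _ => 0),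
      Instr.runs_reverse _ _ hok]
  simp only
  rw [← hb p, ← hb p']
  exact congrArg _ h

theorem runs_quantumProg (hw : q + n + k + 1 < 2 ^ w) (hs : s < 2 ^ w) (hw0 : 0 < w) {L a : ℕ}
    (hL : L ≤ w) (ha : a < w) (b : ℕ) (cl : ℕ → BitVec w)
    (c0 : cl 0 = BitVec.ofNat w n) (c1 : cl 1 = BitVec.ofNat w q)
    (b0 : cl b = 1) (b1 : cl (b + 1) = BitVec.ofNat w k) (b2 : cl (b + 2) = BitVec.ofNat w s)
    (b3 : cl (b + 3) = BitVec.ofNat w (startSize k r)) (b5 : cl (b + 5) = BitVec.ofNat w L)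
    (b6 : cl (b + 6) = BitVec.ofNat w a) (b7 : cl (b + 7) = BitVec.ofNat w (2 ^ a)) :
    ∃ st : State w 63, Runs (oracle w x) (quantumProg b) (cl, (initialState w 63 k r x).2)
      (2 ^ a * (8 * L + 6 + stepOverhead b) + 8 * a + quantumOverhead b) st ∧
      acceptProb st = average (walk (w := w) k s L x) (2 ^ a) (startVector w k r x) ⬝ᵥ
        average (walk (w := w) k s L x) (2 ^ a) (startVector w k r x) := by
  classical
  have hok : [Instr.xor 0 (bin eq (reg 1) (reg 23))].all Instr.ok = true := by decide
  let enc := fun p : BitVec w × Vertex n w × BitVec w =>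
    (encode k s r x 0 (fun _ => 0) p).toBasis
  let φ0 : BitVec w × Vertex n w × BitVec w → ℝ := fun p =>
    if p.1 = 0 then startVector w k r x p.2 else 0
  have s1 := runs_ofGates (oracle w x) ((initInstrs b).flatMap Instr.gates)
    (cl, (initialState w 63 k r x).2)
  simp only at s1
  rw [applyGates_initInstrs hw (oracle w x) cl b c0 c1 b0 b1 b2 b3] at s1
  obtain ⟨cl2, hcl2, s2⟩ := runs_hadAsc (O := oracle w x) (i := rg 1) (enc := enc) (H := hadTime)
    (fun cl c φ hc => apply_hadTime hw _ cl c φ hc) ha.le b (b + 6) (by omega) cl b0 b6 φ0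
  have h2 : iterAsc hadTime a φ0 = clockVector k s L a r x (2 ^ a) := by
    funext p
    rw [iterAsc_hadTime]
    have e : (fun t => φ0 (t, p.2)) = startVector w k r x p.2 • (Pi.single 0 1 : BitVec w → ℝ) := by
      funext t
      simp only [φ0, Pi.smul_apply, smul_eq_mul, Pi.single_apply]
      split_ifs <;> simp
    simp only [e]
    rw [hdAsc_smul, hdAsc_single ha.le, Pi.smul_apply, smul_eq_mul, clockVector]
    split_ifs with hp
    · rw [show p.1.toNat - 2 ^ a = 0 by omega, Function.iterate_zero, id, one_div, mul_comm]
    · rw [mul_zero]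
  rw [h2] at s2
  obtain ⟨cl3, hcl3, s3⟩ := runs_mainLoop (k := k) (s := s) (r := r) (x := x) hw hs hw0 hL a b
    (Nat.pow_lt_pow_right (by norm_num) ha) cl2 (by rw [hcl2 _ (by omega), b0])
    (by rw [hcl2 _ (by omega), b5]) (by rw [hcl2 _ (by omega), b7])
  obtain ⟨cl4, hcl4, s4⟩ := runs_hadDesc (O := oracle w x) (i := rg 1) (enc := enc) (H := hadTime)
    (fun cl c φ hc => apply_hadTime hw _ cl c φ hc) ha.le b (b + 6) cl3
    (by rw [hcl3 _ (by omega), hcl2 _ (by omega), b0])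
    (by rw [hcl3 _ (by omega), hcl2 _ (by omega), b6]) (clockVector k s L a r x 0)
  set φ4 := iterDesc hadTime a (clockVector (w := w) k s L a r x 0) with hφ4
  have s5 := runs_ofGates (oracle w x) ([Instr.xor 0 (bin eq (reg 1) (reg 23))].flatMap Instr.gates)
    (cl4, embed enc φ4)
  simp only [enc] at s5
  rw [Instr.applyGates_flatMap _ _ hok _ (clean_encode k s r x 0 _)] at s5
  simp only [runs_compare] at s5
  refine ⟨_, (Runs.seq s1 (Runs.seq s2 (Runs.seq s3 (Runs.seq s4 s5)))).cast ?_, ?_⟩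
  · simp only [quantumOverhead]; ring
  · have havg : ∀ u, φ4 (0, u) = average (walk (w := w) k s L x) (2 ^ a) (startVector w k r x) u := by
      intro u
      rw [hφ4, iterDesc_hadTime]
      simp only
      rw [hdDesc_zero ha.le, average, Pi.smul_apply, smul_eq_mul, Finset.sum_apply]
      have e : (∑ g : BitVec w, if g.toNat < 2 ^ a then clockVector k s L a r x 0 (g, u) else 0) =
          (Real.sqrt (2 ^ a))⁻¹ * ∑ t ∈ Finset.range (2 ^ a),
            (walk k s L x)^[t] (startVector w k r x) u := by
        rw [← Finset.sum_filter, Finset.mul_sum]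
        have hlt : 2 ^ a < 2 ^ w := Nat.pow_lt_pow_right (by norm_num) ha
        refine Finset.sum_nbij' (fun g => g.toNat) (fun t => BitVec.ofNat w t) ?_ ?_ ?_ ?_ ?_
        · intro g hg; simpa using hg
        · intro t ht
          have ht := Finset.mem_range.1 ht
          simp only [Finset.mem_filter, Finset.mem_univ, true_and]
          rw [toNat_ofNat_of_lt (by omega)]
          exact ht
        · intro g _; simp
        · intro t ht
          have ht := Finset.mem_range.1 ht
          exact toNat_ofNat_of_lt (by omega)
        · intro g hg
          simp only [Finset.mem_filter, Finset.mem_univ, true_and] at hg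
          simp only [clockVector, if_pos hg, Nat.sub_zero]
      rw [e]
      have hs : Real.sqrt (2 ^ a) * Real.sqrt (2 ^ a) = 2 ^ a := Real.mul_self_sqrt (by positivity)
      push_cast
      rw [div_eq_inv_mul, ← mul_assoc, ← mul_inv, hs]
    have hacc : ∀ p : BitVec w × Vertex n w × BitVec w,
        ((finalState k s r x p).toBasis.1 0 = 1) ↔ p.1 = 0 := by
      intro p
      show (if p.1 = 0 then (1 : BitVec w) else 0) = 1 ↔ _
      have h01 : (0 : BitVec w) ≠ 1 := by
        intro h
        have := congrArg BitVec.toNat h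
        simp [hw0.ne'] at this
      split_ifs with h
      · exact iff_of_true rfl h
      · exact iff_of_false h01 h
    simp only [acceptProb]
    rw [← Fintype.sum_of_injective (fun u => (finalState k s r x (0, u)).toBasis)
      (fun u u' h => congrArg Prod.snd (finalState_injective (s := s) (r := r) (x := x) hw h))
      (fun u => φ4 (0, u) * φ4 (0, u))]
    · simp only [havg]
      rfl
    · intro v hv
      split_ifs with h1
      · rw [embed_of_notMem]
        · simp
        · rintro ⟨⟨t, u⟩, rfl⟩
          rw [hacc] at h1
          simp only at h1
          subst h1
          exact hv ⟨u, rfl⟩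
      · rfl
    · intro u
      rw [if_pos ((hacc _).2 rfl)]
      have := embed_apply (finalState_injective (s := s) (r := r) (x := x) hw) φ4 (0, u)
      rw [this]
      simp [pow_two]

end KDistinctness

namespace QRam

variable {w : ℕ}

/-! ### Classical computations -/

/-- Assignments to classical registers. -/
inductive Assign where
  /-- store the constant `v` in the register `c` -/
  | const (c v : ℕ)
  /-- store the value of `o` at the registers `a`, `b` in the register `c` -/
  | arith (o : BinOp) (c a b : ℕ)

/-- The effect of an assignment. -/
def Assign.run : Assign → (ℕ → BitVec w) → (ℕ → BitVec w)
  | const c v, cl => Function.update cl c (BitVec.ofNat w v)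
  | arith o c a b, cl => Function.update cl c (o.eval (cl a) (cl b))

/-- The program that performs a list of assignments. -/
def Prog.ofAssigns {m : ℕ} : List Assign → Prog m
  | [] => .skip
  | .const c v :: l => .seq (.const c v) (ofAssigns l)
  | .arith o c a b :: l => .seq (.arith o c a b) (ofAssigns l)

theorem runs_ofAssigns {m : ℕ} (O : BitVec w → BitVec w) (l : List Assign) (cl : ℕ → BitVec w)
    (ψ : Basis w m → ℂ) :
    Runs O (Prog.ofAssigns l) (cl, ψ) (l.length + 1)
      (l.foldl (fun cl A => A.run cl) cl, ψ) := by
  induction l generalizing cl with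
  | nil => exact Runs.skip _
  | cons A l ih =>
    cases A with
    | const c v =>
      exact (Runs.seq (Runs.const c v (cl, ψ)) (ih _)).cast (by rw [List.length_cons]; ring)
    | arith o c a b =>
      exact (Runs.seq (Runs.arith o c a b (cl, ψ)) (ih _)).cast (by rw [List.length_cons]; ring)

theorem ofNat_ne_zero {a : ℕ} (h : a < 2 ^ w) (h0 : a ≠ 0) : BitVec.ofNat w a ≠ 0 := by
  obtain ⟨a, rfl⟩ := Nat.exists_eq_succ_of_ne_zero h0
  exact ofNat_succ_ne_zero h

/-- Add the number of binary digits of the register `b + 8` to the register `b + 5`. -/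
def sizeLoop (b : ℕ) : Prog 63 :=
  .loop (b + 8) (.ofAssigns [.arith .shiftRight (b + 8) (b + 8) b, .arith .add (b + 5) (b + 5) b])

theorem runs_sizeLoop (O : BitVec w → BitVec w) (ψ : Basis w 63 → ℂ) (b : ℕ) (hw : 0 < w) {v : ℕ}
    (hv : v < 2 ^ w) (u : ℕ) (cl : ℕ → BitVec w) (h1 : cl b = 1)
    (h5 : cl (b + 5) = BitVec.ofNat w u) (h8 : cl (b + 8) = BitVec.ofNat w v) :
    ∃ (ℓ : ℕ) (cl' : ℕ → BitVec w), v < 2 ^ ℓ ∧ 2 ^ ℓ ≤ max 1 (2 * v) ∧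
      (∀ j, j ≠ b + 5 → j ≠ b + 8 → cl' j = cl j) ∧ cl' (b + 5) = BitVec.ofNat w (u + ℓ) ∧
      Runs O (sizeLoop b) (cl, ψ) (4 * ℓ + 1) (cl', ψ) := by
  induction v using Nat.strong_induction_on generalizing u cl with
  | _ v ih =>
    by_cases hv0 : v = 0
    · subst hv0
      exact ⟨0, cl, by norm_num, by norm_num, fun _ _ _ => rfl, h5, Runs.loopFalse h8⟩
    · have hsh : BitVec.ofNat w v >>> (1 : BitVec w).toNat = BitVec.ofNat w (v / 2) := by
        apply BitVec.eq_of_toNat_eq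
        rw [BitVec.toNat_ushiftRight, show (1 : BitVec w).toNat = 1 from BitVec.toNat_one hw,
          BitVec.toNat_ofNat, BitVec.toNat_ofNat,
          Nat.mod_eq_of_lt hv, Nat.mod_eq_of_lt (by omega), Nat.shiftRight_one]
      have hb := runs_ofAssigns (m := 63) O [.arith .shiftRight (b + 8) (b + 8) b,
        .arith .add (b + 5) (b + 5) b] cl ψ
      set cl1 := [Assign.arith .shiftRight (b + 8) (b + 8) b, .arith .add (b + 5) (b + 5) b].foldl
        (fun cl A => A.run cl) cl with hcl1
      have e1 : cl1 b = 1 := by simp [hcl1, Assign.run, h1]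
      have e5 : cl1 (b + 5) = BitVec.ofNat w (u + 1) := by
        simp [hcl1, Assign.run, BinOp.eval, h1, h5, BitVec.ofNat_add]
      have e8 : cl1 (b + 8) = BitVec.ofNat w (v / 2) := by
        simp only [hcl1, Assign.run, BinOp.eval, List.foldl]
        rw [Function.update_of_ne (by omega), Function.update_self, h8, h1, hsh]
      obtain ⟨ℓ, cl', hlt, hle, hfr, h5', hr⟩ := ih (v / 2) (by omega) (by omega) (u + 1) cl1 e1 e5 e8
      refine ⟨ℓ + 1, cl', by rw [pow_succ]; omega, by rw [pow_succ]; omega,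
        fun j hj5 hj8 => ?_, ?_, ?_⟩
      · rw [hfr j hj5 hj8]
        simp [hcl1, Assign.run, hj5, hj8]
      · rw [h5']; congr 1; ring
      · refine (Runs.loopTrue ?_ hb hr).cast (by simp only [List.length_cons, List.length_nil]; ring)
        show cl (b + 8) ≠ 0
        rw [h8]
        exact ofNat_ne_zero hv hv0

/-- Quadruple the register `b + 11`, double the register `b + 7` and increment the register `b + 6`
until the register `b + 11` reaches the register `b + 10`. -/
def timeLoop (b : ℕ) : Prog 63 :=
  .loop (b + 13) (.ofAssigns [.arith .shiftLeft (b + 11) (b + 11) (b + 12),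
    .arith .shiftLeft (b + 7) (b + 7) b, .arith .add (b + 6) (b + 6) b,
    .arith .lt (b + 13) (b + 11) (b + 10)])

theorem ofNat_shiftLeft {v i : ℕ} (hi : i < 2 ^ w) (hv : 2 ^ i * v < 2 ^ w) :
    BitVec.ofNat w v <<< (BitVec.ofNat w i).toNat = BitVec.ofNat w (2 ^ i * v) := by
  have h : v < 2 ^ w := lt_of_le_of_lt (Nat.le_mul_of_pos_left v (by positivity)) hv
  apply BitVec.eq_of_toNat_eq
  rw [BitVec.toNat_shiftLeft, BitVec.toNat_ofNat, BitVec.toNat_ofNat, BitVec.toNat_ofNat,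
    Nat.mod_eq_of_lt h, Nat.mod_eq_of_lt hi, Nat.shiftLeft_eq, mul_comm]

theorem runs_timeLoop (O : BitVec w → BitVec w) (ψ : Basis w 63 → ℂ) (b : ℕ) {M v a : ℕ}
    (hM : 4 * M < 2 ^ w) (hv : v ≤ 4 * M) (hv0 : 0 < v) (ha : 4 ^ a ≤ v)
    (cl : ℕ → BitVec w) (h1 : cl b = 1) (h6 : cl (b + 6) = BitVec.ofNat w a)
    (h7 : cl (b + 7) = BitVec.ofNat w (2 ^ a)) (h10 : cl (b + 10) = BitVec.ofNat w M)
    (h11 : cl (b + 11) = BitVec.ofNat w v) (h12 : cl (b + 12) = BitVec.ofNat w 2)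
    (h13 : cl (b + 13) = if v < M then 1 else 0) :
    ∃ (e : ℕ) (cl' : ℕ → BitVec w), M ≤ 4 ^ e * v ∧ 4 ^ e * v ≤ 4 * M ∧
      (∀ j, j < b + 6 → cl' j = cl j) ∧ cl' (b + 6) = BitVec.ofNat w (a + e) ∧
      cl' (b + 7) = BitVec.ofNat w (2 ^ (a + e)) ∧
      Runs O (timeLoop b) (cl, ψ) (6 * e + 1) (cl', ψ) := by
  have hw4 : 4 < 2 ^ w := by
    have : 0 < M := by by_contra h; omega
    by_contra h
    omega
  have hw : 0 < w := by
    by_contra h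
    have : w = 0 := by omega
    subst this
    omega
  induction hd : M - v using Nat.strong_induction_on generalizing v a cl with
  | _ d ih =>
    by_cases hlt : v < M
    · rw [if_pos hlt] at h13
      have hb := runs_ofAssigns (m := 63) O [.arith .shiftLeft (b + 11) (b + 11) (b + 12),
        .arith .shiftLeft (b + 7) (b + 7) b, .arith .add (b + 6) (b + 6) b,
        .arith .lt (b + 13) (b + 11) (b + 10)] cl ψ
      set cl1 := [Assign.arith .shiftLeft (b + 11) (b + 11) (b + 12),
        .arith .shiftLeft (b + 7) (b + 7) b, .arith .add (b + 6) (b + 6) b,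
        .arith .lt (b + 13) (b + 11) (b + 10)].foldl (fun cl A => A.run cl) cl with hcl1
      have h4a : 4 ^ (a + 1) ≤ 4 * v := by rw [pow_succ]; omega
      have h2a : 2 ^ (a + 1) ≤ 4 ^ (a + 1) := Nat.pow_le_pow_left (by norm_num) _
      have e2 : BitVec.ofNat w v <<< (BitVec.ofNat w 2).toNat = BitVec.ofNat w (4 * v) :=
        ofNat_shiftLeft (by omega) (by omega)
      have e1' : BitVec.ofNat w (2 ^ a) <<< (1 : BitVec w).toNat = BitVec.ofNat w (2 ^ (a + 1)) := by
        have := ofNat_shiftLeft (w := w) (v := 2 ^ a) (i := 1) (by omega)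
          (by rw [← pow_add, add_comm]; omega)
        rw [← pow_add, add_comm 1 a] at this
        exact this
      have e1 : cl1 b = 1 := by simp [hcl1, Assign.run, h1]
      have e6 : cl1 (b + 6) = BitVec.ofNat w (a + 1) := by
        simp [hcl1, Assign.run, BinOp.eval, h1, h6, BitVec.ofNat_add]
      have e7 : cl1 (b + 7) = BitVec.ofNat w (2 ^ (a + 1)) := by
        rw [← e1', ← h7, ← h1]
        simp [hcl1, Assign.run, BinOp.eval]
      have e10 : cl1 (b + 10) = BitVec.ofNat w M := by simp [hcl1, Assign.run, h10]
      have e11 : cl1 (b + 11) = BitVec.ofNat w (4 * v) := by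
        rw [← e2, ← h11, ← h12]
        simp [hcl1, Assign.run, BinOp.eval]
      have e12 : cl1 (b + 12) = BitVec.ofNat w 2 := by simp [hcl1, Assign.run, h12]
      have e13 : cl1 (b + 13) = if 4 * v < M then 1 else 0 := by
        have : cl1 (b + 13) = if (cl1 (b + 11)).toNat < (cl1 (b + 10)).toNat then 1 else 0 := by
          simp [hcl1, Assign.run, BinOp.eval]
        rw [this, e10, e11, BitVec.toNat_ofNat, BitVec.toNat_ofNat, Nat.mod_eq_of_lt (by omega),
          Nat.mod_eq_of_lt (by omega)]
      obtain ⟨e, cl', hge, hle, hfr, h6', h7', hr⟩ := ih (M - 4 * v) (by omega) (by omega) (by omega)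
        h4a cl1 e1 e6 e7 e10 e11 e12 e13 rfl
      refine ⟨e + 1, cl', ?_, ?_, fun j hj => ?_, ?_, ?_, ?_⟩
      · rw [pow_succ, mul_assoc]; exact hge
      · rw [pow_succ, mul_assoc]; exact hle
      · rw [hfr j hj]
        simp [hcl1, Assign.run, show j ≠ b + 11 by omega, show j ≠ b + 7 by omega,
          show j ≠ b + 6 by omega, show j ≠ b + 13 by omega]
      · rw [h6']; congr 1; ring
      · rw [h7']; congr 2; ring
      · refine (Runs.loopTrue ?_ hb hr).cast (by simp only [List.length_cons, List.length_nil]; ring)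
        show cl (b + 13) ≠ 0
        rw [h13]
        exact ofNat_ne_zero (w := w) (a := 1) (by omega) (by norm_num)
    · rw [if_neg hlt] at h13
      exact ⟨0, cl, by omega, by omega, fun _ _ => rfl, h6, h7, Runs.loopFalse h13⟩

/-- The assignments that take into account one more parameter `r_{i+1}`, from the register `c`, for
the size of the starting sets and for the minimum of the parameters. -/
def scanBody (b c i : ℕ) : List Assign :=
  [.const (b + 13) (i + 1), .arith .mul (b + 13) (b + 13) c,
    .arith .add (b + 3) (b + 3) (b + 13), .arith .lt (b + 13) c (b + 4),
    .arith .sub (b + 14) c (b + 4), .arith .mul (b + 14) (b + 14) (b + 13),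
    .arith .add (b + 4) (b + 4) (b + 14)]

/-- Compute the size of the starting sets in the register `b + 3`, and the minimum of the
parameters in the register `b + 4`. -/
def scanProg (b : ℕ) : ℕ → Prog 63
  | 0 => .skip
  | i + 1 => .seq (scanProg b i) (.ofAssigns (scanBody b (i + 2) i))

theorem runs_scanProg (O : BitVec w → BitVec w) (ψ : Basis w 63 → ℂ) (b : ℕ) {r : ℕ → ℕ}
    (hr : ∀ i, r i < 2 ^ w) (i : ℕ) (hi : i + 1 ≤ b) (cl : ℕ → BitVec w)
    (h2 : ∀ j < i, cl (j + 2) = BitVec.ofNat w (r j)) (h3 : cl (b + 3) = 0)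
    (h4 : cl (b + 4) = BitVec.ofNat w (r 0)) :
    ∃ (μ : ℕ) (cl' : ℕ → BitVec w), (∀ j < i, μ ≤ r j) ∧ (μ = r 0 ∨ ∃ j < i, μ = r j) ∧
      (∀ j, j ≠ b + 3 → j ≠ b + 4 → j ≠ b + 13 → j ≠ b + 14 → cl' j = cl j) ∧
      cl' (b + 3) = BitVec.ofNat w (∑ j ∈ Finset.range i, (j + 1) * r j) ∧
      cl' (b + 4) = BitVec.ofNat w μ ∧ Runs O (scanProg b i) (cl, ψ) (8 * i + 1) (cl', ψ) := by
  induction i with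
  | zero => exact ⟨r 0, cl, by simp, Or.inl rfl, fun _ _ _ _ _ => rfl, by simpa using h3, h4,
      Runs.skip _⟩
  | succ i ih =>
    obtain ⟨μ, cl', hle, hex, hfr, h3', h4', hrun⟩ := ih (by omega) fun j hj => h2 j (by omega)
    have hμ : μ < 2 ^ w := by
      rcases hex with rfl | ⟨j, _, rfl⟩ <;> exact hr _
    obtain ⟨c, hc⟩ : ∃ c, c = i + 2 := ⟨_, rfl⟩
    have hb := runs_ofAssigns (m := 63) O (scanBody b c i) cl' ψ
    set cl1 := (scanBody b c i).foldl (fun cl A => A.run cl) cl' with hcl1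
    have hi2 : cl' c = BitVec.ofNat w (r i) := by
      rw [hc, hfr _ (by omega) (by omega) (by omega) (by omega), h2 i (by omega)]
    have n3 : c ≠ b + 3 := by omega
    have n13 : c ≠ b + 13 := by omega
    refine ⟨min (r i) μ, cl1, fun j hj => ?_, ?_, fun j j3 j4 j13 j14 => ?_, ?_, ?_, ?_⟩
    · rcases Nat.lt_succ_iff_lt_or_eq.1 hj with hj | rfl
      · exact (min_le_right _ _).trans (hle j hj)
      · exact min_le_left _ _
    · rcases min_choice (r i) μ with h | h
      · exact Or.inr ⟨i, by omega, h⟩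
      · rw [h]
        rcases hex with h | ⟨j, hj, h⟩
        · exact Or.inl h
        · exact Or.inr ⟨j, by omega, h⟩
    · rw [← hfr j j3 j4 j13 j14]
      simp [hcl1, scanBody, Assign.run, j3, j4, j13, j14]
    · rw [Finset.sum_range_succ, BitVec.ofNat_add, ← h3', BitVec.ofNat_mul, ← hi2]
      simp [hcl1, scanBody, Assign.run, BinOp.eval, n3, n13]
    · have hval : cl1 (b + 4) = cl' (b + 4) + (cl' c - cl' (b + 4)) *
          (if (cl' c).toNat < (cl' (b + 4)).toNat then 1 else 0) := by
        simp [hcl1, scanBody, Assign.run, BinOp.eval, n3, n13]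
      rw [hval, hi2, h4', BitVec.toNat_ofNat, BitVec.toNat_ofNat, Nat.mod_eq_of_lt (hr i),
        Nat.mod_eq_of_lt hμ]
      split_ifs with h
      · rw [min_eq_left h.le, show ∀ v : BitVec w, v * 1 = v from fun v => BitVec.mul_one v,
          BitVec.add_comm, BitVec.sub_add_cancel]
      · rw [min_eq_right (not_lt.1 h), show ∀ v : BitVec w, v * 0 = 0 from fun v => BitVec.mul_zero]
        exact BitVec.add_zero _
    · rw [scanProg, ← hc]
      refine (Runs.seq hrun hb).cast ?_
      simp only [scanBody, List.length_cons, List.length_nil]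
      ring

/-- The classical computation that precedes the quantum part: constants, parameters of the starting
sets, the number of bits of the directions, and the number of steps of the walk. -/
def classicalProg (k s K : ℕ) : Prog 63 :=
  let b := k + 1
  .seq (.ofAssigns [.const b 1, .const (b + 1) k, .const (b + 2) s, .const (b + 3) 0,
      .arith .or (b + 4) 2 2, .const (b + 5) 0, .arith .or (b + 8) 0 0, .const (b + 6) 0,
      .const (b + 7) 1, .const (b + 10) K, .arith .mul (b + 10) (b + 10) 0,
      .arith .mul (b + 10) (b + 10) 0, .const (b + 12) 2])
    (.seq (scanProg b (k - 1)) (.seq (sizeLoop b)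
      (.seq (.ofAssigns [.arith .add (b + 5) (b + 5) (b + 2), .arith .or (b + 11) (b + 4) (b + 4),
        .arith .lt (b + 13) (b + 11) (b + 10)]) (timeLoop b))))

theorem runs_classicalProg (O : BitVec w → BitVec w) (ψ : Basis w 63 → ℂ) {k : ℕ} (hk : 2 ≤ k)
    (s K n q : ℕ) {r : ℕ → ℕ} (hr : ∀ i, r i < 2 ^ w) (hr0 : ∀ i < k - 1, 0 < r i)
    (hn : n < 2 ^ w) (hrn : ∀ i < k - 1, r i ≤ 4 * (K * n * n)) (hK : 4 * (K * n * n) < 2 ^ w)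
    (cl : ℕ → BitVec w) (c0 : cl 0 = BitVec.ofNat w n) (c1 : cl 1 = BitVec.ofNat w q)
    (c2 : ∀ j < k - 1, cl (j + 2) = BitVec.ofNat w (r j)) :
    ∃ (μ ℓ a : ℕ) (cl' : ℕ → BitVec w),
      (∀ j < k - 1, μ ≤ r j) ∧ (∃ j < k - 1, μ = r j) ∧
      n < 2 ^ ℓ ∧ 2 ^ ℓ ≤ max 1 (2 * n) ∧ K * n * n ≤ 4 ^ a * μ ∧ 4 ^ a * μ ≤ 4 * (K * n * n) ∧
      cl' 0 = BitVec.ofNat w n ∧ cl' 1 = BitVec.ofNat w q ∧ cl' (k + 1) = 1 ∧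
      cl' (k + 1 + 1) = BitVec.ofNat w k ∧ cl' (k + 1 + 2) = BitVec.ofNat w s ∧
      cl' (k + 1 + 3) = BitVec.ofNat w (∑ j ∈ Finset.range (k - 1), (j + 1) * r j) ∧
      cl' (k + 1 + 5) = BitVec.ofNat w (ℓ + s) ∧ cl' (k + 1 + 6) = BitVec.ofNat w a ∧
      cl' (k + 1 + 7) = BitVec.ofNat w (2 ^ a) ∧
      Runs O (classicalProg k s K) (cl, ψ) (8 * k + 4 * ℓ + 6 * a + 13) (cl', ψ) := by
  set b := k + 1 with hb
  have hrpos : 0 < r 0 := hr0 0 (by omega)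
  have hw : 0 < w := by
    by_contra h
    have : w = 0 := by omega
    subst this
    have := hr 0
    omega
  have s1 := runs_ofAssigns (m := 63) O [.const b 1, .const (b + 1) k, .const (b + 2) s,
    .const (b + 3) 0, .arith .or (b + 4) 2 2, .const (b + 5) 0, .arith .or (b + 8) 0 0,
    .const (b + 6) 0, .const (b + 7) 1, .const (b + 10) K, .arith .mul (b + 10) (b + 10) 0,
    .arith .mul (b + 10) (b + 10) 0, .const (b + 12) 2] cl ψ
  set cl1 := [Assign.const b 1, .const (b + 1) k, .const (b + 2) s,
    .const (b + 3) 0, .arith .or (b + 4) 2 2, .const (b + 5) 0, .arith .or (b + 8) 0 0,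
    .const (b + 6) 0, .const (b + 7) 1, .const (b + 10) K, .arith .mul (b + 10) (b + 10) 0,
    .arith .mul (b + 10) (b + 10) 0, .const (b + 12) 2].foldl (fun cl A => A.run cl) cl with hcl1
  have fr1 : ∀ j < b, cl1 j = cl j := by
    intro j hj
    have e : ∀ i, j ≠ b + i := fun i => by omega
    have e' : j ≠ b := by omega
    simp [hcl1, Assign.run, e, e']
  have e0 : 0 ≠ b := by omega
  have e2 : 2 ≠ b := by omega
  have d2 : ∀ i, 2 ≠ b + i := fun i => by omega
  have v0 : cl1 b = 1 := by simp [hcl1, Assign.run]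
  have v1 : cl1 (b + 1) = BitVec.ofNat w k := by simp [hcl1, Assign.run]
  have v2 : cl1 (b + 2) = BitVec.ofNat w s := by simp [hcl1, Assign.run]
  have v3 : cl1 (b + 3) = 0 := by simp [hcl1, Assign.run]
  have v4 : cl1 (b + 4) = BitVec.ofNat w (r 0) := by
    rw [← c2 0 (by omega)]
    simp [hcl1, Assign.run, BinOp.eval, e2, d2]
  have v5 : cl1 (b + 5) = BitVec.ofNat w 0 := by simp [hcl1, Assign.run]
  have v6 : cl1 (b + 6) = BitVec.ofNat w 0 := by simp [hcl1, Assign.run]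
  have v7 : cl1 (b + 7) = BitVec.ofNat w (2 ^ 0) := by simp [hcl1, Assign.run]
  have v8 : cl1 (b + 8) = BitVec.ofNat w n := by
    rw [← c0]
    simp [hcl1, Assign.run, BinOp.eval, e0]
  have v10 : cl1 (b + 10) = BitVec.ofNat w (K * n * n) := by
    rw [BitVec.ofNat_mul, BitVec.ofNat_mul, ← c0]
    simp [hcl1, Assign.run, BinOp.eval, e0]
  have v12 : cl1 (b + 12) = BitVec.ofNat w 2 := by simp [hcl1, Assign.run]
  obtain ⟨μ, cl2, hle, hex, fr2, w3, w4, s2⟩ := runs_scanProg O ψ b hr (k - 1) (by omega) cl1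
    (fun j hj => by rw [fr1 _ (by omega), c2 j hj]) v3 v4
  have hex' : ∃ j < k - 1, μ = r j := by
    rcases hex with h | h
    · exact ⟨0, by omega, h⟩
    · exact h
  have hμ0 : 0 < μ := by obtain ⟨j, hj, rfl⟩ := hex'; exact hr0 j hj
  have hμ : μ < 2 ^ w := by obtain ⟨j, hj, rfl⟩ := hex'; exact hr j
  have hμK : μ ≤ 4 * (K * n * n) := by obtain ⟨j, hj, rfl⟩ := hex'; exact hrn j hj
  have fr2' : ∀ i, i ≠ 3 → i ≠ 4 → i ≠ 13 → i ≠ 14 → cl2 (b + i) = cl1 (b + i) :=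
    fun i _ _ _ _ => fr2 _ (by omega) (by omega) (by omega) (by omega)
  obtain ⟨ℓ, cl3, hlt, hleℓ, fr3, x5, s3⟩ := runs_sizeLoop O ψ b hw hn 0 cl2
    (by rw [← v0]; exact fr2' 0 (by omega) (by omega) (by omega) (by omega))
    (by rw [fr2' _ (by omega) (by omega) (by omega) (by omega), v5])
    (by rw [fr2' _ (by omega) (by omega) (by omega) (by omega), v8])
  have fr3' : ∀ i, i ≠ 3 → i ≠ 4 → i ≠ 13 → i ≠ 14 → i ≠ 5 → i ≠ 8 → cl3 (b + i) = cl1 (b + i) :=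
    fun i _ _ _ _ _ _ => by
      rw [fr3 _ (by omega) (by omega), fr2' _ (by omega) (by omega) (by omega) (by omega)]
  have s4 := runs_ofAssigns (m := 63) O [.arith .add (b + 5) (b + 5) (b + 2),
    .arith .or (b + 11) (b + 4) (b + 4), .arith .lt (b + 13) (b + 11) (b + 10)] cl3 ψ
  set cl4 := [Assign.arith .add (b + 5) (b + 5) (b + 2), .arith .or (b + 11) (b + 4) (b + 4),
    .arith .lt (b + 13) (b + 11) (b + 10)].foldl (fun cl A => A.run cl) cl3 with hcl4
  have fr4 : ∀ j, j ≠ b + 5 → j ≠ b + 11 → j ≠ b + 13 → cl4 j = cl3 j := by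
    intro j j5 j11 j13
    simp [hcl4, Assign.run, j5, j11, j13]
  have fr4' : ∀ i, i ≠ 3 → i ≠ 4 → i ≠ 13 → i ≠ 14 → i ≠ 5 → i ≠ 8 → i ≠ 11 →
      cl4 (b + i) = cl1 (b + i) := fun i _ _ _ _ _ _ _ => by
    rw [fr4 _ (by omega) (by omega) (by omega), fr3' _ (by omega) (by omega) (by omega) (by omega)
      (by omega) (by omega)]
  have y0 : cl4 b = 1 := by
    rw [← v0]
    exact fr4' 0 (by omega) (by omega) (by omega) (by omega) (by omega) (by omega) (by omega)
  have y2 : cl3 (b + 2) = BitVec.ofNat w s := by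
    rw [fr3' _ (by omega) (by omega) (by omega) (by omega) (by omega) (by omega), v2]
  have y4 : cl3 (b + 4) = BitVec.ofNat w μ := by rw [fr3 _ (by omega) (by omega), w4]
  have y10 : cl3 (b + 10) = BitVec.ofNat w (K * n * n) := by
    rw [fr3' _ (by omega) (by omega) (by omega) (by omega) (by omega) (by omega), v10]
  have z5 : cl4 (b + 5) = BitVec.ofNat w (ℓ + s) := by
    rw [BitVec.ofNat_add, ← y2, show BitVec.ofNat w ℓ = cl3 (b + 5) by rw [x5, zero_add]]
    simp [hcl4, Assign.run, BinOp.eval]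
  have z11 : cl4 (b + 11) = BitVec.ofNat w μ := by
    rw [← y4]
    simp [hcl4, Assign.run, BinOp.eval]
  have z13 : cl4 (b + 13) = if μ < K * n * n then 1 else 0 := by
    have : cl4 (b + 13) = if (cl3 (b + 4)).toNat < (cl3 (b + 10)).toNat then 1 else 0 := by
      simp [hcl4, Assign.run, BinOp.eval]
    rw [this, y4, y10, BitVec.toNat_ofNat, BitVec.toNat_ofNat, Nat.mod_eq_of_lt hμ,
      Nat.mod_eq_of_lt (by omega)]
  obtain ⟨a, cl5, hge, hlea, fr5, u6, u7, s5⟩ := runs_timeLoop O ψ b hK hμK hμ0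
    (show 4 ^ 0 ≤ μ by omega) cl4 y0
    (by rw [fr4' 6 (by omega) (by omega) (by omega) (by omega) (by omega) (by omega) (by omega), v6])
    (by rw [fr4' 7 (by omega) (by omega) (by omega) (by omega) (by omega) (by omega) (by omega), v7])
    (by rw [fr4' 10 (by omega) (by omega) (by omega) (by omega) (by omega) (by omega) (by omega),
      v10]) z11
    (by rw [fr4' 12 (by omega) (by omega) (by omega) (by omega) (by omega) (by omega) (by omega),
      v12]) z13
  rw [zero_add] at u6 u7
  have fr : ∀ j < b, cl5 j = cl j := fun j hj => by
    rw [fr5 j (by omega), fr4 j (by omega) (by omega) (by omega), fr3 j (by omega) (by omega),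
      fr2 j (by omega) (by omega) (by omega) (by omega), fr1 j hj]
  refine ⟨μ, ℓ, a, cl5, hle, hex', hlt, hleℓ, hge, hlea, ?_, ?_, ?_, ?_, ?_, ?_, ?_, u6, u7, ?_⟩
  · rw [fr 0 (by omega), c0]
  · rw [fr 1 (by omega), c1]
  · rw [fr5 _ (by omega), y0]
  · rw [fr5 _ (by omega),
      fr4' 1 (by omega) (by omega) (by omega) (by omega) (by omega) (by omega) (by omega), v1]
  · rw [fr5 _ (by omega),
      fr4' 2 (by omega) (by omega) (by omega) (by omega) (by omega) (by omega) (by omega), v2]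
  · rw [fr5 _ (by omega), fr4 _ (by omega) (by omega) (by omega), fr3 _ (by omega) (by omega), w3]
  · rw [fr5 _ (by omega), z5]
  · refine (Runs.seq s1 (Runs.seq s2 (Runs.seq s3 (Runs.seq s4 s5)))).cast ?_
    simp only [List.length_cons, List.length_nil]
    omega

end QRam

namespace KDistinctness

open QRam CoinedWalk PhaseDetection

variable {n q w : ℕ}

/-! ### Choice of the parameters, and the theorem -/

/-- The binary logarithm of the number of directions per position of the input, large enough for
the flow to be small compared with the starting vector. -/
def dirBits (k : ℕ) : ℕ := 2 * k + 3

/-- The constant for which `T ^ 2 * r ≥ timeConst k * n ^ 2` makes `T` steps of the walk suffice. -/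
def timeConst (k : ℕ) : ℕ := 3 * 2 ^ (dirBits k + 1) * (k ^ 2 * 2 ^ k + 1)

theorem le_two_pow_dirBits (k : ℕ) : 2 ^ (k + 2) * k + 1 ≤ 2 ^ dirBits k := by
  have h1 : 2 ^ (k + 2) * k ≤ 2 ^ (k + 2) * 2 ^ k :=
    Nat.mul_le_mul_left _ Nat.lt_two_pow_self.le
  have h2 : 0 < 2 ^ (k + 2) * 2 ^ k := by positivity
  have h3 : 2 ^ dirBits k = 2 * (2 ^ (k + 2) * 2 ^ k) := by
    rw [dirBits, ← pow_add, ← pow_succ']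
    congr 1
    ring
  omega

theorem dirBits_lt_timeConst (k : ℕ) : dirBits k < timeConst k := by
  have h : dirBits k + 1 < 2 ^ (dirBits k + 1) := Nat.lt_two_pow_self
  have : 2 ^ (dirBits k + 1) ≤ timeConst k := by
    rw [timeConst, mul_comm 3, mul_assoc]
    exact Nat.le_mul_of_pos_right _ (by positivity)
  omega

theorem le_timeConst (k : ℕ) : k ≤ timeConst k := by
  have := dirBits_lt_timeConst k
  rw [dirBits] at this
  omega

/-- Words of this length are long enough for all numbers that occur. -/
theorem wordLength_bounds {k z : ℕ} (hz : 0 < z) (hnq : n + q < 2 ^ z)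
    (hw : w = (timeConst k + 4) * z) :
    q + n + k + 1 < 2 ^ w ∧ 4 * (timeConst k * n * n) < 2 ^ w ∧ dirBits k + z + 1 ≤ w := by
  have hk := le_timeConst k
  have hs := dirBits_lt_timeConst k
  set K := timeConst k
  have hw' : w = K * z + 4 * z := by rw [hw]; ring
  have hKz : K ≤ K * z := Nat.le_mul_of_pos_right K hz
  refine ⟨?_, ?_, by omega⟩
  · have h1 : 2 ^ z * 2 ^ (K + 1) ≤ 2 ^ w := by
      rw [← pow_add]
      exact Nat.pow_le_pow_right (by norm_num) (by omega)
    have h2 : K + 1 < 2 ^ (K + 1) := Nat.lt_two_pow_self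
    have h3 : 1 ≤ 2 ^ z := Nat.one_le_two_pow
    nlinarith
  · have h1 : 2 ^ (K + 2) * (2 ^ z * 2 ^ z) ≤ 2 ^ w := by
      rw [← pow_add, ← pow_add]
      exact Nat.pow_le_pow_right (by norm_num) (by omega)
    have h2 : 4 * K < 2 ^ (K + 2) := by
      have : K < 2 ^ K := Nat.lt_two_pow_self
      rw [pow_add]; omega
    have h3 : n * n ≤ 2 ^ z * 2 ^ z := Nat.mul_le_mul (by omega) (by omega)
    calc 4 * (K * n * n) = 4 * K * (n * n) := by ring
      _ ≤ 4 * K * (2 ^ z * 2 ^ z) := Nat.mul_le_mul_left _ h3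
      _ < 2 ^ (K + 2) * (2 ^ z * 2 ^ z) := Nat.mul_lt_mul_of_pos_right h2 (by positivity)
      _ ≤ 2 ^ w := h1

theorem add_one_le_log {ℓ : ℕ} (h : 2 ^ ℓ ≤ max 1 (2 * n)) :
    (ℓ : ℝ) + 1 ≤ 4 * Real.log (n + 2) := by
  have h1 : 2 ^ (ℓ + 1) ≤ (n + 2) ^ 2 := by
    rw [pow_succ]
    rcases le_max_iff.1 h with h | h <;> nlinarith [Nat.zero_le (n * n)]
  have h2 : ((ℓ : ℝ) + 1) * Real.log 2 ≤ 2 * Real.log (n + 2) := by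
    have h3 : ((2 : ℝ) ^ (ℓ + 1)) ≤ ((n : ℝ) + 2) ^ 2 := by exact_mod_cast h1
    have h4 := Real.log_le_log (by positivity) h3
    rw [Real.log_pow, Real.log_pow] at h4
    push_cast at h4
    exact h4
  have h5 := Real.log_two_gt_d9
  nlinarith [show (0 : ℝ) ≤ ℓ by positivity]

theorem two_pow_le_div_sqrt {K a μ : ℕ} (hμ : 0 < μ) (hK : 1 ≤ K)
    (h : 4 ^ a * μ ≤ 4 * (K * n * n)) : (2 : ℝ) ^ a ≤ 2 * K * (n / Real.sqrt μ) := by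
  have hsq : 0 < Real.sqrt μ := Real.sqrt_pos.2 (by exact_mod_cast hμ)
  have hsq2 : Real.sqrt μ ^ 2 = μ := Real.sq_sqrt (by positivity)
  rw [mul_div_assoc', le_div_iff₀ hsq]
  refine le_of_sq_le_sq ?_ (by positivity)
  have h1 : (4 : ℝ) ^ a * μ ≤ 4 * (K * n * n) := by exact_mod_cast h
  have h2 : ((2 : ℝ) ^ a) ^ 2 = 4 ^ a := by rw [← pow_mul, mul_comm, pow_mul]; norm_num
  have h3 : (1 : ℝ) ≤ K := by exact_mod_cast hK
  rw [mul_pow, h2, hsq2]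
  have : (0 : ℝ) ≤ n * n := by positivity
  nlinarith [mul_le_mul_of_nonneg_right h3 (mul_nonneg (by linarith : (0 : ℝ) ≤ K) this)]

/-- The algorithm for `k`-distinctness. -/
def distinctnessProg (k : ℕ) : Prog 63 :=
  .seq (classicalProg k (dirBits k) (timeConst k)) (quantumProg (k + 1))

/-- The constant factor in the running time. -/
def runningConst (k : ℕ) : ℕ :=
  8 * k + 8 * dirBits k + stepOverhead (k + 1) + quantumOverhead (k + 1) + 45

theorem steps_le (k ℓ a so qo s : ℕ) :
    8 * k + 4 * ℓ + 6 * a + 13 + (2 ^ a * (8 * (ℓ + s) + 6 + so) + 8 * a + qo) ≤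
      (8 * k + 8 * s + so + qo + 45) * (2 ^ a * (ℓ + 1)) := by
  have ha : a < 2 ^ a := Nat.lt_two_pow_self
  set T := 2 ^ a
  have h1 : T ≤ T * (ℓ + 1) := Nat.le_mul_of_pos_right _ (Nat.succ_pos _)
  have h2 : ℓ + 1 ≤ T * (ℓ + 1) := Nat.le_mul_of_pos_left _ (by omega)
  have h3 : T * ℓ ≤ T * (ℓ + 1) := Nat.mul_le_mul_left _ (by omega)
  have h4 := Nat.mul_le_mul_left (8 * s + so + 6) h1
  have h5 := Nat.mul_le_mul_left (8 * k + qo) (show 1 ≤ T * (ℓ + 1) by omega)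
  have e : T * (8 * (ℓ + s) + 6 + so) = 8 * (T * ℓ) + (8 * s + so + 6) * T := by ring
  rw [e]
  generalize T * (ℓ + 1) = X at *
  have e2 : (8 * k + 8 * s + so + qo + 45) * X =
    (8 * s + so + 6) * X + (8 * k + qo) * X + 39 * X := by ring
  rw [e2]
  omega

end KDistinctness

open KDistinctness in
/-- For every `k ≥ 2` there is one program that, on words of `O(log (n + q))` bits and given the
uniform superposition over `V_0`, decides `k`-distinctness with error at most `1/3` in
`O(n / √(min r_i) · polylog n)` steps. -/
theorem lemma4p2 (k : ℕ) (hk : 2 ≤ k) :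
    ∃ (m : ℕ) (P : QRam.Prog m) (c C d : ℕ), 1 ≤ c ∧
      ∀ (n q : ℕ) (r : Fin (k - 1) → ℕ) (x : Fin n → Fin q) (w : ℕ),
        (∀ i, 0 < r i) →
        (KDistinctness.startSets k r x).Nonempty →
        w = c * Nat.size (n + q) →
        ∃ (t : ℕ) (s : QRam.State w m),
          QRam.Runs (KDistinctness.oracle w x) P (KDistinctness.initialState w m k r x) t s ∧
          (t : ℝ) ≤ C * (n / Real.sqrt ((⨅ i, r i : ℕ) : ℝ)) * Real.log (n + 2) ^ d ∧
          (KDistinctness.HasCollision k x → 2 / 3 ≤ QRam.acceptProb s) ∧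
          (¬ KDistinctness.HasCollision k x → QRam.acceptProb s ≤ 1 / 3) := by
  refine ⟨63, distinctnessProg k, timeConst k + 4, 8 * timeConst k * runningConst k, 1, by omega, ?_⟩
  intro n q r x w hr hne hw
  obtain ⟨S₀, h₀⟩ := hne
  have hK1 : 1 ≤ timeConst k := by have := dirBits_lt_timeConst k; omega
  have hsize := startSize_le h₀ (by omega)
  have hrn : ∀ i, r i ≤ n := fun i => by
    refine le_trans ?_ hsize
    refine le_trans ?_ (Finset.single_le_sum (f := fun i : Fin (k - 1) => ((i : ℕ) + 1) * r i)
      (fun _ _ => Nat.zero_le _) (Finset.mem_univ i))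
    exact Nat.le_mul_of_pos_left _ (Nat.succ_pos _)
  let i₀ : Fin (k - 1) := ⟨0, by omega⟩
  have hn : 0 < n := lt_of_lt_of_le (hr i₀) (hrn i₀)
  have hnq : n + q < 2 ^ Nat.size (n + q) := Nat.lt_size_self _
  have hz : 0 < Nat.size (n + q) := Nat.size_pos.2 (by omega)
  obtain ⟨hw1, hw2, hw3⟩ := wordLength_bounds hz hnq hw
  have hww : w < 2 ^ w := Nat.lt_two_pow_self
  let r' : ℕ → ℕ := fun i => if h : i < k - 1 then r ⟨i, h⟩ else 0
  have hr' : ∀ (i : ℕ) (h : i < k - 1), r' i = r ⟨i, h⟩ := fun i h => dif_pos h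
  have hr'n : ∀ i, r' i ≤ n := fun i => by
    simp only [r']
    split_ifs with h
    · exact hrn _
    · exact Nat.zero_le _
  have hnK : n ≤ 4 * (timeConst k * n * n) := by
    have h1 : 1 ≤ timeConst k * n := Nat.mul_pos hK1 hn
    have h2 := Nat.le_mul_of_pos_left n h1
    omega
  obtain ⟨μ, ℓ, a, cl, hμle, ⟨j, hj, hμj⟩, hlt, hle, hge, hlea, c0, c1, b0, b1, b2, b3, b5, b6, b7,
    s1⟩ := QRam.runs_classicalProg (oracle w x) (initialState w 63 k r x).2 hk (dirBits k)
      (timeConst k) n q (r := r') (fun i => by have := hr'n i; omega)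
      (fun i hi => by rw [hr' i hi]; exact hr _) (by omega)
      (fun i _ => (hr'n i).trans hnK) hw2 (parameters w k n q r) rfl rfl
      (fun i hi => by simp only [parameters, dif_pos hi, hr' i hi])
  rw [hr' j hj] at hμj
  have hμ0 : 0 < μ := by rw [hμj]; exact hr _
  have hμr : ∀ i, μ ≤ r i := fun i => by
    have := hμle i i.isLt
    rwa [hr' i i.isLt] at this
  have hinf : ⨅ i, r i = μ := by
    have : Nonempty (Fin (k - 1)) := ⟨i₀⟩
    refine le_antisymm ?_ (le_ciInf hμr)
    rw [hμj]
    exact ciInf_le (OrderBot.bddBelow _) _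
  have hsum : ∑ j ∈ Finset.range (k - 1), (j + 1) * r' j = startSize k r := by
    rw [Finset.sum_range, startSize]
    exact Finset.sum_congr rfl fun i _ => by rw [hr' i i.isLt]
  rw [hsum] at b3
  have hmax : max 1 (2 * n) = 2 * n := max_eq_right (by omega)
  have hℓz : ℓ ≤ Nat.size (n + q) := by
    rw [hmax] at hle
    have : 2 ^ ℓ < 2 ^ (Nat.size (n + q) + 1) := by rw [pow_succ 2 (Nat.size _)]; omega
    have := (Nat.pow_lt_pow_iff_right (by norm_num)).1 this
    omega
  have haw : a < w := by
    have h1 : 4 ^ a ≤ 4 ^ a * μ := Nat.le_mul_of_pos_right _ hμ0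
    have h2 : 2 ^ a ≤ 4 ^ a := Nat.pow_le_pow_left (by norm_num) _
    exact (Nat.pow_lt_pow_iff_right (by norm_num)).1
      (lt_of_le_of_lt (h2.trans (h1.trans hlea)) hw2)
  have hL : ℓ + dirBits k ≤ w := by omega
  obtain ⟨st, s2, hacc⟩ := runs_quantumProg (k := k) (s := dirBits k) (r := r) (x := x) hw1
    (by omega) (by omega) hL haw (k + 1) cl c0 c1 b0 b1 b2 b3 b5 b6 b7
  refine ⟨_, st, QRam.Runs.seq s1 s2, ?_, fun hc => ?_, fun hc => ?_⟩
  · have h1 := steps_le k ℓ a (stepOverhead (k + 1)) (quantumOverhead (k + 1)) (dirBits k)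
    have h2 := add_one_le_log hle
    have h3 := two_pow_le_div_sqrt hμ0 hK1 hlea
    rw [hinf, pow_one]
    refine (Nat.cast_le.2 h1).trans ?_
    have h4 : (2 : ℝ) ^ a * (ℓ + 1) ≤
        2 * timeConst k * (n / Real.sqrt μ) * (4 * Real.log (n + 2)) :=
      mul_le_mul h3 h2 (by positivity) (by positivity)
    have h5 := mul_le_mul_of_nonneg_left h4 (Nat.cast_nonneg (α := ℝ) (runningConst k))
    rw [runningConst] at h5 ⊢
    push_cast at h5 ⊢
    linarith
  · rw [hacc]
    refine le_dot_average_of_hasCollision hc (by omega) ⟨S₀, h₀⟩ (by omega) (by omega) hL ?_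
      (le_two_pow_dirBits k) (by positivity)
    rw [pow_add]
    exact Nat.mul_le_mul_right _ hlt.le
  · rw [hacc]
    refine (dot_average_le_of_not_hasCollision hc (by omega) h₀ (by omega) hL (dirBits k) (2 ^ a)
      (ρ := μ) hμr ((hμr i₀).trans (hrn i₀)) hμ0).trans ?_
    have hpos : (0 : ℝ) < μ * ((2 ^ a : ℕ) : ℝ) ^ 2 := by
      have : (0 : ℝ) < μ := by exact_mod_cast hμ0
      positivity
    rw [div_le_iff₀ hpos]
    have h1 : 3 * (2 ^ (ℓ + dirBits k) * (n * (k ^ 2 * 2 ^ k + 1))) ≤ μ * (2 ^ a) ^ 2 := by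
      have e1 : μ * (2 ^ a) ^ 2 = 4 ^ a * μ := by
        rw [← pow_mul, mul_comm a 2, pow_mul, mul_comm]; norm_num
      rw [e1]
      refine le_trans ?_ hge
      rw [hmax] at hle
      calc 3 * (2 ^ (ℓ + dirBits k) * (n * (k ^ 2 * 2 ^ k + 1)))
          = 2 ^ ℓ * (3 * 2 ^ dirBits k * (n * (k ^ 2 * 2 ^ k + 1))) := by rw [pow_add]; ring
        _ ≤ 2 * n * (3 * 2 ^ dirBits k * (n * (k ^ 2 * 2 ^ k + 1))) := Nat.mul_le_mul_right _ hle
        _ = timeConst k * n * n := by rw [timeConst, pow_succ]; ring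
    have h2 : (3 : ℝ) * (2 ^ (ℓ + dirBits k) * (n * (k ^ 2 * 2 ^ k + 1))) ≤
        μ * ((2 ^ a : ℕ) : ℝ) ^ 2 := by exact_mod_cast h1
    linarith
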